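/- **Setting.** A represented space is a set $X$ with a surjective partial map $\delta_X:\subseteq\mathbb{N}^{\mathbb{N}}\to X$; if $\delta_X(p)=x$, then $p$ is called a name of $x$. A problem $f:\subseteq X\rightrightarrows Y$ is a partial multi-valued function between represented spaces, with domain $\mathrm{dom}(f)=\{x\in X: f(x)\neq\emptyset\}$. A partial function $F:\subseteq\mathbb{N}^{\mathbb{N}}\to\mathbb{N}^{\mathbb{N}}$ realizes $f$, written $F\vdash f$, if $\delta_Y(F(p))\in f(\delta_X(p))$ for every name $p$ of a point of $\mathrm{dom}(f)$. We write $f\leq_{\mathrm{W}} g$ if there are computable $H,K:\subseteq\mathbb{N}^{\mathbb{N}}\to\mathbb{N}^{\mathbb{N}}$ such that $p\mapsto H\langle p,G(K(p))\rangle$ realizes $f$ for every $G\vdash g$, and $f\leq_{\mathrm{sW}} g$ if there are computable $H,K$ such that $p\mapsto H(G(K(p)))$ realizes $f$ for every $G\vdash g$. The relations $\equiv_{\mathrm{W}}$ and $\equiv_{\mathrm{sW}}$ mean reducibility in both directions. The parallelization $\widehat f:\subseteq X^{\mathbb{N}}\rightrightarrows Y^{\mathbb{N}}$ maps $(x_i)_i$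 to the set of all $(y_i)_i$ with $y_i\in f(x_i)$ for all $i$, where $\langle p_0,p_1,\dots\rangle$ is a name of $(x_i)_i$ if each $p_i$ is a name of $x_i$. The jump $f'$ is $f$ with the input representation $\delta_X$ replaced by $\delta_X\circ\lim$, where $\lim\langle p_0,p_1,\dots\rangle=\lim_{i\to\infty}p_i$ in $\mathbb{N}^{\mathbb{N}}$; $f^{(n)}$ is the $n$-fold jump of $f$. The problem $\mathsf{WKL}$ maps an infinite binary tree, given by its characteristic function, to the set of its infinite paths in $2^{\mathbb{N}}$. Let $n\geq1$, and let $k\geq1$ be a natural number, identified with $\{0,\dots,k-1\}$, or $k=\mathbb{N}$. Let $\mathcal{C}_{n,k}$ be the set of colorings $c:[\mathbb{N}]^n\to k$ of the $n$-element subsets of $\mathbb{N}$ (for $k=\mathbb{N}$, only those with finite range), where a name of $c$ lists the values of $c$ along a standard numbering of $[\mathbb{N}]^n$. A set $M\subseteq\mathbb{N}$ is homogeneous for $c$ if $c$ has a constant value on $[M]^n$; for infinite $M$ this value is denoted by $c(M)$. The coloring $c$ is stable if $\lim_{i\to\infty}c(A\cup\{i\})$ exists for all $A\in[\mathbb{N}]^{n-1}$.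 The problem $\mathsf{RT}_{n,k}$ maps $c\in\mathcal{C}_{n,k}$ to the set of infinite homogeneous sets $M$ for $c$, given by their characteristic functions, and $\mathsf{CRT}_{n,k}$ maps $c$ to the set of all pairs $(c(M),M)\in k\times2^{\mathbb{N}}$ for such $M$. The problems $\mathsf{SRT}_{n,k}$ and $\mathsf{CSRT}_{n,k}$ are the restrictions of $\mathsf{RT}_{n,k}$ and $\mathsf{CRT}_{n,k}$, respectively, to stable colorings. **Corollary 4.19.** Let $k\geq2$ be a natural number or $k=\mathbb{N}$. 1. For all $n\geq1$: $\ \widehat{\mathsf{RT}_{n,k}}\equiv_{\mathrm{W}}\mathsf{WKL}^{(n)}\equiv_{\mathrm{sW}}\widehat{\mathsf{CRT}_{n,k}}$. 2. For all $n\geq2$: $\ \widehat{\mathsf{SRT}_{n,k}}\equiv_{\mathrm{W}}\mathsf{WKL}^{(n)}\equiv_{\mathrm{sW}}\widehat{\mathsf{CSRT}_{n,k}}$. -/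

import Mathlib

namespace Weihrauch

open Filter Topology

/-! ### Baire space, tupling and computable partial functions -/

/-- Baire space `ℕ^ℕ`. -/
abbrev Baire : Type := ℕ → ℕ

/-- The finite initial segment `p(0) … p(l-1)`. -/
def initSeg (p : Baire) (l : ℕ) : List ℕ := (List.range l).map p

/-- Computability of a partial function on Baire space (Type-2 computability): some computable
word function, monotone for the prefix order, maps the initial segments of every `p` in the domain
to initial segments of `F p` that exhaust `F p`. -/
def ComputableFun (F : Baire →. Baire) : Prop :=
  ∃ g : List ℕ → List ℕ, Computable g ∧ (∀ u v, u <+: v → g u <+: g v) ∧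
    ∀ p q, q ∈ F p → ∀ n, ∃ l, (g (initSeg p l))[n]? = some (q n)

/-- The pair `⟨p, q⟩ = p(0) q(0) p(1) q(1) …`. -/
def pairB (p q : Baire) : Baire := fun n => if n % 2 = 0 then p (n / 2) else q (n / 2)

/-- The `i`-th component of `⟨p₀, p₁, p₂, …⟩`, where `⟨p₀, p₁, …⟩⟨i, j⟩ = p_i(j)`. -/
def component (p : Baire) (i : ℕ) : Baire := fun j => p (Nat.pair i j)

/-- The countable tuple `⟨p₀, p₁, p₂, …⟩`. -/
def tupleB (p : ℕ → Baire) : Baire := fun m => p (Nat.unpair m).1 (Nat.unpair m).2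

/-- The graph of `lim : ⊆ ℕ^ℕ → ℕ^ℕ`, `⟨p₀, p₁, …⟩ ↦ lim p_i`: `q = lim p`. -/
def IsLim (p q : Baire) : Prop := Tendsto (fun i => component p i) atTop (𝓝 q)

theorem pairB_left (p q : Baire) (n : ℕ) : pairB p q (2 * n) = p n := by
  simp [pairB]

theorem pairB_right (p q : Baire) (n : ℕ) : pairB p q (2 * n + 1) = q n := by
  have h : (2 * n + 1) / 2 = n := by omega
  have h' : (2 * n + 1) % 2 ≠ 0 := by omega
  simp [pairB, h]

theorem pairB_inj {p q p' q' : Baire} (h : pairB p q = pairB p' q') : p = p' ∧ q = q' :=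
  ⟨funext fun n => by rw [← pairB_left p q n, h, pairB_left],
    funext fun n => by rw [← pairB_right p q n, h, pairB_right]⟩

theorem component_tupleB (p : ℕ → Baire) (i : ℕ) : component (tupleB p) i = p i := by
  funext j
  simp [component, tupleB]

/-! ### Represented spaces -/

/-- A represented space: a set with a surjective partial map `δ : ⊆ ℕ^ℕ → X`, given by its graph:
`Names p x` says that `p ∈ dom δ` and `δ p = x`. -/
structure RepSpace where
  carrier : Type
  Names : Baire → carrier → Prop
  unique : ∀ p x y, Names p x → Names p y → x = y
  surj : ∀ x, ∃ p, Names p x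

namespace RepSpace

/-- The jump `δ' = δ ∘ lim` of a representation. -/
def jump (X : RepSpace) : RepSpace where
  carrier := X.carrier
  Names p x := ∃ q, IsLim p q ∧ X.Names q x
  unique := by
    rintro p x y ⟨q, hq, hx⟩ ⟨r, hr, hy⟩
    obtain rfl := tendsto_nhds_unique hq hr
    exact X.unique q x y hx hy
  surj x := by
    obtain ⟨p, hp⟩ := X.surj x
    refine ⟨tupleB fun _ => p, p, ?_, hp⟩
    simp only [IsLim, component_tupleB]
    exact tendsto_const_nhds

/-- The countable power `X^ℕ`; `⟨p₀, p₁, …⟩` is a name of `(x_i)` if each `p_i` names `x_i`. -/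
def seq (X : RepSpace) : RepSpace where
  carrier := ℕ → X.carrier
  Names p x := ∀ i, X.Names (component p i) (x i)
  unique p x y hx hy := funext fun i => X.unique _ _ _ (hx i) (hy i)
  surj x := by
    choose p hp using fun i => X.surj (x i)
    exact ⟨tupleB p, fun i => by rw [component_tupleB]; exact hp i⟩

/-- The product `X × Y`; `⟨p, q⟩` names `(x, y)` if `p` names `x` and `q` names `y`. -/
def prod (X Y : RepSpace) : RepSpace where
  carrier := X.carrier × Y.carrier
  Names r z := ∃ p q, r = pairB p q ∧ X.Names p z.1 ∧ Y.Names q z.2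
  unique := by
    rintro r z w ⟨p, q, rfl, h1, h2⟩ ⟨p', q', h, h3, h4⟩
    obtain ⟨rfl, rfl⟩ := pairB_inj h
    exact Prod.ext (X.unique _ _ _ h1 h3) (Y.unique _ _ _ h2 h4)
  surj z := by
    obtain ⟨p, hp⟩ := X.surj z.1
    obtain ⟨q, hq⟩ := Y.surj z.2
    exact ⟨_, p, q, rfl, hp, hq⟩

/-- Cantor space `2^ℕ`; its points are also read as characteristic functions of subsets of `ℕ`. -/
def cantor : RepSpace where
  carrier := ℕ → Bool
  Names p x := ∀ i, p i = (x i).toNat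
  unique p x y hx hy := funext fun i => by
    have h : (x i).toNat = (y i).toNat := (hx i).symm.trans (hy i)
    cases hi : x i <;> cases hj : y i <;> simp_all
  surj x := ⟨fun i => (x i).toNat, fun _ => rfl⟩

/-- The discrete space `k = {0, …, k-1}` for finite `k`, and `ℕ` for `k = ⊤`; `δ p = p(0)`. -/
def colors (k : ℕ∞) : RepSpace where
  carrier := {m : ℕ // (m : ℕ∞) < k}
  Names p m := p 0 = m
  unique _ _ _ hx hy := Subtype.ext (hx.symm.trans hy)
  surj m := ⟨fun _ => m, rfl⟩

end RepSpace

/-! ### Problems, operations on problems, and reducibilities -/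

/-- A problem: a partial multi-valued function `f : ⊆ X ⇉ Y` between represented spaces. Its domain
is `{x | f(x) ≠ ∅}`. -/
structure Problem where
  X : RepSpace
  Y : RepSpace
  sol : X.carrier → Set Y.carrier

namespace Problem

/-- The domain of a problem. -/
def dom (f : Problem) : Set f.X.carrier := {x | (f.sol x).Nonempty}

/-- `F ⊢ f`: for each name `p` of a point `x ∈ dom f`, `F p` is defined and names a point of
`f(x)`. -/
def Realizes (F : Baire →. Baire) (f : Problem) : Prop :=
  ∀ p x, f.X.Names p x → x ∈ f.dom → ∃ q ∈ F p, ∃ y, f.Y.Names q y ∧ y ∈ f.sol x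

/-- Weihrauch reducibility `f ≤_W g`: there are computable `H, K : ⊆ ℕ^ℕ → ℕ^ℕ` such that
`H⟨id, G K⟩ ⊢ f` for all `G ⊢ g`. -/
def LeW (f g : Problem) : Prop :=
  ∃ H K : Baire →. Baire, ComputableFun H ∧ ComputableFun K ∧
    ∀ G : Baire →. Baire, Realizes G g →
      Realizes (fun p => (K p).bind fun q => (G q).bind fun r => H (pairB p r)) f

/-- Strong Weihrauch reducibility `f ≤_sW g`: there are computable `H, K : ⊆ ℕ^ℕ → ℕ^ℕ` such that
`H G K ⊢ f` for all `G ⊢ g`. -/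
def LeSW (f g : Problem) : Prop :=
  ∃ H K : Baire →. Baire, ComputableFun H ∧ ComputableFun K ∧
    ∀ G : Baire →. Baire, Realizes G g →
      Realizes (fun p => (K p).bind fun q => (G q).bind fun r => H r) f

/-- Weihrauch equivalence `f ≡_W g`. -/
def EquivW (f g : Problem) : Prop := LeW f g ∧ LeW g f

/-- Strong Weihrauch equivalence `f ≡_sW g`. -/
def EquivSW (f g : Problem) : Prop := LeSW f g ∧ LeSW g f

/-- The parallelization of `f`: solve countably many instances of `f` in parallel. -/
def parallelization (f : Problem) : Problem where
  X := f.X.seq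
  Y := f.Y.seq
  sol x := {y : ℕ → f.Y.carrier | ∀ i, y i ∈ f.sol (x i)}

/-- The jump `f'`: the same problem, with the jump of the input representation. -/
def jump (f : Problem) : Problem where
  X := f.X.jump
  Y := f.Y
  sol := f.sol

/-- The `n`-fold jump `f^(n)`. -/
def iterJump (n : ℕ) (f : Problem) : Problem := jump^[n] f

end Problem

/-! ### Weak Kőnig's lemma -/

/-- Binary trees: sets of finite binary words that are closed under prefixes. -/
def BinTree : Type := {T : Set (List Bool) // ∀ u v, u <+: v → v ∈ T → u ∈ T}

/-- The space `Tr` of binary trees, represented by characteristic functions with respect to the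
standard coding of binary words as natural numbers. -/
def treeSpace : RepSpace where
  carrier := BinTree
  Names p T := ∀ w : List Bool,
    (w ∈ T.1 → p (Encodable.encode w) = 1) ∧ (w ∉ T.1 → p (Encodable.encode w) = 0)
  unique p S T hS hT := by
    refine Subtype.ext (Set.ext fun w => ?_)
    have hS := hS w
    have hT := hT w
    by_cases h1 : w ∈ S.1 <;> by_cases h2 : w ∈ T.1 <;> simp_all
  surj T := by
    classical
    refine ⟨fun m => if ∃ w ∈ T.1, Encodable.encode w = m then 1 else 0, fun w => ⟨fun h => ?_,
      fun h => ?_⟩⟩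
    · exact if_pos ⟨w, h, rfl⟩
    · refine if_neg ?_
      rintro ⟨v, hv, e⟩
      exact h (Encodable.encode_injective e ▸ hv)

/-- Weak Kőnig's lemma: given an infinite binary tree, find an infinite path. -/
def WKL : Problem where
  X := treeSpace
  Y := RepSpace.cantor
  sol T := {x : ℕ → Bool | T.1.Infinite ∧ ∀ l, (List.range l).map x ∈ T.1}

/-! ### Ramsey's theorem -/

/-- The sets underlying the numbering of `[ℕ]^n`:
`⟨i₀, …, i_{n-1}⟩ ↦ {i₀ < i₀ + i₁ + 1 < i₀ + i₁ + i₂ + 2 < …}`. -/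
def thetaSet : ℕ → ℕ → Finset ℕ
  | 0, _ => ∅
  | 1, i => {i}
  | n + 2, i => insert (Nat.unpair i).1
      ((thetaSet (n + 1) (Nat.unpair i).2).map (addLeftEmbedding ((Nat.unpair i).1 + 1)))

theorem thetaSet_card : ∀ n i, (thetaSet n i).card = n
  | 0, _ => rfl
  | 1, _ => rfl
  | n + 2, i => by
    rw [thetaSet, Finset.card_insert_of_notMem, Finset.card_map, thetaSet_card (n + 1)]
    simp only [Finset.mem_map, addLeftEmbedding_apply, not_exists, not_and]
    omega

/-- The total standard numbering `ϑ_n : ℕ → [ℕ]^n`. -/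
def theta (n i : ℕ) : Set.powersetCard ℕ n := ⟨thetaSet n i, thetaSet_card n i⟩

theorem thetaSet_surj : ∀ (n : ℕ) (s : Finset ℕ), s.card = n → ∃ i, thetaSet n i = s
  | 0, s, h => ⟨0, (Finset.card_eq_zero.mp h).symm⟩
  | 1, s, h => by
    obtain ⟨a, rfl⟩ := Finset.card_eq_one.mp h
    exact ⟨a, rfl⟩
  | n + 2, s, h => by
    have hne : s.Nonempty := Finset.card_pos.mp (by omega)
    set a := s.min' hne with ha
    have hlt : ∀ x ∈ s.erase a, a + 1 ≤ x := fun x hx =>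
      Finset.min'_lt_of_mem_erase_min' s hne hx
    have hcard : ((s.erase a).image fun x => x - (a + 1)).card = n + 1 := by
      rw [Finset.card_image_of_injOn, Finset.card_erase_of_mem (s.min'_mem hne), h]
      · rfl
      · intro x hx y hy hxy
        have h1 := hlt x hx
        have h2 := hlt y hy
        simp only at hxy
        omega
    obtain ⟨j, hj⟩ := thetaSet_surj (n + 1) _ hcard
    refine ⟨Nat.pair a j, ?_⟩
    rw [thetaSet, Nat.unpair_pair, hj]
    conv_rhs => rw [← Finset.insert_erase (s.min'_mem hne)]
    congr 1
    ext x
    simp only [Finset.mem_map, Finset.mem_image, addLeftEmbedding_apply]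
    constructor
    · rintro ⟨_, ⟨y, hy, rfl⟩, rfl⟩
      have := hlt y hy
      rwa [show a + 1 + (y - (a + 1)) = y by omega]
    · intro hx
      have := hlt x hx
      exact ⟨_, ⟨x, hx, rfl⟩, by omega⟩

theorem theta_surj (n : ℕ) (A : Set.powersetCard ℕ n) : ∃ i, theta n i = A := by
  obtain ⟨i, hi⟩ := thetaSet_surj n A.1 A.2
  exact ⟨i, Subtype.ext hi⟩

/-- `C_{n,k}`: colorings of the `n`-element subsets of `ℕ` with colors `< k`. For `k = ⊤`, which
stands for `k = ℕ`, these are the colorings with colors in `ℕ` and a finite range (for finite `k`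
the range is finite anyway). -/
def Coloring (n : ℕ) (k : ℕ∞) : Type :=
  {c : Set.powersetCard ℕ n → ℕ // (∀ A, (c A : ℕ∞) < k) ∧ (Set.range c).Finite}

/-- The represented space `C_{n,k}`; `p` names `c` if `p(i) = c(ϑ_n(i))` for all `i`. -/
def coloringSpace (n : ℕ) (k : ℕ∞) : RepSpace where
  carrier := Coloring n k
  Names p c := ∀ i, p i = c.1 (theta n i)
  unique p c d hc hd := by
    refine Subtype.ext (funext fun A => ?_)
    obtain ⟨i, rfl⟩ := theta_surj n A
    exact (hc i).symm.trans (hd i)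
  surj c := ⟨fun i => c.1 (theta n i), fun _ => rfl⟩

namespace Coloring

variable {n : ℕ} {k : ℕ∞}

/-- `M` (a characteristic function) is an infinite homogeneous set for `c`, with color
`c(M) = j`. -/
def HomogeneousWithColor (c : Coloring n k) (M : ℕ → Bool) (j : ℕ) : Prop :=
  {i | M i = true}.Infinite ∧
    ∀ A : Set.powersetCard ℕ n, (∀ i ∈ (A : Finset ℕ), M i = true) → c.1 A = j

/-- `M ∈ H_c`: `M` is an infinite homogeneous set for `c`. -/
def Homogeneous (c : Coloring n k) (M : ℕ → Bool) : Prop := ∃ j, c.HomogeneousWithColor M j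

/-- `c` is stable: `lim_{i → ∞} c(A ∪ {i})` exists for all `A ∈ [ℕ]^{n-1}`. -/
def Stable (c : Coloring n k) : Prop :=
  ∀ A : Finset ℕ, A.card + 1 = n → ∃ j, ∀ᶠ i in atTop,
    ∃ h : insert i A ∈ Set.powersetCard ℕ n, c.1 ⟨insert i A, h⟩ = j

end Coloring

/-- `RT_{n,k}`: given a coloring, find an infinite homogeneous set. -/
def RT (n : ℕ) (k : ℕ∞) : Problem where
  X := coloringSpace n k
  Y := RepSpace.cantor
  sol c := {M : ℕ → Bool | Coloring.Homogeneous c M}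

/-- `CRT_{n,k}`: given a coloring, find an infinite homogeneous set together with its color. -/
def CRT (n : ℕ) (k : ℕ∞) : Problem where
  X := coloringSpace n k
  Y := (RepSpace.colors k).prod RepSpace.cantor
  sol c := {y : {m : ℕ // (m : ℕ∞) < k} × (ℕ → Bool) |
    Coloring.HomogeneousWithColor c y.2 y.1.1}

/-- `SRT_{n,k}`: the restriction of `RT_{n,k}` to stable colorings. -/
def SRT (n : ℕ) (k : ℕ∞) : Problem where
  X := coloringSpace n k
  Y := RepSpace.cantor
  sol c := {M | Coloring.Stable c ∧ M ∈ (RT n k).sol c}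

/-- `CSRT_{n,k}`: the restriction of `CRT_{n,k}` to stable colorings. -/
def CSRT (n : ℕ) (k : ℕ∞) : Problem where
  X := coloringSpace n k
  Y := (RepSpace.colors k).prod RepSpace.cantor
  sol c := {y | Coloring.Stable c ∧ y ∈ (CRT n k).sol c}

end Weihrauch

/-! Two strong reductions carry everything: WKL^(n) reduces to the parallelization of CRT_{n,2}, and
even of CSRT_{n,2} for n ≥ 2; conversely CRT_{n,ℕ} reduces to WKL^(n), which absorbs
parallelization. The other reductions come from enlarging the palette, restricting to stable
colorings, and forgetting the color. In the opposite direction the color is computable from the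
coloring and a homogeneous set, which costs access to the instance and so gives only an ordinary
Weihrauch reduction.

Lower bound. Suppose a binary tree is given as a limit. For each word w, stages are colored by which
of the two subtrees above w currently looks higher. If the subtree above w is infinite, a color
occurring infinitely often points to a child with an infinite subtree, so the colors for all w
determine a path (`WKL_jump_sRed_CRT`). Higher n follow by induction, since CRT_{n,2}' reduces to
CSRT_{n+1,2}: the color of A ∪ {i} with i above A is the i-th approximation to the color of A, which
gives a stable coloring with the same homogeneous sets and colors (`CRT_jump_sRed_CSRT`).

Upper bound, by induction on n. For n = 1, the colors that occur infinitely often form a closed set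
in a compact box, computable as a limit (`CRT_one_sRed`). For the step, an Erdős–Rado argument is
used: a prescription d of colors determines a greedy sequence along which the color of an (n+1)-set
does not depend on its largest element. The prescriptions with infinite greedy sequences form a
nonempty closed set, again computable as a limit, and d is then an n-coloring whose homogeneous sets
transfer to the original coloring. Choosing d and then solving an instance of WKL^(n) computed from
d would naively cost too many jumps. A uniform low basis theorem (`exists_wordMap_lowBasis`) repairs
this: for a suitable d, the limit of what is computed from d is itself computable as a limit from
the closed set. Hence one additional jump suffices (`CRT_succ_sRed`).

WKL is closed under parallelization and under products with the identity, because closed subsets of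
computable compact boxes can be coded by binary trees (`cl_sRed_WKL`). Both properties pass to
jumps, and the second turns ordinary reductions to WKL^(n) into strong ones. All reductions are
given by primitive recursive monotone word functions. -/

namespace Weihrauch

open Filter Topology Problem

/-! ### Primitive recursiveness by `fun_prop` -/

attribute [fun_prop] Primrec

namespace Prim

variable {α β γ σ : Type} [Primcodable α] [Primcodable β] [Primcodable γ] [Primcodable σ]

@[fun_prop]
theorem id' : Primrec (fun a : α => a) := Primrec.id

@[fun_prop]
theorem const' (b : β) : Primrec (fun _ : α => b) := Primrec.const b

@[fun_prop]
theorem comp' {f : β → γ} {g : α → β} (hf : Primrec f) (hg : Primrec g) :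
    Primrec fun a => f (g a) := hf.comp hg

@[fun_prop]
theorem pair' {f : α → β} {g : α → γ} (hf : Primrec f) (hg : Primrec g) :
    Primrec fun a => (f a, g a) := hf.pair hg

@[fun_prop]
theorem fst' {f : α → β × γ} (hf : Primrec f) : Primrec fun a => (f a).1 := Primrec.fst.comp hf

@[fun_prop]
theorem snd' {f : α → β × γ} (hf : Primrec f) : Primrec fun a => (f a).2 := Primrec.snd.comp hf

section Arith

variable {f g : α → ℕ}

@[fun_prop]
theorem add (hf : Primrec f) (hg : Primrec g) : Primrec fun a => f a + g a :=
  Primrec.nat_add.comp hf hg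

@[fun_prop]
theorem sub (hf : Primrec f) (hg : Primrec g) : Primrec fun a => f a - g a :=
  Primrec.nat_sub.comp hf hg

@[fun_prop]
theorem mul (hf : Primrec f) (hg : Primrec g) : Primrec fun a => f a * g a :=
  Primrec.nat_mul.comp hf hg

@[fun_prop]
theorem div (hf : Primrec f) (hg : Primrec g) : Primrec fun a => f a / g a :=
  Primrec.nat_div.comp hf hg

@[fun_prop]
theorem mod (hf : Primrec f) (hg : Primrec g) : Primrec fun a => f a % g a :=
  Primrec.nat_mod.comp hf hg

@[fun_prop]
theorem min' (hf : Primrec f) (hg : Primrec g) : Primrec fun a => min (f a) (g a) :=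
  Primrec.nat_min.comp hf hg

@[fun_prop]
theorem max' (hf : Primrec f) (hg : Primrec g) : Primrec fun a => max (f a) (g a) :=
  Primrec.nat_max.comp hf hg

@[fun_prop]
theorem natPair (hf : Primrec f) (hg : Primrec g) : Primrec fun a => Nat.pair (f a) (g a) :=
  Primrec₂.natPair.comp hf hg

@[fun_prop]
theorem unpair (hf : Primrec f) : Primrec fun a => Nat.unpair (f a) := Primrec.unpair.comp hf

@[fun_prop]
theorem decide_le (hf : Primrec f) (hg : Primrec g) : Primrec fun a => decide (f a ≤ g a) :=
  (Primrec.nat_le.comp hf hg).decide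

@[fun_prop]
theorem decide_lt (hf : Primrec f) (hg : Primrec g) : Primrec fun a => decide (f a < g a) :=
  (Primrec.nat_lt.comp hf hg).decide

end Arith

section Logic

@[fun_prop]
theorem decide_eq [DecidableEq β] {f g : α → β} (hf : Primrec f) (hg : Primrec g) :
    Primrec fun a => decide (f a = g a) := (Primrec.eq.comp hf hg).decide

@[fun_prop]
theorem and' {f g : α → Bool} (hf : Primrec f) (hg : Primrec g) : Primrec fun a => f a && g a :=
  Primrec.and.comp hf hg

@[fun_prop]
theorem or' {f g : α → Bool} (hf : Primrec f) (hg : Primrec g) : Primrec fun a => f a || g a :=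
  Primrec.or.comp hf hg

@[fun_prop]
theorem not' {f : α → Bool} (hf : Primrec f) : Primrec fun a => !(f a) := Primrec.not.comp hf

@[fun_prop]
theorem ite' {c : α → Prop} [DecidablePred c] {f g : α → β} (hc : Primrec fun a => decide (c a))
    (hf : Primrec f) (hg : Primrec g) : Primrec fun a => if c a then f a else g a :=
  Primrec.ite hc.primrecPred hf hg

@[fun_prop]
theorem toNat' {f : α → Bool} (hf : Primrec f) : Primrec fun a => (f a).toNat :=
  (Primrec.dom_bool Bool.toNat).comp hf

end Logic

section Opt

@[fun_prop]
theorem some' {f : α → β} (hf : Primrec f) : Primrec fun a => some (f a) :=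
  Primrec.option_some.comp hf

@[fun_prop]
theorem bind' {f : α → Option β} {g : α → β → Option γ} (hf : Primrec f)
    (hg : Primrec fun x : α × β => g x.1 x.2) : Primrec fun a => (f a).bind (g a) :=
  Primrec.option_bind hf hg

@[fun_prop]
theorem option_map' {f : α → Option β} {g : α → β → γ} (hf : Primrec f)
    (hg : Primrec fun x : α × β => g x.1 x.2) : Primrec fun a => (f a).map (g a) :=
  Primrec.option_map hf hg

@[fun_prop]
theorem option_getD' {f : α → Option β} {g : α → β} (hf : Primrec f) (hg : Primrec g) :
    Primrec fun a => (f a).getD (g a) := Primrec.option_getD.comp hf hg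

@[fun_prop]
theorem isSome' {f : α → Option β} (hf : Primrec f) : Primrec fun a => (f a).isSome :=
  Primrec.option_isSome.comp hf

@[fun_prop]
theorem encode' {f : α → β} (hf : Primrec f) : Primrec fun a => Encodable.encode (f a) :=
  Primrec.encode.comp hf

@[fun_prop]
theorem decode' {f : α → ℕ} (hf : Primrec f) :
    Primrec fun a => (Encodable.decode (f a) : Option β) := Primrec.decode.comp hf

end Opt

section Lists

@[fun_prop]
theorem map' {f : α → List β} {g : α → β → γ} (hf : Primrec f)
    (hg : Primrec fun p : α × β => g p.1 p.2) : Primrec fun a => (f a).map (g a) :=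
  Primrec.list_map hf hg

@[fun_prop]
theorem range {f : α → ℕ} (hf : Primrec f) : Primrec fun a => List.range (f a) :=
  Primrec.list_range.comp hf

@[fun_prop]
theorem getElem? {f : α → List β} {g : α → ℕ} (hf : Primrec f) (hg : Primrec g) :
    Primrec fun a => (f a)[g a]? := Primrec.list_getElem?.comp hf hg

@[fun_prop]
theorem getD {f : α → List β} {g : α → ℕ} (d : β) (hf : Primrec f) (hg : Primrec g) :
    Primrec fun a => (f a).getD (g a) d := (Primrec.list_getD d).comp hf hg

@[fun_prop]
theorem length {f : α → List β} (hf : Primrec f) : Primrec fun a => (f a).length :=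
  Primrec.list_length.comp hf

@[fun_prop]
theorem append {f g : α → List β} (hf : Primrec f) (hg : Primrec g) :
    Primrec fun a => f a ++ g a := Primrec.list_append.comp hf hg

@[fun_prop]
theorem cons {f : α → β} {g : α → List β} (hf : Primrec f) (hg : Primrec g) :
    Primrec fun a => f a :: g a := Primrec.list_cons.comp hf hg

@[fun_prop]
theorem take {f : α → ℕ} {g : α → List β} (hf : Primrec f) (hg : Primrec g) :
    Primrec fun a => (g a).take (f a) := Primrec.list_take.comp hf hg

@[fun_prop]
theorem tail {g : α → List β} (hg : Primrec g) : Primrec fun a => (g a).tail :=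
  Primrec.list_tail.comp hg

@[fun_prop]
theorem flatMap {f : α → List β} {g : α → β → List γ} (hf : Primrec f)
    (hg : Primrec fun p : α × β => g p.1 p.2) : Primrec fun a => (f a).flatMap (g a) :=
  Primrec.list_flatMap hf hg

@[fun_prop]
theorem foldr {f : α → List β} {g : α → σ} {h : α → β → σ → σ} (hf : Primrec f) (hg : Primrec g)
    (hh : Primrec fun p : α × β × σ => h p.1 p.2.1 p.2.2) :
    Primrec fun a => (f a).foldr (h a) (g a) :=
  Primrec.list_foldr (h := fun a x => h a x.1 x.2) hf hg hh

@[fun_prop]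
theorem all {f : α → List β} {g : α → β → Bool} (hf : Primrec f)
    (hg : Primrec fun p : α × β => g p.1 p.2) : Primrec fun a => (f a).all (g a) := by
  have h : Primrec fun a => (f a).foldr (fun b r => g a b && r) true :=
    foldr hf (Primrec.const true)
      (Primrec.and.comp (hg.comp (Primrec.fst.pair (Primrec.fst.comp Primrec.snd)))
        (Primrec.snd.comp Primrec.snd))
  refine h.of_eq fun a => ?_
  induction f a <;> simp_all

@[fun_prop]
theorem any {f : α → List β} {g : α → β → Bool} (hf : Primrec f)
    (hg : Primrec fun p : α × β => g p.1 p.2) : Primrec fun a => (f a).any (g a) := by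
  have h : Primrec fun a => (f a).foldr (fun b r => g a b || r) false :=
    foldr hf (Primrec.const false)
      (Primrec.or.comp (hg.comp (Primrec.fst.pair (Primrec.fst.comp Primrec.snd)))
        (Primrec.snd.comp Primrec.snd))
  refine h.of_eq fun a => ?_
  induction f a <;> simp_all

@[fun_prop]
theorem findSome? {f : α → List β} {g : α → β → Option γ} (hf : Primrec f)
    (hg : Primrec fun p : α × β => g p.1 p.2) : Primrec fun a => (f a).findSome? (g a) := by
  have h : Primrec fun a => (f a).foldr (fun b r => (g a b) <|> r) none :=
    foldr hf (Primrec.const none)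
      (Primrec.option_orElse.comp (hg.comp (Primrec.fst.pair (Primrec.fst.comp Primrec.snd)))
        (Primrec.snd.comp Primrec.snd))
  refine h.of_eq fun a => ?_
  induction f a with
  | nil => rfl
  | cons b l ih => cases hb : g a b <;> simp_all [List.findSome?]

@[fun_prop]
theorem find? {f : α → List β} {g : α → β → Bool} (hf : Primrec f)
    (hg : Primrec fun p : α × β => g p.1 p.2) : Primrec fun a => (f a).find? (g a) := by
  have h : Primrec fun a => (f a).findSome? fun b => if g a b = true then some b else none := by
    have : Primrec fun p : α × β => decide (g p.1 p.2 = true) := by simpa using hg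
    exact findSome? hf (ite' this (by fun_prop) (by fun_prop))
  refine h.of_eq fun a => ?_
  induction f a with
  | nil => rfl
  | cons b l ih => cases hb : g a b <;> simp_all [List.findSome?, List.find?]

end Lists

@[fun_prop]
theorem natRec {n : α → ℕ} {f : α → β} {g : α → ℕ → β → β} (hn : Primrec n) (hf : Primrec f)
    (hg : Primrec fun x : α × ℕ × β => g x.1 x.2.1 x.2.2) :
    Primrec fun a => (Nat.rec (f a) (g a) (n a) : β) :=
  Primrec.nat_rec' (h := fun a x => g a x.1 x.2) hn hf hg

end Prim

/-! ### Initial segments and word maps -/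

section InitSeg

variable (p q : Baire) (l m n : ℕ)

@[simp]
theorem length_initSeg : (initSeg p l).length = l := by simp [initSeg]

theorem initSeg_getElem? : (initSeg p l)[n]? = if n < l then some (p n) else none := by
  simp only [initSeg, List.getElem?_map]
  split_ifs with h
  · rw [List.getElem?_range h]; rfl
  · rw [List.getElem?_eq_none (by simpa using h)]; rfl

variable {l n} in
theorem initSeg_getElem?_of_lt (h : n < l) : (initSeg p l)[n]? = some (p n) := by
  rw [initSeg_getElem?, if_pos h]

variable {p l n} in
theorem eq_of_initSeg_getElem? {v : ℕ} (h : (initSeg p l)[n]? = some v) : n < l ∧ p n = v := by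
  rw [initSeg_getElem?] at h
  split_ifs at h with h'
  exact ⟨h', Option.some.inj h⟩

variable {l n} in
theorem initSeg_getD (h : n < l) (d : ℕ) : (initSeg p l).getD n d = p n := by
  rw [List.getD_eq_getElem?_getD, initSeg_getElem?_of_lt p h]; rfl

@[simp]
theorem getElem_initSeg (h : n < (initSeg p l).length) : (initSeg p l)[n] = p n := by
  simp [initSeg]

theorem initSeg_take : (initSeg p l).take m = initSeg p (min m l) := by
  simp [initSeg, ← List.map_take, List.take_range]

variable {m l} in
theorem initSeg_take_of_le (h : m ≤ l) : (initSeg p l).take m = initSeg p m := by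
  rw [initSeg_take, min_eq_left h]

variable {l m} in
theorem initSeg_isPrefix (h : l ≤ m) : initSeg p l <+: initSeg p m := by
  rw [← initSeg_take_of_le p h]; exact List.take_prefix _ _

theorem initSeg_succ : initSeg p (l + 1) = initSeg p l ++ [p l] := by
  simp [initSeg, List.range_succ]

variable {p q l} in
theorem initSeg_congr (h : ∀ i < l, p i = q i) : initSeg p l = initSeg q l :=
  List.map_congr_left fun i hi => h i (List.mem_range.mp hi)

end InitSeg

theorem getElem?_of_isPrefix {u v : List ℕ} (h : u <+: v) {n a : ℕ} (hn : u[n]? = some a) :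
    v[n]? = some a := by
  obtain ⟨w, rfl⟩ := h
  rw [List.getElem?_append_left (List.getElem?_eq_some_iff.mp hn).1, hn]

/-- A primitive recursive monotone word function. -/
def IsWordMap (g : List ℕ → List ℕ) : Prop := Primrec g ∧ ∀ u v, u <+: v → g u <+: g v

/-- The word function `g` sends (the initial segments of) `p` to `q`. -/
def Maps (g : List ℕ → List ℕ) (p q : Baire) : Prop :=
  ∀ n, ∃ l, (g (initSeg p l))[n]? = some (q n)

theorem Maps.eventually {g : List ℕ → List ℕ} (hg : IsWordMap g) {p q : Baire} (h : Maps g p q)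
    (n : ℕ) : ∃ l, ∀ m, l ≤ m → (g (initSeg p m))[n]? = some (q n) := by
  obtain ⟨l, hl⟩ := h n
  exact ⟨l, fun m hm => getElem?_of_isPrefix (hg.2 _ _ (initSeg_isPrefix p hm)) hl⟩

/-- Letters are never revised: by monotonicity an early output letter reappears on every longer
prefix, in particular on one where the correct letter is known to be present. -/
theorem Maps.sound {g : List ℕ → List ℕ} (hg : IsWordMap g) {p q : Baire} (h : Maps g p q)
    {n l v : ℕ} (hv : (g (initSeg p l))[n]? = some v) : v = q n := by
  obtain ⟨l', hl'⟩ := h.eventually hg n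
  have h1 := hl' (max l l') (le_max_right _ _)
  have h2 := getElem?_of_isPrefix (hg.2 _ _ (initSeg_isPrefix p (le_max_left l l'))) hv
  exact Option.some.inj (h2.symm.trans h1)

theorem Maps.unique {g : List ℕ → List ℕ} (hg : IsWordMap g) {p q r : Baire} (h : Maps g p q)
    (h' : Maps g p r) : q = r := by
  funext n
  obtain ⟨l, hl⟩ := h n
  exact h'.sound hg hl

theorem Maps.prefix_word {g : List ℕ → List ℕ} (hg : IsWordMap g) {p q : Baire} (h : Maps g p q)
    (m : ℕ) : ∃ l, initSeg q m <+: g (initSeg p l) := by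
  have : ∃ l, ∀ n < m, (g (initSeg p l))[n]? = some (q n) := by
    induction m with
    | zero => exact ⟨0, by simp⟩
    | succ m ih =>
      obtain ⟨l, hl⟩ := ih
      obtain ⟨l', hl'⟩ := h.eventually hg m
      refine ⟨max l l', fun n hn => ?_⟩
      rcases Nat.lt_succ_iff_lt_or_eq.mp hn with hn | rfl
      · exact getElem?_of_isPrefix (hg.2 _ _ (initSeg_isPrefix p (le_max_left l l'))) (hl n hn)
      · exact hl' _ (le_max_right _ _)
  obtain ⟨l, hl⟩ := this
  refine ⟨l, ?_⟩
  rw [List.prefix_iff_getElem?]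
  intro i hi
  have hi' : i < m := by simpa using hi
  rw [hl i hi', ← initSeg_getElem?_of_lt q hi', List.getElem?_eq_getElem hi]

theorem IsWordMap.comp {g h : List ℕ → List ℕ} (hg : IsWordMap g) (hh : IsWordMap h) :
    IsWordMap fun u => g (h u) :=
  ⟨hg.1.comp hh.1, fun u v huv => hg.2 _ _ (hh.2 u v huv)⟩

theorem Maps.comp {g h : List ℕ → List ℕ} (hg : IsWordMap g) (hh : IsWordMap h) {p q r : Baire}
    (h2 : Maps g q r) (h1 : Maps h p q) : Maps (fun u => g (h u)) p r := by
  intro n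
  obtain ⟨l, hl⟩ := h2 n
  obtain ⟨m, hm⟩ := h1.prefix_word hh l
  exact ⟨m, getElem?_of_isPrefix (hg.2 _ _ hm) hl⟩

theorem isWordMap_id : IsWordMap fun u => u := ⟨Primrec.id, fun _ _ h => h⟩

theorem maps_id (p : Baire) : Maps (fun u => u) p p :=
  fun n => ⟨n + 1, initSeg_getElem?_of_lt p n.lt_succ_self⟩

/-! ### Functionals given by unbounded search -/

section OfSearch

variable (φ : List ℕ → ℕ → ℕ → Option ℕ)

/-- The first value found for position `n` by a search through the prefixes of `u`. -/
def firstVal (u : List ℕ) (n : ℕ) : Option ℕ :=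
  (List.range u.length).findSome? fun e => φ (u.take e.unpair.1) n e.unpair.2

/-- The longest word (of length at most `k`) of values found by searching through `u`. -/
def searchWord (u : List ℕ) (k : ℕ) : List ℕ :=
  Nat.rec [] (fun _ w => ((firstVal φ u w.length).map fun v => w ++ [v]).getD w) k

theorem findSome?_range_mono {f g : ℕ → Option ℕ} {k l : ℕ} (hkl : k ≤ l)
    (hfg : ∀ e < k, f e = g e) {v : ℕ} (h : (List.range k).findSome? f = some v) :
    (List.range l).findSome? g = some v := by
  obtain ⟨m, rfl⟩ := Nat.exists_eq_add_of_le hkl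
  rw [List.range_add, List.findSome?_append]
  have : (List.range k).findSome? g = (List.range k).findSome? f := by
    clear h hkl
    induction k with
    | zero => rfl
    | succ k ih =>
      rw [List.range_succ, List.findSome?_append, List.findSome?_append,
        ih fun e he => hfg e (he.trans k.lt_succ_self)]
      simp [List.findSome?, hfg k k.lt_succ_self]
  rw [this, h]; rfl

/-- A search step `e` uses the prefix of length `e.unpair.1 ≤ e`. As `e < u.length`, this prefix
lies inside `u`; a longer input adds steps at the end but does not change the earlier ones. -/
theorem firstVal_mono {u v : List ℕ} (h : u <+: v) {n a : ℕ} (ha : firstVal φ u n = some a) :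
    firstVal φ v n = some a := by
  refine findSome?_range_mono h.length_le (fun e he => ?_) ha
  obtain ⟨w, rfl⟩ := h
  rw [List.take_append_of_le_length ((Nat.unpair_left_le e).trans he.le)]

/-- By the last clause the word stops short of `k` only where the search fails. This yields both
monotonicity and exhaustiveness in `exists_wordMap`. -/
theorem searchWord_valid (u : List ℕ) (k : ℕ) :
    (searchWord φ u k).length ≤ k ∧
    (∀ n (hn : n < (searchWord φ u k).length), firstVal φ u n = some (searchWord φ u k)[n]) ∧
    ((searchWord φ u k).length < k → firstVal φ u (searchWord φ u k).length = none) := by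
  induction k with
  | zero => simp [searchWord]
  | succ k ih =>
    obtain ⟨h1, h2, h3⟩ := ih
    have hs : searchWord φ u (k + 1) = ((firstVal φ u (searchWord φ u k).length).map
      fun v => searchWord φ u k ++ [v]).getD (searchWord φ u k) := rfl
    cases hv : firstVal φ u (searchWord φ u k).length with
    | none =>
      rw [hv] at hs
      simp only [Option.map_none, Option.getD_none] at hs
      simp only [hs]
      exact ⟨by omega, h2, fun _ => hv⟩
    | some a =>
      rw [hv] at hs
      simp only [Option.map_some, Option.getD_some] at hs
      simp only [hs]
      refine ⟨by simpa using h1, fun n hn => ?_, fun hlt => ?_⟩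
      · rw [List.getElem_append]
        split_ifs with hn'
        · exact h2 n hn'
        · have : n = (searchWord φ u k).length := by simp at hn; omega
          subst this
          simpa using hv
      · have hk : ¬ (searchWord φ u k).length < k := fun h => by simp [h3 h] at hv
        simp at hlt
        omega

/-- A primitive recursive search procedure yields a word map. -/
theorem exists_wordMap (hφ : Primrec fun x : List ℕ × ℕ × ℕ => φ x.1 x.2.1 x.2.2) :
    ∃ g, IsWordMap g ∧ ∀ p q : Baire, (∀ n, ∃ l s, φ (initSeg p l) n s = some (q n)) →
      (∀ n l s v, φ (initSeg p l) n s = some v → v = q n) → Maps g p q := by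
  have hfv : Primrec fun x : List ℕ × ℕ => firstVal φ x.1 x.2 := by
    unfold firstVal
    have : Primrec fun y : (List ℕ × ℕ) × ℕ =>
        φ (y.1.1.take y.2.unpair.1) y.1.2 y.2.unpair.2 :=
      hφ.comp (by fun_prop : Primrec fun y : (List ℕ × ℕ) × ℕ =>
        (y.1.1.take y.2.unpair.1, y.1.2, y.2.unpair.2))
    fun_prop
  have hstep : Primrec fun x : List ℕ × ℕ × List ℕ =>
      ((firstVal φ x.1 x.2.2.length).map fun v => x.2.2 ++ [v]).getD x.2.2 := by
    have : Primrec fun x : List ℕ × ℕ × List ℕ => firstVal φ x.1 x.2.2.length :=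
      hfv.comp (by fun_prop : Primrec fun x : List ℕ × ℕ × List ℕ => (x.1, x.2.2.length))
    fun_prop
  refine ⟨fun u => searchWord φ u u.length, ⟨?_, fun u v huv => ?_⟩, fun p q hex hs n => ?_⟩
  · unfold searchWord
    exact Prim.natRec (by fun_prop) (by fun_prop) hstep
  · obtain ⟨a1, a2, -⟩ := searchWord_valid φ u u.length
    obtain ⟨b1, b2, b3⟩ := searchWord_valid φ v v.length
    have hval : ∀ n (hn : n < (searchWord φ u u.length).length),
        firstVal φ v n = some (searchWord φ u u.length)[n] :=
      fun n hn => firstVal_mono φ huv (a2 n hn)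
    have hlen : (searchWord φ u u.length).length ≤ (searchWord φ v v.length).length := by
      by_contra hlt
      push Not at hlt
      have := b3 (by have := huv.length_le; omega)
      rw [hval _ hlt] at this
      simp at this
    rw [List.prefix_iff_getElem?]
    intro i hi
    have hi' := hi.trans_le hlen
    rw [List.getElem?_eq_getElem hi']
    exact (b2 i hi').symm.trans (hval i hi)
  · have hfst : ∀ n, ∃ l, ∀ m, l ≤ m → firstVal φ (initSeg p m) n = some (q n) := by
      intro n
      obtain ⟨l, s, h⟩ := hex n
      refine ⟨Nat.pair l s + 1, fun m hm => ?_⟩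
      have hne : (firstVal φ (initSeg p m) n).isSome := by
        rw [firstVal, List.findSome?_isSome_iff]
        refine ⟨Nat.pair l s, by simp; omega, ?_⟩
        have : l ≤ m := (Nat.left_le_pair l s).trans (by omega)
        simp [initSeg_take_of_le p this, h]
      obtain ⟨a, ha⟩ := Option.isSome_iff_exists.mp hne
      rw [ha]
      obtain ⟨e, -, he⟩ := List.exists_of_findSome?_eq_some ha
      rw [initSeg_take] at he
      rw [hs _ _ _ _ he]
    have hall : ∃ l, ∀ i ≤ n, firstVal φ (initSeg p l) i = some (q i) := by
      choose L hL using hfst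
      refine ⟨(Finset.range (n + 1)).sup L, fun i hi => hL i _ ?_⟩
      exact Finset.le_sup (Finset.mem_range.mpr (by omega))
    obtain ⟨l, hl⟩ := hall
    -- The input length also caps the number of output letters, so at least `n + 1` is needed for
    -- position `n`.
    refine ⟨max l (n + 1), ?_⟩
    have hl' : ∀ i ≤ n, firstVal φ (initSeg p (max l (n + 1))) i = some (q i) := fun i hi =>
      firstVal_mono φ (initSeg_isPrefix p (le_max_left _ _)) (hl i hi)
    obtain ⟨-, b2, b3⟩ := searchWord_valid φ (initSeg p (max l (n + 1)))
      (initSeg p (max l (n + 1))).length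
    have hlen : n < (searchWord φ (initSeg p (max l (n + 1)))
        (initSeg p (max l (n + 1))).length).length := by
      by_contra hlt
      push Not at hlt
      have := b3 ((hlt.trans_lt (by omega : n < max l (n + 1))).trans_eq
        (length_initSeg p _).symm)
      rw [hl' _ hlt] at this
      simp at this
    rw [List.getElem?_eq_getElem hlen, ← b2 n hlen, hl' n le_rfl]

end OfSearch

/-- A functional that reads a primitive recursively bounded part of its argument. -/
theorem exists_wordMap_of_bound (B : ℕ → ℕ) (ψ : List ℕ → ℕ → ℕ) (hB : Primrec B)
    (hψ : Primrec fun x : List ℕ × ℕ => ψ x.1 x.2) :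
    ∃ g, IsWordMap g ∧ ∀ p : Baire, Maps g p fun n => ψ (initSeg p (B n)) n := by
  have h1 : Primrec fun x : List ℕ × ℕ × ℕ => ψ (x.1.take (B x.2.1)) x.2.1 :=
    hψ.comp (by fun_prop : Primrec fun x : List ℕ × ℕ × ℕ => (x.1.take (B x.2.1), x.2.1))
  obtain ⟨g, hg, h⟩ := exists_wordMap
    (fun u n _ => if B n ≤ u.length then some (ψ (u.take (B n)) n) else none) (by fun_prop)
  refine ⟨g, hg, fun p => h p _ (fun n => ⟨B n, 0, ?_⟩) fun n l s v hv => ?_⟩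
  · simp [initSeg_take_of_le p le_rfl]
  · rw [length_initSeg] at hv
    split_ifs at hv with hl
    rw [initSeg_take_of_le p hl] at hv
    exact (Option.some.inj hv).symm

/-- A functional `p ↦ (n ↦ ψ (p (κ n)) n)`. -/
theorem exists_wordMap_of_index (κ : ℕ → ℕ) (ψ : ℕ → ℕ → ℕ) (hκ : Primrec κ)
    (hψ : Primrec fun x : ℕ × ℕ => ψ x.1 x.2) :
    ∃ g, IsWordMap g ∧ ∀ p : Baire, Maps g p fun n => ψ (p (κ n)) n := by
  have h1 : Primrec fun x : List ℕ × ℕ => ψ (x.1.getD (κ x.2) 0) x.2 :=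
    hψ.comp (by fun_prop : Primrec fun x : List ℕ × ℕ => (x.1.getD (κ x.2) 0, x.2))
  obtain ⟨g, hg, h⟩ := exists_wordMap_of_bound (fun n => κ n + 1)
    (fun u n => ψ (u.getD (κ n) 0) n) (by fun_prop) h1
  refine ⟨g, hg, fun p => ?_⟩
  have := h p
  simp only [initSeg_getD p (Nat.lt_succ_self _)] at this
  exact this

theorem exists_wordMap_reindex (κ : ℕ → ℕ) (hκ : Primrec κ) :
    ∃ g, IsWordMap g ∧ ∀ p : Baire, Maps g p fun n => p (κ n) :=
  exists_wordMap_of_index κ (fun v _ => v) hκ (by fun_prop)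

/-- Pairing of word maps. -/
theorem exists_wordMap_pair {g h : List ℕ → List ℕ} (hg : IsWordMap g) (hh : IsWordMap h) :
    ∃ k, IsWordMap k ∧ ∀ p q r, Maps g p q → Maps h p r → Maps k p (pairB q r) := by
  have h1 := hg.1
  have h2 := hh.1
  obtain ⟨k, hk, H⟩ := exists_wordMap
    (fun u n _ => if n % 2 = 0 then (g u)[n / 2]? else (h u)[n / 2]?) (by fun_prop)
  refine ⟨k, hk, fun p q r hq hr => H _ _ (fun n => ?_) fun n l s v hv => ?_⟩
  · by_cases hn : n % 2 = 0
    · obtain ⟨l, hl⟩ := hq (n / 2)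
      exact ⟨l, 0, by simp [hn, hl, pairB]⟩
    · obtain ⟨l, hl⟩ := hr (n / 2)
      exact ⟨l, 0, by simp only [hn, if_false, hl, pairB]⟩
  · by_cases hn : n % 2 = 0
    · simp only [hn, if_true] at hv
      simpa [pairB, hn] using hq.sound hg hv
    · simp only [hn, if_false] at hv
      simpa [pairB, hn] using hr.sound hh hv

theorem exists_wordMap_fst : ∃ g, IsWordMap g ∧ ∀ p q, Maps g (pairB p q) p := by
  obtain ⟨g, hg, h⟩ := exists_wordMap_reindex (fun n => 2 * n) (by fun_prop)
  refine ⟨g, hg, fun p q => ?_⟩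
  simpa only [pairB_left] using h (pairB p q)

theorem exists_wordMap_snd : ∃ g, IsWordMap g ∧ ∀ p q, Maps g (pairB p q) q := by
  obtain ⟨g, hg, h⟩ := exists_wordMap_reindex (fun n => 2 * n + 1) (by fun_prop)
  refine ⟨g, hg, fun p q => ?_⟩
  simpa only [pairB_right] using h (pairB p q)

/-- The word `⟨u⟩_i` of length `J`, read off a prefix `u` of a tuple. -/
def compSeg (u : List ℕ) (i J : ℕ) : List ℕ := (List.range J).map fun j => u.getD (Nat.pair i j) 0

@[fun_prop]
theorem Prim.compSeg {α : Type} [Primcodable α] {u : α → List ℕ} {i J : α → ℕ} (hu : Primrec u)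
    (hi : Primrec i) (hJ : Primrec J) : Primrec fun a => compSeg (u a) (i a) (J a) := by
  unfold Weihrauch.compSeg
  fun_prop

theorem compSeg_initSeg (p : Baire) {i J l : ℕ} (h : Nat.pair i J ≤ l) :
    compSeg (initSeg p l) i J = initSeg (component p i) J := by
  refine List.map_congr_left fun j hj => ?_
  rw [initSeg_getD _ ((Nat.pair_lt_pair_right i (List.mem_range.mp hj)).trans_le h)]
  rfl

/-- Componentwise application of a word map. -/
theorem exists_wordMap_parallel {g : List ℕ → List ℕ} (hg : IsWordMap g) :
    ∃ k, IsWordMap k ∧ ∀ p q, (∀ i, Maps g (component p i) (component q i)) → Maps k p q := by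
  have h1 := hg.1
  obtain ⟨k, hk, H⟩ := exists_wordMap (fun u n J => if Nat.pair n.unpair.1 J ≤ u.length then
    (g (compSeg u n.unpair.1 J))[n.unpair.2]? else none) (by fun_prop)
  refine ⟨k, hk, fun p q h => H _ _ (fun n => ?_) fun n l J v hv => ?_⟩
  · obtain ⟨J, hJ⟩ := h n.unpair.1 n.unpair.2
    refine ⟨Nat.pair n.unpair.1 J, J, ?_⟩
    rw [length_initSeg, if_pos le_rfl, compSeg_initSeg p le_rfl, hJ]
    simp [component]
  · rw [length_initSeg] at hv
    split_ifs at hv with hl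
    rw [compSeg_initSeg p hl] at hv
    simpa [component] using (h n.unpair.1).sound hg hv

/-! ### Limits -/

theorem isLim_iff {p q : Baire} : IsLim p q ↔ ∀ j, ∀ᶠ i in atTop, p (Nat.pair i j) = q j := by
  unfold IsLim
  rw [tendsto_pi_nhds]
  refine forall_congr' fun j => ?_
  rw [nhds_discrete, tendsto_pure]
  rfl

/-- Word maps extend to limits. -/
theorem exists_wordMap_lim {g : List ℕ → List ℕ} (hg : IsWordMap g) :
    ∃ k, IsWordMap k ∧ ∀ p q r, IsLim p q → Maps g q r → ∃ s, Maps k p s ∧ IsLim s r := by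
  have h1 := hg.1
  -- The `i`-th approximation applies `g` to the first `i` letters of the `i`-th component and puts
  -- 0 for letters not yet produced.
  obtain ⟨k, hk, H⟩ := exists_wordMap_of_bound (fun n => Nat.pair n.unpair.1 n.unpair.1)
    (fun u n => ((g (compSeg u n.unpair.1 n.unpair.1))[n.unpair.2]?).getD 0)
    (by fun_prop) (by fun_prop)
  refine ⟨k, hk, fun p q r hl hm => ⟨_, H p, isLim_iff.mpr fun j => ?_⟩⟩
  obtain ⟨l, hl'⟩ := hm.eventually hg j
  have hev : ∀ᶠ i in atTop, ∀ j ∈ Finset.range l, p (Nat.pair i j) = q j := by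
    rw [eventually_all_finset]
    exact fun j _ => isLim_iff.mp hl j
  filter_upwards [hev, eventually_ge_atTop l] with i hi hil
  simp only [Nat.unpair_pair, compSeg_initSeg p le_rfl]
  have hseg : initSeg (component p i) l = initSeg q l :=
    initSeg_congr fun j hj => hi j (Finset.mem_range.mpr hj)
  have := getElem?_of_isPrefix (hg.2 _ _ (hseg ▸ initSeg_isPrefix (component p i) hil))
    (hl' l le_rfl)
  rw [this]; rfl

/-! ### Reductions by word maps -/

/-- The partial function on Baire space given by a word function. -/
noncomputable def wordFun (g : List ℕ → List ℕ) : Baire →. Baire :=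
  fun p => ⟨∃ q, Maps g p q, fun h => h.choose⟩

theorem mem_wordFun {g : List ℕ → List ℕ} (hg : IsWordMap g) {p q : Baire} :
    q ∈ wordFun g p ↔ Maps g p q := by
  refine ⟨fun ⟨h, e⟩ => ?_, fun h => ⟨⟨q, h⟩, ?_⟩⟩
  · rw [← e]; exact h.choose_spec
  · exact (Exists.choose_spec (⟨q, h⟩ : ∃ q, Maps g p q)).unique hg h

theorem computableFun_wordFun {g : List ℕ → List ℕ} (hg : IsWordMap g) :
    ComputableFun (wordFun g) :=
  ⟨g, hg.1.to_comp, hg.2, fun _ _ h => (mem_wordFun hg).mp h⟩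

namespace Problem

/-- Strong Weihrauch reducibility, spelled out pointwise and witnessed by word maps. -/
def SRed (f g : Problem) : Prop :=
  ∃ k h, IsWordMap k ∧ IsWordMap h ∧ ∀ p x, f.X.Names p x → x ∈ f.dom →
    ∃ q x', Maps k p q ∧ g.X.Names q x' ∧ x' ∈ g.dom ∧
      ∀ r y', g.Y.Names r y' → y' ∈ g.sol x' → ∃ s y, Maps h r s ∧ f.Y.Names s y ∧ y ∈ f.sol x

/-- Weihrauch reducibility, spelled out pointwise and witnessed by word maps. -/
def WRed (f g : Problem) : Prop :=
  ∃ k h, IsWordMap k ∧ IsWordMap h ∧ ∀ p x, f.X.Names p x → x ∈ f.dom →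
    ∃ q x', Maps k p q ∧ g.X.Names q x' ∧ x' ∈ g.dom ∧
      ∀ r y', g.Y.Names r y' → y' ∈ g.sol x' →
        ∃ s y, Maps h (pairB p r) s ∧ f.Y.Names s y ∧ y ∈ f.sol x

variable {f g h : Problem}

theorem SRed.leSW (H : SRed f g) : LeSW f g := by
  obtain ⟨k, h, hk, hh, H⟩ := H
  refine ⟨wordFun h, wordFun k, computableFun_wordFun hh, computableFun_wordFun hk,
    fun G hG p x hp hx => ?_⟩
  obtain ⟨q, x', hq, hx', hd, H⟩ := H p x hp hx
  obtain ⟨r, hr, y', hy', hs⟩ := hG q x' hx' hd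
  obtain ⟨s, y, hs, hy, hsol⟩ := H r y' hy' hs
  exact ⟨s, Part.mem_bind ((mem_wordFun hk).mpr hq)
    (Part.mem_bind hr ((mem_wordFun hh).mpr hs)), y, hy, hsol⟩

theorem WRed.leW (H : WRed f g) : LeW f g := by
  obtain ⟨k, h, hk, hh, H⟩ := H
  refine ⟨wordFun h, wordFun k, computableFun_wordFun hh, computableFun_wordFun hk,
    fun G hG p x hp hx => ?_⟩
  obtain ⟨q, x', hq, hx', hd, H⟩ := H p x hp hx
  obtain ⟨r, hr, y', hy', hs⟩ := hG q x' hx' hd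
  obtain ⟨s, y, hs, hy, hsol⟩ := H r y' hy' hs
  exact ⟨s, Part.mem_bind ((mem_wordFun hk).mpr hq)
    (Part.mem_bind hr ((mem_wordFun hh).mpr hs)), y, hy, hsol⟩

theorem SRed.refl (f : Problem) : SRed f f :=
  ⟨_, _, isWordMap_id, isWordMap_id, fun p x hp hx =>
    ⟨p, x, maps_id p, hp, hx, fun r y hr hy => ⟨r, y, maps_id r, hr, hy⟩⟩⟩

theorem SRed.trans (H₁ : SRed f g) (H₂ : SRed g h) : SRed f h := by
  obtain ⟨k₁, h₁, hk₁, hh₁, H₁⟩ := H₁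
  obtain ⟨k₂, h₂, hk₂, hh₂, H₂⟩ := H₂
  refine ⟨_, _, hk₂.comp hk₁, hh₁.comp hh₂, fun p x hp hx => ?_⟩
  obtain ⟨q, x', hq, hx', hd, H₁⟩ := H₁ p x hp hx
  obtain ⟨q', x'', hq', hx'', hd', H₂⟩ := H₂ q x' hx' hd
  refine ⟨q', x'', hq'.comp hk₂ hk₁ hq, hx'', hd', fun r y' hr hy' => ?_⟩
  obtain ⟨s, y, hs, hy, hsol⟩ := H₂ r y' hr hy'
  obtain ⟨s', z, hs', hz, hsol'⟩ := H₁ s y hy hsol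
  exact ⟨s', z, hs'.comp hh₁ hh₂ hs, hz, hsol'⟩

theorem SRed.wRed (H : SRed f g) : WRed f g := by
  obtain ⟨k, h, hk, hh, H⟩ := H
  obtain ⟨π, hπ, Hπ⟩ := exists_wordMap_snd
  refine ⟨k, _, hk, hh.comp hπ, fun p x hp hx => ?_⟩
  obtain ⟨q, x', hq, hx', hd, H⟩ := H p x hp hx
  refine ⟨q, x', hq, hx', hd, fun r y' hr hy' => ?_⟩
  obtain ⟨s, y, hs, hy, hsol⟩ := H r y' hr hy'
  exact ⟨s, y, hs.comp hh hπ (Hπ p r), hy, hsol⟩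

/-- The reduction of `g` to `h` expects the name of its own instance for postprocessing; this is
recomputed from `p` by `k₁`. -/
theorem SRed.trans_wRed (H₁ : SRed f g) (H₂ : WRed g h) : WRed f h := by
  obtain ⟨k₁, h₁, hk₁, hh₁, H₁⟩ := H₁
  obtain ⟨k₂, h₂, hk₂, hh₂, H₂⟩ := H₂
  obtain ⟨π₁, hπ₁, Hπ₁⟩ := exists_wordMap_fst
  obtain ⟨π₂, hπ₂, Hπ₂⟩ := exists_wordMap_snd
  obtain ⟨m, hm, Hm⟩ := exists_wordMap_pair (hk₁.comp hπ₁) hπ₂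
  refine ⟨_, _, hk₂.comp hk₁, hh₁.comp (hh₂.comp hm), fun p x hp hx => ?_⟩
  obtain ⟨q, x', hq, hx', hd, H₁⟩ := H₁ p x hp hx
  obtain ⟨q', x'', hq', hx'', hd', H₂⟩ := H₂ q x' hx' hd
  refine ⟨q', x'', hq'.comp hk₂ hk₁ hq, hx'', hd', fun r y' hr hy' => ?_⟩
  obtain ⟨s, y, hs, hy, hsol⟩ := H₂ r y' hr hy'
  obtain ⟨s', z, hs', hz, hsol'⟩ := H₁ s y hy hsol
  have hmap := Hm _ _ _ (hq.comp hk₁ hπ₁ (Hπ₁ p r)) (Hπ₂ p r)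
  exact ⟨s', z, hs'.comp hh₁ (hh₂.comp hm) (hs.comp hh₂ hm hmap), hz, hsol'⟩

/-! ### Jumps -/

/-- Preprocessing is continuous and can be applied to the approximations. Postprocessing sees only
the solution, which a jump leaves unchanged; it must not use the instance, which is now known only
as a limit. -/
theorem SRed.jump (H : SRed f g) : SRed f.jump g.jump := by
  obtain ⟨k, h, hk, hh, H⟩ := H
  obtain ⟨k', hk', Hk⟩ := exists_wordMap_lim hk
  refine ⟨k', h, hk', hh, fun p x ⟨p', hp', hp⟩ hx => ?_⟩
  obtain ⟨q, x', hq, hx', hd, H⟩ := H p' x hp hx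
  obtain ⟨s, hs, hl⟩ := Hk p p' q hp' hq
  exact ⟨s, x', hs, ⟨q, hl, hx'⟩, hd, H⟩

theorem iterJump_succ (f : Problem) (n : ℕ) : f.iterJump (n + 1) = (f.iterJump n).jump :=
  Function.iterate_succ_apply' _ _ _

theorem SRed.iterJump (H : SRed f g) (n : ℕ) : SRed (f.iterJump n) (g.iterJump n) := by
  induction n with
  | zero => exact H
  | succ n ih => rw [iterJump_succ, iterJump_succ]; exact ih.jump

/-! ### Parallelization -/

theorem SRed.parallelization (H : SRed f g) : SRed f.parallelization g.parallelization := by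
  obtain ⟨k, h, hk, hh, H⟩ := H
  obtain ⟨k', hk', Hk⟩ := exists_wordMap_parallel hk
  obtain ⟨h', hh', Hh⟩ := exists_wordMap_parallel hh
  refine ⟨k', h', hk', hh', fun p x hp ⟨z, hz⟩ => ?_⟩
  choose q x' hq hx' hd H using fun i => H _ _ (hp i) ⟨z i, hz i⟩
  choose y' hy' using hd
  refine ⟨tupleB q, x', Hk _ _ fun i => by rw [component_tupleB]; exact hq i,
    fun i => by rw [component_tupleB]; exact hx' i, ⟨y', hy'⟩, fun r y hr hy => ?_⟩
  choose s w hs hw hsol using fun i => H i _ _ (hr i) (hy i)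
  exact ⟨tupleB s, w, Hh _ _ fun i => by rw [component_tupleB]; exact hs i,
    fun i => by rw [component_tupleB]; exact hw i, hsol⟩

theorem WRed.parallelization (H : WRed f g) : WRed f.parallelization g.parallelization := by
  obtain ⟨k, h, hk, hh, H⟩ := H
  obtain ⟨k', hk', Hk⟩ := exists_wordMap_parallel hk
  obtain ⟨h', hh', Hh⟩ := exists_wordMap_parallel hh
  -- Regroups a pair of tuples as a tuple of pairs; the parity of the inner position selects the
  -- side.
  obtain ⟨m, hm, Hm⟩ := exists_wordMap_reindex (fun n => 2 * Nat.pair n.unpair.1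
    (n.unpair.2 / 2) + n.unpair.2 % 2) (by fun_prop)
  have Hm' : ∀ p r, Maps m (pairB p r)
      (tupleB fun i => pairB (component p i) (component r i)) := by
    intro p r
    convert Hm (pairB p r) using 1
    funext n
    rcases Nat.mod_two_eq_zero_or_one n.unpair.2 with e | e
    · simp only [tupleB, e, add_zero, pairB_left]
      simp [pairB, e, component]
    · simp only [tupleB, e, pairB_right]
      simp [pairB, e, component]
  refine ⟨k', _, hk', hh'.comp hm, fun p x hp ⟨z, hz⟩ => ?_⟩
  choose q x' hq hx' hd H using fun i => H _ _ (hp i) ⟨z i, hz i⟩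
  choose y' hy' using hd
  refine ⟨tupleB q, x', Hk _ _ fun i => by rw [component_tupleB]; exact hq i,
    fun i => by rw [component_tupleB]; exact hx' i, ⟨y', hy'⟩, fun r y hr hy => ?_⟩
  choose s w hs hw hsol using fun i => H i _ _ (hr i) (hy i)
  refine ⟨tupleB s, w, Maps.comp hh' hm (Hh _ _ fun i => ?_) (Hm' p r),
    fun i => by rw [component_tupleB]; exact hw i, hsol⟩
  rw [component_tupleB, component_tupleB]
  exact hs i

/-- A convergent sequence of tuples and a tuple of convergent sequences differ by exchanging stage
and component. This exchange is an involution, so it serves for both directions. -/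
theorem exists_wordMap_transpose : ∃ m, IsWordMap m ∧ ∀ p, Maps m p
    fun n => p (Nat.pair n.unpair.2.unpair.1 (Nat.pair n.unpair.1 n.unpair.2.unpair.2)) :=
  exists_wordMap_reindex _ (by fun_prop)

theorem jump_parallelization_sRed (f : Problem) :
    SRed f.parallelization.jump f.jump.parallelization := by
  obtain ⟨m, hm, Hm⟩ := exists_wordMap_transpose
  refine ⟨m, _, hm, isWordMap_id, fun p x ⟨q, hl, hq⟩ hx => ⟨_, x, Hm p, fun i =>
    ⟨component q i, isLim_iff.mpr fun j => ?_, hq i⟩, hx, fun r y hr hy =>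
    ⟨r, y, maps_id r, hr, hy⟩⟩⟩
  filter_upwards [isLim_iff.mp hl (Nat.pair i j)] with t ht
  simpa [component] using ht

theorem parallelization_jump_sRed (f : Problem) :
    SRed f.jump.parallelization f.parallelization.jump := by
  obtain ⟨m, hm, Hm⟩ := exists_wordMap_transpose
  refine ⟨m, _, hm, isWordMap_id, fun p x hp hx => ?_⟩
  choose q hl hq using hp
  refine ⟨_, x, Hm p, ⟨tupleB q, isLim_iff.mpr fun j => ?_, fun i => ?_⟩, hx, fun r y hr hy =>
    ⟨r, y, maps_id r, hr, hy⟩⟩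
  · filter_upwards [isLim_iff.mp (hl j.unpair.1) j.unpair.2] with t ht
    simpa [component, tupleB] using ht
  · rw [component_tupleB]; exact hq i

theorem parallelization_iterJump_sRed (f : Problem) (n : ℕ) :
    SRed (f.iterJump n).parallelization (f.parallelization.iterJump n) := by
  induction n with
  | zero => exact SRed.refl _
  | succ n ih =>
    rw [iterJump_succ, iterJump_succ]
    exact (parallelization_jump_sRed _).trans ih.jump

/-! ### Products with the identity -/

/-- Baire space, represented by the identity. -/
def _root_.Weihrauch.RepSpace.baire : RepSpace where
  carrier := Baire
  Names p x := p = x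
  unique _ _ _ hx hy := hx.symm.trans hy
  surj x := ⟨x, rfl⟩

/-- The product of the identity on Baire space with `f`. -/
def prodId (f : Problem) : Problem where
  X := RepSpace.baire.prod f.X
  Y := RepSpace.baire.prod f.Y
  sol z := {w : Baire × f.Y.carrier | w.1 = z.1 ∧ w.2 ∈ f.sol z.2}

/-- The identity factor carries the instance through to the solution, where postprocessing can use
it. -/
theorem WRed.sRed_prodId (H : WRed f g) : SRed f g.prodId := by
  obtain ⟨k, h, hk, hh, H⟩ := H
  obtain ⟨m, hm, Hm⟩ := exists_wordMap_pair isWordMap_id hk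
  refine ⟨m, h, hm, hh, fun p x hp hx => ?_⟩
  obtain ⟨q, x', hq, hx', ⟨y', hy'⟩, H⟩ := H p x hp hx
  refine ⟨_, (p, x'), Hm _ _ _ (maps_id p) hq, ⟨p, q, rfl, rfl, hx'⟩, ⟨(p, y'), rfl, hy'⟩, ?_⟩
  rintro _ ⟨z, y⟩ ⟨p', r, rfl, rfl, hr⟩ ⟨rfl, hy⟩
  exact H r y hr hy

theorem SRed.prodId (H : SRed f g) : SRed f.prodId g.prodId := by
  obtain ⟨k, h, hk, hh, H⟩ := H
  obtain ⟨π₁, hπ₁, Hπ₁⟩ := exists_wordMap_fst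
  obtain ⟨π₂, hπ₂, Hπ₂⟩ := exists_wordMap_snd
  obtain ⟨k', hk', Hk⟩ := exists_wordMap_pair hπ₁ (hk.comp hπ₂)
  obtain ⟨h', hh', Hh⟩ := exists_wordMap_pair hπ₁ (hh.comp hπ₂)
  refine ⟨k', h', hk', hh', ?_⟩
  rintro _ ⟨_, x⟩ ⟨p, p', rfl, rfl, hp⟩ ⟨⟨z', y⟩, -, hy⟩
  obtain ⟨q, x', hq, hx', ⟨y', hy'⟩, H⟩ := H p' x hp ⟨y, hy⟩
  refine ⟨_, (p, x'), Hk _ _ _ (Hπ₁ _ _) (hq.comp hk hπ₂ (Hπ₂ _ _)), ⟨p, q, rfl, rfl, hx'⟩,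
    ⟨(p, y'), rfl, hy'⟩, ?_⟩
  rintro _ ⟨z, y⟩ ⟨p', r, rfl, rfl, hr⟩ ⟨rfl, hy⟩
  obtain ⟨s, w, hs, hw, hsol⟩ := H r y hr hy
  exact ⟨_, (p', w), Hh _ _ _ (Hπ₁ _ _) (hs.comp hh hπ₂ (Hπ₂ _ _)), ⟨p', s, rfl, rfl, hw⟩,
    rfl, hsol⟩

/-- The identity factor enters as a constant sequence of approximations: even positions ignore the
stage. -/
theorem prodId_jump_sRed (f : Problem) : SRed f.jump.prodId f.prodId.jump := by
  obtain ⟨m, hm, Hm⟩ := exists_wordMap_reindex (fun n => if n.unpair.2 % 2 = 0 then n.unpair.2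
    else 2 * Nat.pair n.unpair.1 (n.unpair.2 / 2) + 1) (by fun_prop)
  refine ⟨m, _, hm, isWordMap_id, ?_⟩
  rintro _ ⟨z, x⟩ ⟨p, p', rfl, rfl, q, hl, hq⟩ hx
  refine ⟨_, (p, x), Hm _, ⟨pairB p q, isLim_iff.mpr fun j => ?_, p, q, rfl, rfl, hq⟩, hx,
    fun r y hr hy => ⟨r, y, maps_id r, hr, hy⟩⟩
  by_cases hj : j % 2 = 0
  · exact Eventually.of_forall fun i => by simp [hj, pairB]
  · filter_upwards [isLim_iff.mp hl (j / 2)] with i hi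
    simp only [Nat.unpair_pair, hj, if_false, pairB_right, hi]
    simp [pairB, hj]

theorem prodId_iterJump_sRed (f : Problem) (n : ℕ) :
    SRed (f.iterJump n).prodId (f.prodId.iterJump n) := by
  induction n with
  | zero => exact SRed.refl _
  | succ n ih =>
    rw [iterJump_succ, iterJump_succ]
    exact (prodId_jump_sRed _).trans ih.jump

end Problem

/-! ### Closed subsets of compact boxes -/

/-- The functions `f` bounded by the odd part of `p` such that `Q` holds for all pairs of initial
segments of `p` and `f`. -/
def clSol (Q : List ℕ → List ℕ → Bool) (p : Baire) : Set Baire :=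
  {f | (∀ m, f m ≤ p (2 * m + 1)) ∧ ∀ l, Q (initSeg p l) (initSeg f l) = true}

/-- The problem to find a point of the closed set `clSol Q p`. -/
def CL (Q : List ℕ → List ℕ → Bool) : Problem where
  X := RepSpace.baire
  Y := RepSpace.baire
  sol := clSol Q

/-- The value at `m` of the function coded by a binary word: the least `v` such that the bit at
`⟨m, v⟩` is set. -/
def decodeAt (w : List Bool) (m : ℕ) : Option ℕ :=
  (List.range w.length).find? fun v => decide (w[Nat.pair m v]? = some true)

theorem decodeAt_eq_some {w : List Bool} {m v : ℕ} : decodeAt w m = some v ↔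
    w[Nat.pair m v]? = some true ∧ ∀ v' < v, w[Nat.pair m v']? ≠ some true := by
  rw [decodeAt, List.find?_range_eq_some]
  simp only [decide_eq_true_eq, List.mem_range, Bool.not_eq_true', decide_eq_false_iff_not]
  refine ⟨fun ⟨h1, _, h2⟩ => ⟨h1, h2⟩, fun ⟨h1, h2⟩ => ⟨h1, ?_, h2⟩⟩
  exact (Nat.right_le_pair m v).trans_lt (List.getElem?_eq_some_iff.mp h1).1

theorem decodeAt_mono {w w' : List Bool} (h : w <+: w') {m v : ℕ} (hv : decodeAt w m = some v) :
    decodeAt w' m = some v := by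
  rw [decodeAt_eq_some] at hv ⊢
  have hlt := (List.getElem?_eq_some_iff.mp hv.1).1
  have key : ∀ v' ≤ v, w'[Nat.pair m v']? = w[Nat.pair m v']? := by
    intro v' hv'
    have : Nat.pair m v' ≤ Nat.pair m v := by
      rcases hv'.eq_or_lt with rfl | hlt
      · exact le_rfl
      · exact (Nat.pair_lt_pair_right m hlt).le
    obtain ⟨t, rfl⟩ := h
    rw [List.getElem?_append_left (this.trans_lt hlt)]
  exact ⟨by rw [key v le_rfl]; exact hv.1, fun v' hv' => by rw [key v' hv'.le]; exact hv.2 v' hv'⟩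

/-- The binary tree coding `clSol Q p`, where `u` is an initial segment of `p`. -/
def boxTree (Q : List ℕ → List ℕ → Bool) (u : List ℕ) (w : List Bool) : Bool :=
  ((List.range w.length).all fun m =>
    !decide (w[Nat.pair m (u.getD (2 * m + 1) 0)]? = some false)) &&
  (List.range (w.length + 1)).all fun l =>
    !((List.range l).all fun m => (decodeAt w m).isSome) ||
      Q (u.take l) ((List.range l).map fun m => (decodeAt w m).getD 0)

/-- The first clause forces a set bit in row `m` at the bound, so every path decodes to a function
in the box. The second tests `Q` only on values already decoded; these persist under extension,
which makes the set closed under prefixes. -/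
theorem boxTree_iff {Q : List ℕ → List ℕ → Bool} {p : Baire} {w : List Bool} :
    boxTree Q (initSeg p (2 * w.length + 2)) w = true ↔
      (∀ m, w[Nat.pair m (p (2 * m + 1))]? ≠ some false) ∧
      ∀ l ≤ w.length, ∀ v : ℕ → ℕ, (∀ m < l, decodeAt w m = some (v m)) →
        Q (initSeg p l) (initSeg v l) = true := by
  simp only [boxTree, Bool.and_eq_true, List.all_eq_true, List.mem_range, Bool.not_eq_true',
    decide_eq_false_iff_not, Bool.or_eq_true]
  refine and_congr ⟨fun h m hm => ?_, fun h m hm => ?_⟩ ⟨fun h l hl v hv => ?_, fun h l hl => ?_⟩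
  · have h1 := (List.getElem?_eq_some_iff.mp hm).1
    have h2 : m < w.length := (Nat.left_le_pair m _).trans_lt h1
    have := h m h2
    rw [initSeg_getD p (by omega)] at this
    exact this hm
  · rw [initSeg_getD p (by omega)]
    exact h m
  · rcases h l (by omega) with h | h
    · rw [← Bool.not_eq_true, List.all_eq_true] at h
      exact absurd (fun m hm => by rw [hv m (List.mem_range.mp hm)]; rfl) h
    · rw [initSeg_take_of_le p (by omega)] at h
      convert h using 2
      exact List.map_congr_left fun m hm => by rw [hv m (List.mem_range.mp hm)]; rfl
  · by_cases hall : ((List.range l).all fun m => (decodeAt w m).isSome) = true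
    · right
      rw [List.all_eq_true] at hall
      rw [initSeg_take_of_le p (by omega)]
      refine h l (by omega) (fun m => (decodeAt w m).getD 0) fun m hm => ?_
      obtain ⟨a, ha⟩ := Option.isSome_iff_exists.mp (hall m (List.mem_range.mpr hm))
      rw [ha]; rfl
    · left
      exact Bool.not_eq_true _ ▸ hall

theorem getElem?_map_range {α : Type} (x : ℕ → α) (l i : ℕ) (a : α) :
    ((List.range l).map x)[i]? = some a ↔ i < l ∧ x i = a := by
  rw [List.getElem?_map]
  by_cases h : i < l
  · rw [List.getElem?_range h]; simp [h]
  · rw [List.getElem?_eq_none (by simpa using h)]; simp [h]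

theorem infinite_of_map_range_mem {T : Set (List Bool)} {x : ℕ → Bool}
    (h : ∀ l, (List.range l).map x ∈ T) : T.Infinite :=
  Set.infinite_of_injective_forall_mem (fun a b hab => by
    simpa using congrArg List.length hab) h

theorem cl_sRed_WKL {Q : List ℕ → List ℕ → Bool}
    (hQ : Primrec fun x : List ℕ × List ℕ => Q x.1 x.2) : SRed (CL Q) WKL := by
  have hdec : Primrec fun x : List Bool × ℕ => decodeAt x.1 x.2 := by
    unfold decodeAt; fun_prop
  have hbt : Primrec fun x : List ℕ × List Bool => boxTree Q x.1 x.2 := by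
    have h1 : Primrec fun y : ((List ℕ × List Bool) × ℕ) × ℕ => decodeAt y.1.1.2 y.2 :=
      hdec.comp (by fun_prop : Primrec fun y : ((List ℕ × List Bool) × ℕ) × ℕ => (y.1.1.2, y.2))
    have h2 : Primrec fun y : (List ℕ × List Bool) × ℕ =>
        Q (y.1.1.take y.2) ((List.range y.2).map fun m => (decodeAt y.1.2 m).getD 0) :=
      hQ.comp (by fun_prop : Primrec fun y : (List ℕ × List Bool) × ℕ =>
        (y.1.1.take y.2, (List.range y.2).map fun m => (decodeAt y.1.2 m).getD 0))
    unfold boxTree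
    fun_prop
  obtain ⟨k, hk, Hk⟩ := exists_wordMap_of_bound
    (fun n => 2 * ((Encodable.decode (α := List Bool) n).map List.length).getD 0 + 2)
    (fun u n => ((Encodable.decode (α := List Bool) n).map fun w => (boxTree Q u w).toNat).getD 0)
    (by fun_prop) (by
      have : Primrec fun y : (List ℕ × ℕ) × List Bool => boxTree Q y.1.1 y.2 :=
        hbt.comp (by fun_prop : Primrec fun y : (List ℕ × ℕ) × List Bool => (y.1.1, y.2))
      fun_prop)
  obtain ⟨h, hh, Hh⟩ := exists_wordMap
    (fun u m _ => (List.range u.length).find? fun v => decide (u[Nat.pair m v]? = some 1))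
    (by fun_prop)
  refine ⟨k, h, hk, hh, ?_⟩
  rintro p _ rfl ⟨f, hf, hfQ⟩
  let T : BinTree := ⟨{w | boxTree Q (initSeg p (2 * w.length + 2)) w = true}, by
    intro w w' hww' hw'
    simp only [Set.mem_ofPred_eq, boxTree_iff] at hw' ⊢
    refine ⟨fun m hm => hw'.1 m ?_, fun l hl v hv => hw'.2 l (hl.trans hww'.length_le) v
      fun m hm => decodeAt_mono hww' (hv m hm)⟩
    obtain ⟨t, rfl⟩ := hww'
    rw [List.getElem?_append_left (List.getElem?_eq_some_iff.mp hm).1, hm]⟩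
  refine ⟨_, T, Hk p, fun w => ?_, ?_, ?_⟩
  · simp only [Encodable.encodek, Option.map_some, Option.getD_some]
    refine ⟨fun hw => ?_, fun hw => ?_⟩
    · rw [show boxTree Q (initSeg p (2 * w.length + 2)) w = true from hw]; rfl
    · rw [show boxTree Q (initSeg p (2 * w.length + 2)) w = false from
        Bool.eq_false_iff.mpr hw]; rfl
  · let x : ℕ → Bool := fun i =>
      decide (f i.unpair.1 = i.unpair.2 ∨ p (2 * i.unpair.1 + 1) = i.unpair.2)
    have hx : ∀ l, (List.range l).map x ∈ T.1 := by
      intro l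
      refine boxTree_iff.mpr ⟨fun m hm => ?_, fun l' hl' v hv => ?_⟩
      · have := ((getElem?_map_range x l _ _).mp hm).2
        simp [x] at this
      · have : initSeg v l' = initSeg f l' := initSeg_congr fun m hm => by
          obtain ⟨h1, h2⟩ := decodeAt_eq_some.mp (hv m hm)
          obtain ⟨h3, h4⟩ := (getElem?_map_range x l _ _).mp h1
          simp only [x, Nat.unpair_pair, decide_eq_true_eq] at h4
          rcases h4 with h4 | h4
          · exact h4.symm
          · by_contra hne
            have hle := hf m
            rw [h4] at hle
            have hlt : f m < v m := lt_of_le_of_ne hle (Ne.symm hne)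
            refine h2 (f m) hlt ((getElem?_map_range x l _ _).mpr
              ⟨(Nat.pair_lt_pair_right m hlt).trans h3, ?_⟩)
            simp [x]
        rw [this]
        exact hfQ l'
    exact ⟨x, infinite_of_map_range_mem hx, hx⟩
  · rintro r (x : ℕ → Bool) (hr : ∀ i, r i = (x i).toNat) ⟨-, hx⟩
    replace hx : ∀ l, (List.range l).map x ∈ T.1 := hx
    have hb : ∀ m, x (Nat.pair m (p (2 * m + 1))) = true := by
      intro m
      have := (boxTree_iff.mp (hx (Nat.pair m (p (2 * m + 1)) + 1))).1 m
      rw [Ne, getElem?_map_range] at this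
      simpa using this
    have hex : ∀ m, ∃ v, x (Nat.pair m v) = true := fun m => ⟨_, hb m⟩
    let v : Baire := fun m => Nat.find (hex m)
    have hv1 : ∀ m, x (Nat.pair m (v m)) = true := fun m => Nat.find_spec (hex m)
    have hv2 : ∀ m v', v' < v m → ¬ x (Nat.pair m v') = true := fun m v' h =>
      Nat.find_min (hex m) h
    have hr' : ∀ i, r i = 1 ↔ x i = true := by
      intro i
      have := hr i
      cases hxi : x i <;> simp_all
    refine ⟨v, v, Hh _ _ (fun m => ?_) (fun m l s a ha => ?_), rfl, fun m => ?_, fun l => ?_⟩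
    · refine ⟨Nat.pair m (v m) + 1, 0, ?_⟩
      rw [List.find?_range_eq_some]
      refine ⟨?_, ?_, fun v' hv' => ?_⟩
      · simp [(hr' _).mpr (hv1 m)]
      · simp only [length_initSeg, List.mem_range]
        exact Nat.lt_succ_of_le (Nat.right_le_pair m (v m))
      · simp only [initSeg_getElem?, Bool.not_eq_true', decide_eq_false_iff_not]
        intro h
        split_ifs at h
        exact hv2 m v' hv' ((hr' _).mp (Option.some.inj h))
    · rw [List.find?_range_eq_some] at ha
      obtain ⟨h1, -, h3⟩ := ha
      obtain ⟨h4, h5⟩ := eq_of_initSeg_getElem? (of_decide_eq_true h1)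
      rcases lt_trichotomy a (v m) with h | h | h
      · exact absurd ((hr' _).mp h5) (hv2 m a h)
      · exact h
      · have := h3 (v m) h
        simp [(Nat.pair_lt_pair_right m h).trans h4, (hr' _).mpr (hv1 m)] at this
    · exact Nat.find_min' (hex m) (hb m)
    · set N := (Finset.range l).sup (fun m => Nat.pair m (v m) + 1) + l with hN
      refine (boxTree_iff.mp (hx N)).2 l (by simp [hN]) v fun m hm => ?_
      have hlt : Nat.pair m (v m) < N := by
        have := Finset.le_sup (f := fun m => Nat.pair m (v m) + 1) (Finset.mem_range.mpr hm)
        omega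
      rw [decodeAt_eq_some]
      refine ⟨(getElem?_map_range x _ _ _).mpr ⟨hlt, hv1 m⟩, fun v' hv' h => ?_⟩
      exact hv2 m v' hv' ((getElem?_map_range x _ _ _).mp h).2

/-! ### Closure properties of weak Kőnig's lemma -/

theorem toNat_not_decide_eq_zero {a : ℕ} (h : a ≤ 1) : (!decide (a = 0)).toNat = a := by
  interval_cases a <;> rfl

theorem map_initSeg {α : Type} (g : ℕ → α) (p : Baire) (l : ℕ) :
    (initSeg p l).map g = (List.range l).map fun j => g (p j) := by
  simp [initSeg]

/-- The closed set of sequences of paths through a sequence of trees. -/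
def seqPaths (u w : List ℕ) : Bool :=
  (List.range (w.length + 1)).all fun i => (List.range (w.length + 1)).all fun l =>
    !decide (Nat.pair i l ≤ w.length) ||
      decide (u.getD (2 * Nat.pair i (Encodable.encode
        ((compSeg w i l).map fun a => !decide (a = 0)))) 1 = 1)

/-- Tree entries that have not been read default to 1 and pass; each condition is really tested once
the prefixes are long enough. -/
theorem seqPaths_iff {p f : Baire} : (∀ l, seqPaths (initSeg p l) (initSeg f l) = true) ↔
    ∀ i l, p (2 * Nat.pair i (Encodable.encode
      ((List.range l).map fun j => !decide (component f i j = 0)))) = 1 := by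
  simp only [seqPaths, List.all_eq_true, List.mem_range, length_initSeg, Bool.or_eq_true,
    Bool.not_eq_true', decide_eq_false_iff_not, decide_eq_true_eq]
  refine ⟨fun h i l => ?_, fun h L i hi l hl => ?_⟩
  · set e := Encodable.encode ((List.range l).map fun j => !decide (component f i j = 0)) with he
    set L := Nat.pair i l + 2 * Nat.pair i e + 1 with hL
    have hi : i ≤ Nat.pair i l := Nat.left_le_pair i l
    have hl : l ≤ Nat.pair i l := Nat.right_le_pair i l
    rcases h L i (by omega) l (by omega) with h | h
    · omega
    · rw [compSeg_initSeg f (by omega), map_initSeg] at h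
      rwa [← he, initSeg_getD p (by omega)] at h
  · by_cases hil : Nat.pair i l ≤ L
    · right
      rw [compSeg_initSeg f hil, map_initSeg]
      have := h i l
      rw [List.getD_eq_getElem?_getD, initSeg_getElem?]
      split_ifs
      · exact this
      · rfl
    · exact Or.inl hil

theorem WKL_parallelization_sRed : SRed WKL.parallelization WKL := by
  refine SRed.trans (g := CL seqPaths) ?_ (cl_sRed_WKL (by unfold seqPaths; fun_prop))
  -- Even positions hold the trees; odd positions hold the constant bound 1, so that solutions are
  -- sequences of bits.
  obtain ⟨k, hk, Hk⟩ := exists_wordMap_of_index (fun n => n / 2)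
    (fun v n => if n % 2 = 0 then v else 1) (by fun_prop) (by fun_prop)
  refine ⟨k, _, hk, isWordMap_id, fun p T hp ⟨y, hy⟩ => ?_⟩
  replace hp : ∀ i w, (w ∈ (T i).1 → p (Nat.pair i (Encodable.encode w)) = 1) ∧
    (w ∉ (T i).1 → p (Nat.pair i (Encodable.encode w)) = 0) := hp
  replace hy : ∀ i, (T i).1.Infinite ∧ ∀ l, (List.range l).map (y i) ∈ (T i).1 := hy
  refine ⟨_, _, Hk p, rfl, ⟨tupleB fun i j => (y i j).toNat, fun m => ?_, ?_⟩, ?_⟩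
  · simp only [tupleB, Nat.mul_add_mod]
    exact Bool.toNat_le _
  · refine seqPaths_iff.mpr fun i l => ?_
    rw [component_tupleB]
    have : ∀ j, (!decide ((y i j).toNat = 0)) = y i j := fun j => by cases y i j <;> rfl
    simp only [this]
    simpa using (hp i _).1 ((hy i).2 l)
  · rintro r _ rfl ⟨hb, hr⟩
    replace hb : ∀ m, r m ≤ 1 := fun m => by simpa using hb m
    refine ⟨r, fun i j => !decide (component r i j = 0), maps_id r, fun i j => ?_, fun i => ?_⟩
    · exact (toNat_not_decide_eq_zero (hb _)).symm
    · refine ⟨(hy i).1, fun l => ?_⟩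
      have := seqPaths_iff.mp hr i l
      by_contra hn
      simp [(hp i _).2 hn] at this

/-- The closed set of pairs of a given point and a path through a given tree. -/
def pairPaths (u w : List ℕ) : Bool :=
  ((List.range w.length).all fun m => !decide (m % 2 = 0) ||
    decide ((u[2 * m]?).getD (w.getD m 0) = w.getD m 0)) &&
  (List.range (w.length + 1)).all fun l => !decide (2 * l ≤ w.length) ||
    decide (u.getD (2 * (2 * Encodable.encode
      ((List.range l).map fun j => !decide (w.getD (2 * j + 1) 0 = 0)) + 1)) 1 = 1)

theorem pairPaths_iff {p f : Baire} : (∀ l, pairPaths (initSeg p l) (initSeg f l) = true) ↔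
    (∀ m, m % 2 = 0 → p (2 * m) = f m) ∧
    ∀ l, p (2 * (2 * Encodable.encode
      ((List.range l).map fun j => !decide (f (2 * j + 1) = 0)) + 1)) = 1 := by
  simp only [pairPaths, Bool.and_eq_true, List.all_eq_true, List.mem_range, length_initSeg,
    Bool.or_eq_true, Bool.not_eq_true', decide_eq_false_iff_not, decide_eq_true_eq]
  have hmap : ∀ L l, 2 * l ≤ L → ((List.range l).map fun j =>
      !decide ((initSeg f L).getD (2 * j + 1) 0 = 0)) =
      (List.range l).map fun j => !decide (f (2 * j + 1) = 0) := by
    refine fun L l hl => List.map_congr_left fun j hj => ?_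
    have := List.mem_range.mp hj
    rw [initSeg_getD f (by omega)]
  refine ⟨fun h => ⟨fun m hm => ?_, fun l => ?_⟩, fun h L => ⟨fun m hm => ?_, fun l hl => ?_⟩⟩
  · rcases (h (2 * m + 1)).1 m (by omega) with h | h
    · exact absurd hm h
    · rw [initSeg_getElem?_of_lt p (by omega), initSeg_getD f (by omega)] at h
      exact h
  · set e := Encodable.encode ((List.range l).map fun j => !decide (f (2 * j + 1) = 0)) with he
    set L := 2 * l + 2 * (2 * e + 1) + 1 with hL
    rcases (h L).2 l (by omega) with h | h
    · omega
    · rwa [hmap L l (by omega), ← he, initSeg_getD p (by omega)] at h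
  · by_cases hm2 : m % 2 = 0
    · right
      rw [initSeg_getD f hm, initSeg_getElem?]
      split_ifs
      · exact h.1 m hm2
      · rfl
    · exact Or.inl hm2
  · by_cases hl2 : 2 * l ≤ L
    · right
      rw [hmap L l hl2, List.getD_eq_getElem?_getD, initSeg_getElem?]
      split_ifs
      · exact h.2 l
      · rfl
    · exact Or.inl hl2

theorem WKL_prodId_sRed : SRed WKL.prodId WKL := by
  refine SRed.trans (g := CL pairPaths) ?_ (cl_sRed_WKL (by unfold pairPaths; fun_prop))
  -- The even entries of a solution are to be the letters of the given point, so each letter serves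
  -- as its own bound; the odd entries are path bits, bounded by 1.
  obtain ⟨k, hk, Hk⟩ := exists_wordMap_of_index (fun n => n / 2)
    (fun v n => if n % 2 = 0 then v else if n / 2 % 2 = 0 then v else 1) (by fun_prop)
    (by fun_prop)
  refine ⟨k, _, hk, isWordMap_id, ?_⟩
  rintro _ ⟨z', T⟩ ⟨z, t, rfl, rfl, ht⟩ ⟨⟨_, y⟩, -, hy⟩
  replace ht : ∀ w, (w ∈ T.1 → t (Encodable.encode w) = 1) ∧
    (w ∉ T.1 → t (Encodable.encode w) = 0) := ht
  replace hy : T.1.Infinite ∧ ∀ l, (List.range l).map y ∈ T.1 := hy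
  refine ⟨_, _, Hk _, rfl, ⟨pairB z fun j => (y j).toNat, fun m => ?_, ?_⟩, ?_⟩
  · have h1 : (2 * m + 1) / 2 = m := by omega
    have h2 : ¬ (2 * m + 1) % 2 = 0 := by omega
    simp only [h1, h2, if_false]
    by_cases hm : m % 2 = 0
    · simp [pairB, hm]
    · simp only [pairB, hm, if_false]
      exact Bool.toNat_le _
  · refine pairPaths_iff.mpr ⟨fun m hm => ?_, fun l => ?_⟩
    · simp [pairB, hm]
    · have : ∀ j, (!decide ((y j).toNat = 0)) = y j := fun j => by cases y j <;> rfl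
      simp only [pairB_right, this]
      simpa [pairB_right] using (ht _).1 (hy.2 l)
  · rintro r _ rfl ⟨hb, hr⟩
    obtain ⟨hr1, hr2⟩ := pairPaths_iff.mp hr
    replace hb : ∀ m, r (2 * m + 1) ≤ 1 := fun m => by
      have := hb (2 * m + 1)
      have h1 : (2 * (2 * m + 1) + 1) / 2 = 2 * m + 1 := by omega
      have h2 : ¬ (2 * (2 * m + 1) + 1) % 2 = 0 := by omega
      have h3 : ¬ (2 * m + 1) % 2 = 0 := by omega
      simpa only [h1, h2, h3, if_false] using this
    have hz : ∀ m, r (2 * m) = z m := fun m => by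
      have := hr1 (2 * m) (by omega)
      simpa [pairB_left] using this.symm
    refine ⟨r, (z, fun j => !decide (r (2 * j + 1) = 0)), maps_id r, ?_, rfl, hy.1, fun l => ?_⟩
    · refine ⟨z, fun j => r (2 * j + 1), ?_, rfl, fun j => ?_⟩
      · funext n
        rcases Nat.even_or_odd' n with ⟨m, rfl | rfl⟩
        · rw [pairB_left, hz]
        · rw [pairB_right]
      · exact (toNat_not_decide_eq_zero (hb j)).symm
    · have := hr2 l
      by_contra hn
      have h1 : ∀ a : ℕ, 2 * a / 2 = a := fun a => by omega
      simp only [Nat.mul_mod_right, if_true, h1, pairB_right] at this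
      rw [(ht _).2 hn] at this
      simp at this

theorem iterJump_WKL_parallelization_sRed (n : ℕ) :
    SRed (WKL.iterJump n).parallelization (WKL.iterJump n) :=
  (parallelization_iterJump_sRed WKL n).trans (WKL_parallelization_sRed.iterJump n)

theorem iterJump_WKL_prodId_sRed (n : ℕ) : SRed (WKL.iterJump n).prodId (WKL.iterJump n) :=
  (prodId_iterJump_sRed WKL n).trans (WKL_prodId_sRed.iterJump n)

/-- WKL^(n) is a cylinder: it can return the instance along with the solution. -/
theorem Problem.WRed.sRed_iterJump_WKL {f : Problem} {n : ℕ} (H : WRed f (WKL.iterJump n)) :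
    SRed f (WKL.iterJump n) :=
  H.sRed_prodId.trans (iterJump_WKL_prodId_sRed n)

/-! ### The numbering of finite sets by increasing words -/

/-- The increasing enumeration of `thetaSet n i`. -/
def thetaList : ℕ → ℕ → List ℕ
  | 0, _ => []
  | 1, i => [i]
  | n + 2, i => i.unpair.1 :: (thetaList (n + 1) i.unpair.2).map fun x => i.unpair.1 + 1 + x

/-- The inverse of `thetaList n` on increasing words of length `n`. -/
def thetaIdx : ℕ → List ℕ → ℕ
  | 0, _ => 0
  | 1, L => L.getD 0 0
  | n + 2, L => Nat.pair (L.getD 0 0)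
      (thetaIdx (n + 1) (L.tail.map fun x => x - (L.getD 0 0 + 1)))

/-- A bound for the indices of the `n`-element subsets of `{0, …, j-1}`. -/
def idxBound : ℕ → ℕ → ℕ
  | 0, _ => 1
  | 1, j => j
  | n + 2, j => (j + idxBound (n + 1) j) * (j + idxBound (n + 1) j)

theorem primrec_thetaList : ∀ n, Primrec (thetaList n)
  | 0 => by simp only [thetaList]; fun_prop
  | 1 => by simp only [thetaList]; fun_prop
  | n + 2 => by
    have := primrec_thetaList (n + 1)
    simp only [thetaList]; fun_prop

theorem primrec_thetaIdx : ∀ n, Primrec (thetaIdx n)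
  | 0 => by simp only [thetaIdx]; fun_prop
  | 1 => by simp only [thetaIdx]; fun_prop
  | n + 2 => by
    have := primrec_thetaIdx (n + 1)
    simp only [thetaIdx]; fun_prop

theorem primrec_idxBound : ∀ n, Primrec (idxBound n)
  | 0 => by simp only [idxBound]; fun_prop
  | 1 => by simp only [idxBound]; fun_prop
  | n + 2 => by
    have := primrec_idxBound (n + 1)
    simp only [idxBound]; fun_prop

@[simp]
theorem length_thetaList : ∀ n i, (thetaList n i).length = n
  | 0, _ => rfl
  | 1, _ => rfl
  | n + 2, i => by simp [thetaList, length_thetaList (n + 1)]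

theorem toFinset_thetaList : ∀ n i, (thetaList n i).toFinset = thetaSet n i
  | 0, _ => rfl
  | 1, _ => rfl
  | n + 2, i => by
    rw [thetaList, thetaSet, List.toFinset_cons, ← toFinset_thetaList (n + 1)]
    congr 1
    ext x
    simp

theorem mem_thetaList {n i x : ℕ} : x ∈ thetaList n i ↔ x ∈ thetaSet n i := by
  rw [← toFinset_thetaList, List.mem_toFinset]

theorem pairwise_thetaList : ∀ n i, (thetaList n i).Pairwise (· < ·)
  | 0, _ => List.Pairwise.nil
  | 1, _ => List.pairwise_singleton _ _
  | n + 2, i => by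
    rw [thetaList, List.pairwise_cons, List.pairwise_map]
    refine ⟨fun x hx => ?_, (pairwise_thetaList (n + 1) _).imp fun h => by omega⟩
    obtain ⟨y, -, rfl⟩ := List.mem_map.mp hx
    omega

theorem thetaList_thetaIdx : ∀ (n : ℕ) (L : List ℕ), L.Pairwise (· < ·) → L.length = n →
    thetaList n (thetaIdx n L) = L
  | 0, L, _, h => by rw [List.length_eq_zero_iff.mp h]; rfl
  | 1, L, _, h => by
    obtain ⟨a, rfl⟩ := List.length_eq_one_iff.mp h
    rfl
  | n + 2, [], _, h => by simp at h
  | n + 2, a :: L, hL, h => by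
    rw [List.pairwise_cons] at hL
    simp only [thetaList, thetaIdx, List.getD_cons_zero, Nat.unpair_pair, List.tail_cons]
    rw [thetaList_thetaIdx (n + 1)]
    · rw [List.map_map]
      congr 1
      conv_rhs => rw [← List.map_id L]
      refine List.map_congr_left fun x hx => ?_
      have := hL.1 x hx
      simp only [Function.comp_apply, id_eq]
      omega
    · rw [List.pairwise_map]
      refine hL.2.imp_of_mem fun {x y} hx hy hxy => ?_
      have := hL.1 x hx
      omega
    · simpa using h

theorem thetaIdx_thetaList : ∀ (n i : ℕ), 1 ≤ n → thetaIdx n (thetaList n i) = i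
  | 0, _, h => by omega
  | 1, _, _ => rfl
  | n + 2, i, _ => by
    simp only [thetaList, thetaIdx, List.getD_cons_zero, List.tail_cons, List.map_map]
    have : (fun x => x - (i.unpair.1 + 1)) ∘ (fun x => i.unpair.1 + 1 + x) = id := by
      funext x; simp
    rw [this, List.map_id, thetaIdx_thetaList (n + 1) _ (by omega), Nat.pair_unpair]

/-- Tells how much of the name of a coloring has to be read to know it on all subsets of `{0, …,
j-1}`. The recursion rests on `Nat.pair a b < (max a b + 1) ^ 2`. -/
theorem thetaIdx_lt_idxBound : ∀ (n j : ℕ) (L : List ℕ), (∀ x ∈ L, x < j) → L.length = n →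
    thetaIdx n L < idxBound n j
  | 0, _, _, _, _ => Nat.zero_lt_one
  | 1, j, L, hL, h => by
    obtain ⟨a, rfl⟩ := List.length_eq_one_iff.mp h
    exact hL a (by simp)
  | n + 2, j, [], _, h => by simp at h
  | n + 2, j, a :: L, hL, h => by
    have h1 := thetaIdx_lt_idxBound (n + 1) j (L.map fun x => x - (a + 1)) (by
      intro x hx
      obtain ⟨y, hy, rfl⟩ := List.mem_map.mp hx
      have := hL y (by simp [hy])
      omega) (by simpa using h)
    have h2 := hL a (by simp)
    simp only [thetaIdx, idxBound, List.getD_cons_zero, List.tail_cons]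
    refine (Nat.pair_lt_max_add_one_sq _ _).trans_le ?_
    rw [← sq]
    exact Nat.pow_le_pow_left (by omega) 2

theorem idxBound_mono : ∀ n, Monotone (idxBound n)
  | 0 => monotone_const
  | 1 => monotone_id
  | n + 2 => fun i j h => by
    have := idxBound_mono (n + 1) h
    exact Nat.mul_le_mul (by omega) (by omega)

theorem le_idxBound : ∀ n j, 1 ≤ n → j ≤ idxBound n j
  | 0, _, h => by omega
  | 1, _, _ => le_rfl
  | n + 2, j, _ => by
    have : j ≤ j + idxBound (n + 1) j := by omega
    exact this.trans (Nat.le_mul_self _)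

theorem eq_of_pairwise_lt_of_toFinset_eq {L L' : List ℕ} (h : L.Pairwise (· < ·))
    (h' : L'.Pairwise (· < ·)) (e : L.toFinset = L'.toFinset) : L = L' :=
  List.Perm.eq_of_pairwise' h h' (List.perm_of_nodup_nodup_toFinset_eq
    (h.imp ne_of_lt) (h'.imp ne_of_lt) e)

theorem theta_injective {n : ℕ} (hn : 1 ≤ n) {i j : ℕ} (h : theta n i = theta n j) : i = j := by
  have e : thetaSet n i = thetaSet n j := congrArg Subtype.val h
  rw [← toFinset_thetaList, ← toFinset_thetaList] at e
  have := eq_of_pairwise_lt_of_toFinset_eq (pairwise_thetaList n i) (pairwise_thetaList n j) e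
  rw [← thetaIdx_thetaList n i hn, this, thetaIdx_thetaList n j hn]

/-! ### Colorings and their names -/

/-- `M` is an infinite homogeneous set of color `j` for the coloring named by `x`. -/
def HomName (n : ℕ) (x : Baire) (M : ℕ → Bool) (j : ℕ) : Prop :=
  {i | M i = true}.Infinite ∧ ∀ m, (∀ i ∈ thetaList n m, M i = true) → x m = j

theorem homogeneousWithColor_iff {n : ℕ} {k : ℕ∞} {c : Coloring n k} {x : Baire}
    (hx : (coloringSpace n k).Names x c) {M : ℕ → Bool} {j : ℕ} :
    c.HomogeneousWithColor M j ↔ HomName n x M j := by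
  refine and_congr_right fun _ => ⟨fun h m hm => ?_, fun h A hA => ?_⟩
  · rw [hx m]
    exact h _ fun i hi => hm i (mem_thetaList.mpr hi)
  · obtain ⟨m, rfl⟩ := theta_surj n A
    rw [← hx m]
    exact h m fun i hi => hA i (mem_thetaList.mp hi)

theorem HomName.apply_thetaIdx {n : ℕ} {x : Baire} {M : ℕ → Bool} {j : ℕ} (h : HomName n x M j)
    {L : List ℕ} (hL : L.Pairwise (· < ·)) (hlen : L.length = n) (hM : ∀ i ∈ L, M i = true) :
    x (thetaIdx n L) = j :=
  h.2 _ (by rwa [thetaList_thetaIdx n L hL hlen])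

/-- An infinite set has increasing words of every length. -/
theorem exists_pairwise_of_infinite {S : Set ℕ} (hS : S.Infinite) (n : ℕ) :
    ∃ L : List ℕ, L.Pairwise (· < ·) ∧ L.length = n ∧ ∀ i ∈ L, i ∈ S := by
  obtain ⟨t, ht, hc⟩ := hS.exists_subset_card_eq n
  refine ⟨t.sort, (Finset.sortedLT_sort t).pairwise, by rw [Finset.length_sort, hc], fun i hi => ?_⟩
  exact ht ((Finset.mem_sort (r := fun a b => a ≤ b)).mp hi)

theorem HomName.exists_eq {n : ℕ} {x : Baire} {M : ℕ → Bool} {j : ℕ} (h : HomName n x M j) :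
    ∃ m, (∀ i ∈ thetaList n m, M i = true) ∧ x m = j := by
  obtain ⟨L, hL, hlen, hM⟩ := exists_pairwise_of_infinite h.1 n
  exact ⟨thetaIdx n L, by rwa [thetaList_thetaIdx n L hL hlen], h.apply_thetaIdx hL hlen hM⟩

/-- For `n ≥ 1` the numbering is injective, so any bounded sequence of admissible colors is
consistent as a name; for `n = 0` all indices denote the empty set. -/
theorem exists_coloring {n : ℕ} (hn : 1 ≤ n) {k : ℕ∞} {x : Baire} (hk : ∀ m, (x m : ℕ∞) < k)
    (hb : ∃ K, ∀ m, x m ≤ K) : ∃ c : Coloring n k, (coloringSpace n k).Names x c := by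
  choose idx hidx using theta_surj n
  obtain ⟨K, hK⟩ := hb
  refine ⟨⟨fun A => x (idx A), fun A => hk _, (Set.finite_Iic K).subset ?_⟩, fun m => ?_⟩
  · rintro _ ⟨A, rfl⟩
    exact hK _
  · exact congrArg x (theta_injective hn (hidx _).symm)

theorem bounded_of_names {n : ℕ} {k : ℕ∞} {c : Coloring n k} {x : Baire}
    (hx : (coloringSpace n k).Names x c) : ∃ K, ∀ m, x m ≤ K := by
  obtain ⟨K, hK⟩ := c.2.2.bddAbove
  exact ⟨K, fun m => by rw [hx m]; exact hK ⟨_, rfl⟩⟩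

/-! ### The Erdős–Rado construction -/

/-- `b` may follow the chain `L`: it is larger than all elements of `L`, and the colors of the
`(n+1)`-element sets formed by it and `L` are those prescribed by `d`. -/
def ErOk (n : ℕ) (p d : Baire) (L : List ℕ) (b : ℕ) : Prop :=
  (∀ a ∈ L, a < b) ∧ ∀ m < idxBound n L.length, (∀ i ∈ thetaList n m, i < L.length) →
    p (thetaIdx (n + 1) ((thetaList n m).map (fun i => L.getD i 0) ++ [b])) = d m

/-- `L` is the greedy chain of length `j` for the prescription `d`. -/
def ErChain (n : ℕ) (p d : Baire) : ℕ → List ℕ → Prop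
  | 0, L => L = []
  | j + 1, L => ∃ L' b, L = L' ++ [b] ∧ ErChain n p d j L' ∧ ErOk n p d L' b ∧
      ∀ b' < b, ¬ ErOk n p d L' b'

theorem ErChain.length {n : ℕ} {p d : Baire} : ∀ {j L}, ErChain n p d j L → L.length = j
  | 0, _, h => by rw [h]; rfl
  | j + 1, _, ⟨L', b, e, h, _⟩ => by rw [e]; simp [h.length]

theorem ErChain.unique {n : ℕ} {p d : Baire} : ∀ {j L M}, ErChain n p d j L →
    ErChain n p d j M → L = M
  | 0, _, _, h, h' => by rw [h, h']
  | j + 1, _, _, ⟨L, b, e, h, hb, hl⟩, ⟨L', b', e', h', hb', hl'⟩ => by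
    obtain rfl := h.unique h'
    rcases lt_trichotomy b b' with hlt | rfl | hlt
    · exact absurd hb (hl' b hlt)
    · rw [e, e']
    · exact absurd hb' (hl b' hlt)

/-- Arbitrarily long greedy chains are initial segments of a single sequence. -/
theorem exists_of_erChain {n : ℕ} {p d : Baire} (h : ∀ j, ∃ L, ErChain n p d j L) :
    ∃ P : Baire, StrictMono P ∧ (∀ j, ErChain n p d j (initSeg P j)) ∧
      ∀ j, ErOk n p d (initSeg P j) (P j) := by
  have h' : ∀ j, ∃ L' b, ErChain n p d j L' ∧ ErOk n p d L' b ∧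
      ErChain n p d (j + 1) (L' ++ [b]) := by
    intro j
    obtain ⟨L, L', b, rfl, h1, h2, h3⟩ := h (j + 1)
    exact ⟨L', b, h1, h2, L', b, rfl, h1, h2, h3⟩
  choose L P h1 h2 h3 using h'
  have hseg : ∀ j, L j = initSeg P j := by
    intro j
    induction j with
    | zero => exact h1 0
    | succ j ih => rw [initSeg_succ, ← ih]; exact (h1 (j + 1)).unique (h3 j)
  refine ⟨P, strictMono_nat_of_lt_succ fun j => ?_, fun j => hseg j ▸ h1 j, fun j => hseg j ▸ h2 j⟩
  have := (h2 (j + 1)).1 (P j)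
  rw [hseg, initSeg_succ] at this
  exact this (by simp)

theorem pairwise_map_append {L : List ℕ} (hL : L.Pairwise (· < ·)) {b : ℕ} (hb : ∀ i ∈ L, i < b) :
    (L ++ [b]).Pairwise (· < ·) := by
  rw [List.pairwise_append]
  exact ⟨hL, List.pairwise_singleton _ _, fun a ha c hc => by
    rw [List.mem_singleton.mp hc]; exact hb a ha⟩

/-- Along the greedy sequence the colors do not depend on the last elements. -/
theorem erOk_apply {n : ℕ} {p d P : Baire} (h : ∀ j, ErOk n p d (initSeg P j) (P j))
    {L : List ℕ} (hL : L.Pairwise (· < ·)) (hlen : L.length = n) {b : ℕ} (hb : ∀ i ∈ L, i < b) :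
    p (thetaIdx (n + 1) (L.map P ++ [P b])) = d (thetaIdx n L) := by
  have := (h b).2 (thetaIdx n L) (by
    rw [length_initSeg]; exact thetaIdx_lt_idxBound n b L hb hlen)
  rw [thetaList_thetaIdx n L hL hlen, length_initSeg] at this
  rw [← this hb]
  congr 3
  exact List.map_congr_left fun i hi => (initSeg_getD P (hb i hi) 0).symm

/-- The image of a homogeneous set under the greedy sequence is homogeneous. -/
theorem HomName.image {n : ℕ} {p d P : Baire} (hP : StrictMono P)
    (h : ∀ j, ErOk n p d (initSeg P j) (P j)) {M : ℕ → Bool} {j : ℕ} (hM : HomName n d M j)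
    {M' : ℕ → Bool} (hM' : ∀ y, M' y = true ↔ ∃ i, M i = true ∧ P i = y) :
    HomName (n + 1) p M' j := by
  constructor
  · have : {y | M' y = true} = P '' {i | M i = true} := by
      ext y; simp [hM']
    rw [this]
    exact hM.1.image hP.injective.injOn
  · intro m hm
    obtain ⟨g, hg⟩ : ∃ g : ℕ → ℕ, ∀ y, M' y = true → M (g y) = true ∧ P (g y) = y := by
      choose! g hg using fun y => (hM' y).mp
      exact ⟨g, hg⟩
    set L := (thetaList (n + 1) m).map g with hL
    have hLP : L.map P = thetaList (n + 1) m := by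
      rw [hL, List.map_map]
      conv_rhs => rw [← List.map_id (thetaList (n + 1) m)]
      exact List.map_congr_left fun y hy => (hg y (hm y hy)).2
    have hpw : L.Pairwise (· < ·) := by
      have := pairwise_thetaList (n + 1) m
      rw [← hLP, List.pairwise_map] at this
      exact this.imp fun h => hP.lt_iff_lt.mp h
    have hlen : L.length = n + 1 := by simp [hL]
    have hMem : ∀ i ∈ L, M i = true := by
      intro i hi
      obtain ⟨y, hy, rfl⟩ := List.mem_map.mp hi
      exact (hg y (hm y hy)).1
    -- The largest element is split off; the color depends only on the other `n` positions, where it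
    -- is given by `d`.
    obtain ⟨L₀, b, hLb⟩ : ∃ L₀ b, L = L₀ ++ [b] :=
      ⟨L.dropLast, L.getLast (by rintro h; simp [h] at hlen), (List.dropLast_append_getLast _).symm⟩
    rw [hLb, List.pairwise_append] at hpw
    rw [hLb] at hlen hMem
    have hlen' : L₀.length = n := by simpa using hlen
    rw [← thetaIdx_thetaList (n + 1) m (by omega), ← hLP, hLb, List.map_append]
    refine (erOk_apply h hpw.1 hlen' fun i hi => hpw.2.2 i hi b (by simp)).trans ?_
    exact hM.apply_thetaIdx hpw.1 hlen' fun i hi => hMem i (by simp [hi])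

/-- For every bounded coloring there is a prescription with an infinite greedy chain. -/
theorem exists_erChain (n : ℕ) {p : Baire} {K : ℕ} (hK : ∀ m, p m ≤ K) :
    ∃ d : Baire, (∀ m, d m ≤ K) ∧ ∀ j, ∃ L, ErChain n p d j L := by
  -- A nonprincipal ultrafilter assigns to each `S` the color that `S ∪ {b}` has for almost all `b`.
  -- Finitely many such requirements hold simultaneously for some large `b`, so greedy chains
  -- prescribed by these colors never get stuck.
  have hδ : ∀ S : List ℕ, ∃ v, v ≤ K ∧
      ∀ᶠ b in (hyperfilter ℕ : Filter ℕ), p (thetaIdx (n + 1) (S ++ [b])) = v := by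
    intro S
    have := (Ultrafilter.eventually_exists_mem_iff (f := hyperfilter ℕ)
      (P := fun v b => p (thetaIdx (n + 1) (S ++ [b])) = v) (Set.finite_Iic K)).mp
      (Eventually.of_forall fun b => ⟨_, hK _, rfl⟩)
    exact this
  choose δ hδK hδ using hδ
  have hex : ∀ L : List ℕ, ∃ b,
      ErOk n p (fun m => δ ((thetaList n m).map fun i => L.getD i 0)) L b := by
    intro L
    have h1 : ∀ᶠ b in (hyperfilter ℕ : Filter ℕ), ∀ a ∈ L.toFinset, a < b := by
      rw [eventually_all_finset]
      exact fun a _ => (eventually_gt_atTop a).filter_mono Nat.hyperfilter_le_atTop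
    have h2 : ∀ᶠ b in (hyperfilter ℕ : Filter ℕ), ∀ m ∈ Finset.range (idxBound n L.length),
        p (thetaIdx (n + 1) ((thetaList n m).map (fun i => L.getD i 0) ++ [b])) =
          δ ((thetaList n m).map fun i => L.getD i 0) := by
      rw [eventually_all_finset]
      exact fun m _ => hδ _
    obtain ⟨b, hb1, hb2⟩ := (h1.and h2).exists
    exact ⟨b, fun a ha => hb1 a (by simpa using ha), fun m hm _ => hb2 m (by simpa using hm)⟩
  classical
  let nxt : List ℕ → ℕ := fun L => Nat.find (hex L)
  let Ls : ℕ → List ℕ := fun j => Nat.rec [] (fun _ L => L ++ [nxt L]) j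
  let P : Baire := fun j => nxt (Ls j)
  have hLs : ∀ j, Ls j = initSeg P j := by
    intro j
    induction j with
    | zero => rfl
    | succ j ih => rw [initSeg_succ, ← ih]
  let d : Baire := fun m => δ ((thetaList n m).map P)
  -- Although `d` refers to the completed sequence `P`, the entries consulted at length `j` involve
  -- only elements already in the chain.
  have hd : ∀ j b, ErOk n p d (initSeg P j) b ↔
      ErOk n p (fun m => δ ((thetaList n m).map fun i => (initSeg P j).getD i 0))
        (initSeg P j) b := by
    intro j b
    refine and_congr_right fun _ => forall_congr' fun m => imp_congr_right fun _ =>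
      forall_congr' fun hm => ?_
    have : (thetaList n m).map P = (thetaList n m).map fun i => (initSeg P j).getD i 0 :=
      List.map_congr_left fun i hi => (initSeg_getD P (by simpa using hm i hi) 0).symm
    simp only [d, this]
  refine ⟨d, fun m => hδK _, fun j => ⟨initSeg P j, ?_⟩⟩
  induction j with
  | zero => rfl
  | succ j ih =>
    refine ⟨_, _, initSeg_succ P j, ih, (hd j _).mpr ?_, fun b' hb' => fun h => ?_⟩
    · have := Nat.find_spec (hex (Ls j))
      rw [hLs j] at this
      simpa only [P, nxt, hLs j] using this
    · exact Nat.find_min (hex (Ls j)) hb' (by rw [hLs j]; exact (hd j _).mp h)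

/-- Ramsey's theorem. -/
theorem exists_homName {n : ℕ} (hn : 1 ≤ n) {x : Baire} (hb : ∃ K, ∀ m, x m ≤ K) :
    ∃ M j, HomName n x M j := by
  obtain ⟨K, hK⟩ := hb
  induction n, hn using Nat.le_induction generalizing x K with
  | base =>
    obtain ⟨j, -, hj⟩ := (Ultrafilter.eventually_exists_mem_iff (f := hyperfilter ℕ)
      (P := fun v b => x b = v) (Set.finite_Iic K)).mp
      (Eventually.of_forall fun b => ⟨_, hK _, rfl⟩)
    refine ⟨fun i => decide (x i = j), j, ?_, fun m hm => ?_⟩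
    · simp only [decide_eq_true_eq]
      exact fun hfin => notMem_hyperfilter_of_finite hfin hj
    · simpa [thetaList] using hm
  | succ n hn ih =>
    obtain ⟨d, hd, hc⟩ := exists_erChain n hK
    obtain ⟨P, hP, -, hok⟩ := exists_of_erChain hc
    obtain ⟨M, j, hM⟩ := ih K hd
    classical
    exact ⟨fun y => decide (∃ i, M i = true ∧ P i = y), j,
      hM.image hP hok fun y => by simp⟩

theorem mem_dom_CRT {n : ℕ} (hn : 1 ≤ n) {k : ℕ∞} (c : Coloring n k) : c ∈ (CRT n k).dom := by
  obtain ⟨x, hx⟩ := (coloringSpace n k).surj c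
  obtain ⟨M, j, h⟩ := exists_homName hn (bounded_of_names hx)
  obtain ⟨m, -, hm⟩ := h.exists_eq
  refine ⟨(⟨j, ?_⟩, M), (homogeneousWithColor_iff hx).mpr h⟩
  rw [← hm, hx m]
  exact c.2.1 _

/-! ### Simple reductions between versions of Ramsey's theorem -/

theorem HomName.color_lt {n : ℕ} {k : ℕ∞} {c : Coloring n k} {x : Baire}
    (hx : (coloringSpace n k).Names x c) {M : ℕ → Bool} {j : ℕ} (h : HomName n x M j) :
    (j : ℕ∞) < k := by
  obtain ⟨m, -, hm⟩ := h.exists_eq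
  rw [← hm, hx m]
  exact c.2.1 _

/-- The color of a homogeneous set is attained by the coloring, so an answer for the larger palette
already lies in the smaller one. -/
theorem CRT_mono (n : ℕ) {k k' : ℕ∞} (hk : k ≤ k') : SRed (CRT n k) (CRT n k') := by
  refine ⟨_, _, isWordMap_id, isWordMap_id, fun p c hp ⟨⟨⟨j, hj⟩, M⟩, hM⟩ =>
    ⟨p, ⟨c.1, fun A => (c.2.1 A).trans_le hk, c.2.2⟩, maps_id p, hp,
      ⟨(⟨j, hj.trans_le hk⟩, M), hM⟩, ?_⟩⟩
  rintro _ ⟨⟨j', hj'⟩, M'⟩ ⟨a, b, rfl, ha, hb⟩ hM'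
  have hom := (homogeneousWithColor_iff (c := c) hp).mp hM'
  exact ⟨_, (⟨j', hom.color_lt hp⟩, M'), maps_id _, ⟨a, b, rfl, ha, hb⟩, hM'⟩

theorem CSRT_mono (n : ℕ) {k k' : ℕ∞} (hk : k ≤ k') : SRed (CSRT n k) (CSRT n k') := by
  refine ⟨_, _, isWordMap_id, isWordMap_id, fun p c hp ⟨⟨⟨j, hj⟩, M⟩, hst, hM⟩ =>
    ⟨p, ⟨c.1, fun A => (c.2.1 A).trans_le hk, c.2.2⟩, maps_id p, hp,
      ⟨(⟨j, hj.trans_le hk⟩, M), hst, hM⟩, ?_⟩⟩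
  rintro _ ⟨⟨j', hj'⟩, M'⟩ ⟨a, b, rfl, ha, hb⟩ ⟨hst', hM'⟩
  have hom := (homogeneousWithColor_iff (c := c) hp).mp hM'
  exact ⟨_, (⟨j', hom.color_lt hp⟩, M'), maps_id _, ⟨a, b, rfl, ha, hb⟩, hst, hM'⟩

theorem CSRT_sRed_CRT (n : ℕ) (k : ℕ∞) : SRed (CSRT n k) (CRT n k) :=
  ⟨_, _, isWordMap_id, isWordMap_id, fun p c hp ⟨y, hst, hy⟩ =>
    ⟨p, c, maps_id p, hp, ⟨y, hy⟩, fun r y' hr hy' => ⟨r, y', maps_id r, hr, hst, hy'⟩⟩⟩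

theorem SRT_sRed_RT (n : ℕ) (k : ℕ∞) : SRed (SRT n k) (RT n k) :=
  ⟨_, _, isWordMap_id, isWordMap_id, fun p c hp ⟨y, hst, hy⟩ =>
    ⟨p, c, maps_id p, hp, ⟨y, hy⟩, fun r y' hr hy' => ⟨r, y', maps_id r, hr, hst, hy'⟩⟩⟩

theorem RT_sRed_CRT (n : ℕ) (k : ℕ∞) : SRed (RT n k) (CRT n k) := by
  obtain ⟨π, hπ, Hπ⟩ := exists_wordMap_snd
  refine ⟨_, π, isWordMap_id, hπ, fun p c hp ⟨M, j, hM⟩ => ⟨p, c, maps_id p, hp,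
    ⟨(⟨j, ((homogeneousWithColor_iff hp).mp hM).color_lt hp⟩, M), hM⟩, ?_⟩⟩
  rintro _ ⟨j', M'⟩ ⟨a, b, rfl, ha, hb⟩ hM'
  exact ⟨b, M', Hπ a b, hb, _, hM'⟩

/-- From a coloring and a homogeneous set one can compute its color. -/
theorem exists_wordMap_color (n : ℕ) : ∃ h, IsWordMap h ∧ ∀ (p r : Baire) (M : ℕ → Bool) (j : ℕ),
    HomName n p M j → (∀ i, r i = (M i).toNat) →
      Maps h (pairB p r) (pairB (fun _ => j) r) := by
  have h1 := primrec_thetaList n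
  obtain ⟨h, hh, Hh⟩ := exists_wordMap (fun u m s => if m % 2 = 0 then
    (if (thetaList n s).all (fun i => decide (u[2 * i + 1]? = some 1)) = true then u[2 * s]?
      else none) else u[2 * (m / 2) + 1]?) (by fun_prop)
  refine ⟨h, hh, fun p r M j hM hr => Hh _ _ (fun m => ?_) fun m l s v hv => ?_⟩
  · by_cases hm : m % 2 = 0
    · obtain ⟨s, hs, hj⟩ := hM.exists_eq
      -- A prefix containing both the color of the `s`-th set and the membership bits of its
      -- elements.
      refine ⟨2 * s + 1 + (thetaList n s).foldr (fun i a => (2 * i + 2) + a) 0, s, ?_⟩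
      have hfold : ∀ L : List ℕ, ∀ i ∈ L, 2 * i + 2 ≤ L.foldr (fun i a => (2 * i + 2) + a) 0 := by
        intro L
        induction L with
        | nil => simp
        | cons a L ih =>
          intro i hi
          rcases List.mem_cons.mp hi with rfl | hi
          · simp
          · have := ih i hi
            simp only [List.foldr_cons]
            omega
      rw [if_pos hm, if_pos, initSeg_getElem?_of_lt _ (by omega), pairB_left, hj]
      · simp [pairB, hm]
      · rw [List.all_eq_true]
        intro i hi
        have := hfold _ i hi
        rw [initSeg_getElem?_of_lt _ (by omega), pairB_right, hr, hs i hi]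
        rfl
    · refine ⟨2 * (m / 2) + 2, 0, ?_⟩
      rw [if_neg hm, initSeg_getElem?_of_lt _ (by omega), pairB_right]
      simp only [pairB, hm, if_false]
  · by_cases hm : m % 2 = 0
    · rw [if_pos hm] at hv
      split_ifs at hv with hall
      obtain ⟨-, hv⟩ := eq_of_initSeg_getElem? hv
      rw [pairB_left] at hv
      rw [← hv, hM.2 s]
      · simp [pairB, hm]
      · rw [List.all_eq_true] at hall
        intro i hi
        obtain ⟨-, h1⟩ := eq_of_initSeg_getElem? (of_decide_eq_true (hall i hi))
        rw [pairB_right, hr] at h1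
        exact Bool.toNat_eq_one.mp h1
    · rw [if_neg hm] at hv
      obtain ⟨-, hv⟩ := eq_of_initSeg_getElem? hv
      rw [← hv, pairB_right]
      simp only [pairB, hm, if_false]

theorem CRT_wRed_RT (n : ℕ) (k : ℕ∞) : WRed (CRT n k) (RT n k) := by
  obtain ⟨h, hh, Hh⟩ := exists_wordMap_color n
  refine ⟨_, h, isWordMap_id, hh, fun p c hp ⟨⟨j, M⟩, hM⟩ =>
    ⟨p, c, maps_id p, hp, ⟨M, _, hM⟩, ?_⟩⟩
  rintro r M' hr ⟨j', hM'⟩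
  have hom := (homogeneousWithColor_iff hp).mp hM'
  exact ⟨_, (⟨j', hom.color_lt hp⟩, M'), Hh p r M' j' hom hr, ⟨_, _, rfl, rfl, hr⟩, hM'⟩

theorem CSRT_wRed_SRT (n : ℕ) (k : ℕ∞) : WRed (CSRT n k) (SRT n k) := by
  obtain ⟨h, hh, Hh⟩ := exists_wordMap_color n
  refine ⟨_, h, isWordMap_id, hh, fun p c hp ⟨⟨j, M⟩, hst, hM⟩ =>
    ⟨p, c, maps_id p, hp, ⟨M, hst, _, hM⟩, ?_⟩⟩
  rintro r M' hr ⟨-, j', hM'⟩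
  have hom := (homogeneousWithColor_iff hp).mp hM'
  exact ⟨_, (⟨j', hom.color_lt hp⟩, M'), Hh p r M' j' hom hr, ⟨_, _, rfl, rfl, hr⟩, hst, hM'⟩

/-! ### The jump of Ramsey's theorem -/

/-- An (n+1)-set is colored by the approximation, at the stage given by its largest element, to the
color of the remaining n-set. Convergence of the approximations is exactly stability. -/
theorem CRT_jump_sRed_CSRT {n : ℕ} (hn : 1 ≤ n) :
    SRed (CRT n 2).jump (CSRT (n + 1) 2) := by
  have h1 := primrec_thetaList (n + 1)
  have h2 := primrec_thetaIdx n
  -- Truncation by 1 is needed because approximations need not themselves have values below 2; the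
  -- limit has, so it is unaffected.
  obtain ⟨k, hk, Hk⟩ := exists_wordMap_of_index
    (fun m => Nat.pair ((thetaList (n + 1) m).getD n 0) (thetaIdx n ((thetaList (n + 1) m).take n)))
    (fun v _ => min 1 v) (by fun_prop) (by fun_prop)
  refine ⟨k, _, hk, isWordMap_id, fun p c ⟨q, hl, hq⟩ _ => ?_⟩
  replace hq : (coloringSpace n 2).Names q c := hq
  rw [isLim_iff] at hl
  have hq1 : ∀ m, q m ≤ 1 := by
    intro m
    have := c.2.1 (theta n m)
    rw [← hq m] at this
    have h' : q m < 2 := by exact_mod_cast this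
    omega
  set x : Baire := fun m => min 1 (p (Nat.pair ((thetaList (n + 1) m).getD n 0)
    (thetaIdx n ((thetaList (n + 1) m).take n)))) with hx
  have hx1 : ∀ m, x m ≤ 1 := fun m => min_le_left _ _
  have hxL : ∀ L : List ℕ, L.Pairwise (· < ·) → L.length = n → ∀ i, (∀ a ∈ L, a < i) →
      x (thetaIdx (n + 1) (L ++ [i])) = min 1 (p (Nat.pair i (thetaIdx n L))) := by
    intro L hL hlen i hi
    simp only [hx]
    rw [thetaList_thetaIdx (n + 1) (L ++ [i]) (pairwise_map_append hL hi) (by simp [hlen])]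
    have e1 : (L ++ [i]).getD n 0 = i := by
      rw [List.getD_eq_getElem?_getD, List.getElem?_append_right (by omega)]
      simp [hlen]
    have e2 : (L ++ [i]).take n = L := by
      rw [← hlen]; simp
    rw [e1, e2]
  obtain ⟨c', hc'⟩ := exists_coloring (k := 2) (n := n + 1) (by omega) (x := x) (fun m => by
    have : x m < 2 := by have := hx1 m; omega
    exact_mod_cast this) ⟨1, hx1⟩
  have hst : c'.Stable := by
    intro A hA
    obtain ⟨m, hm⟩ := thetaSet_surj n A (by omega)
    refine ⟨q m, ?_⟩
    have hev : ∀ᶠ i in atTop, ∀ a ∈ A, a < i := by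
      rw [eventually_all_finset]
      exact fun a _ => eventually_gt_atTop a
    filter_upwards [hl m, hev] with i hi hA'
    have hcard : (insert i A).card = n + 1 := by
      rw [Finset.card_insert_of_notMem fun h => (hA' i h).false, hA]
    refine ⟨hcard, ?_⟩
    have hlt : ∀ a ∈ thetaList n m, a < i := fun a ha => hA' a (by
      rw [← hm]; exact mem_thetaList.mp ha)
    have e := hxL (thetaList n m) (pairwise_thetaList n m) (length_thetaList n m) i hlt
    rw [thetaIdx_thetaList n m hn, hi, min_eq_right (hq1 m), hc'] at e
    rw [← e]
    refine congrArg c'.1 (Subtype.ext ?_)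
    change insert i A = thetaSet (n + 1) (thetaIdx (n + 1) (thetaList n m ++ [i]))
    rw [← toFinset_thetaList, thetaList_thetaIdx (n + 1) _
      (pairwise_map_append (pairwise_thetaList n m) hlt) (by simp)]
    ext a
    simp [mem_thetaList, hm]
  obtain ⟨y, hy⟩ := mem_dom_CRT (by omega) c'
  refine ⟨x, c', Hk p, hc', ⟨y, hst, hy⟩, ?_⟩
  rintro r ⟨⟨j, hj⟩, M⟩ hr ⟨-, hM⟩
  refine ⟨r, (⟨j, hj⟩, M), maps_id r, hr, (homogeneousWithColor_iff (c := c) hq).mpr ?_⟩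
  have hom := (homogeneousWithColor_iff hc').mp hM
  refine ⟨hom.1, fun m hm => ?_⟩
  have hev : ∀ᶠ i in atTop, ∀ a ∈ thetaSet n m, a < i := by
    rw [eventually_all_finset]
    exact fun a _ => eventually_gt_atTop a
  -- An element of `M` above the given set and past the stage where its color has converged.
  obtain ⟨i, hiM, hi, hi'⟩ := ((Nat.frequently_atTop_iff_infinite.mpr hom.1).and_eventually
    ((hl m).and hev)).exists
  have hlt : ∀ a ∈ thetaList n m, a < i := fun a ha => hi' a (mem_thetaList.mp ha)
  have e := hxL (thetaList n m) (pairwise_thetaList n m) (length_thetaList n m) i hlt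
  rw [thetaIdx_thetaList n m hn, hi, min_eq_right (hq1 m)] at e
  rw [← e]
  refine hom.apply_thetaIdx (pairwise_map_append (pairwise_thetaList n m) hlt) (by simp)
    fun a ha => ?_
  rcases List.mem_append.mp ha with ha | ha
  · exact hm a ha
  · rw [List.mem_singleton.mp ha]; exact hiM

/-! ### Weak Kőnig's lemma from Ramsey's theorem -/

/-- `v` extends `w` and `u` contains all prefixes of `v`. -/
def goodExt (u : List ℕ) (w v : List Bool) : Bool :=
  decide (v.take w.length = w) &&
    (List.range (v.length + 1)).all fun l => decide (u.getD (Encodable.encode (v.take l)) 0 = 1)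

/-- Some word of length at least `N` extends `w`, as far as `u` can tell. -/
def hasHigher (u : List ℕ) (w : List Bool) (N : ℕ) : Bool :=
  (List.range u.length).any fun e => ((Encodable.decode₂ (List Bool) e).map fun v =>
    goodExt u w v && decide (N ≤ v.length)).getD false

/-- The color is `0` if the subtree above `w0` appears to be at least as high as the one above
`w1`, and `1` otherwise. -/
def nodeColor (u : List ℕ) (w : List Bool) : ℕ :=
  if ((List.range u.length).all fun e => ((Encodable.decode₂ (List Bool) e).map fun v =>
      !goodExt u (w ++ [true]) v || hasHigher u (w ++ [false]) v.length).getD true) = true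
  then 0 else 1

section

variable {α : Type} [Primcodable α] {u : α → List ℕ} {w v : α → List Bool} {N : α → ℕ}

@[fun_prop]
theorem Prim.decode₂' (hN : Primrec N) :
    Primrec fun a => Encodable.decode₂ (List Bool) (N a) := Primrec.decode₂.comp hN

@[fun_prop]
theorem Prim.goodExt (hu : Primrec u) (hw : Primrec w) (hv : Primrec v) :
    Primrec fun a => goodExt (u a) (w a) (v a) := by
  unfold Weihrauch.goodExt
  fun_prop

@[fun_prop]
theorem Prim.hasHigher (hu : Primrec u) (hw : Primrec w) (hN : Primrec N) :
    Primrec fun a => hasHigher (u a) (w a) (N a) := by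
  unfold Weihrauch.hasHigher
  fun_prop

@[fun_prop]
theorem Prim.nodeColor (hu : Primrec u) (hw : Primrec w) :
    Primrec fun a => nodeColor (u a) (w a) := by
  unfold Weihrauch.nodeColor
  fun_prop

end

theorem hasHigher_iff {u : List ℕ} {w : List Bool} {N : ℕ} : hasHigher u w N = true ↔
    ∃ v, Encodable.encode v < u.length ∧ goodExt u w v = true ∧ N ≤ v.length := by
  simp only [hasHigher, List.any_eq_true, List.mem_range]
  refine ⟨fun ⟨e, he, h⟩ => ?_, fun ⟨v, hv, h1, h2⟩ => ⟨_, hv, ?_⟩⟩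
  · rcases hd : Encodable.decode₂ (List Bool) e with _ | v
    · simp [hd] at h
    · rw [Encodable.decode₂_eq_some] at hd
      subst hd
      exact ⟨v, he, by simpa using h⟩
  · simp [h1, h2]

theorem nodeColor_eq_zero_iff {u : List ℕ} {w : List Bool} : nodeColor u w = 0 ↔
    ∀ v, Encodable.encode v < u.length → goodExt u (w ++ [true]) v = true →
      ∃ v', Encodable.encode v' < u.length ∧ goodExt u (w ++ [false]) v' = true ∧
        v.length ≤ v'.length := by
  have : nodeColor u w = 0 ↔ ∀ e < u.length, ((Encodable.decode₂ (List Bool) e).map fun v =>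
      !goodExt u (w ++ [true]) v || hasHigher u (w ++ [false]) v.length).getD true = true := by
    simp only [nodeColor, List.all_eq_true, List.mem_range]
    split_ifs with h
    · exact iff_of_true rfl h
    · exact iff_of_false not_false h
  simp only [this, ← hasHigher_iff]
  refine ⟨fun h v hv hg => ?_, fun h e he => ?_⟩
  · simpa [hg] using h _ hv
  · rcases hd : Encodable.decode₂ (List Bool) e with _ | v
    · rfl
    · rw [Encodable.decode₂_eq_some] at hd
      subst hd
      by_cases hg : goodExt u (w ++ [true]) v = true
      · simp [h v he hg]
      · simp [Bool.eq_false_iff.mpr hg]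

/-- The subtree of `T` above `w` is infinite. -/
def InfAbove (T : BinTree) (w : List Bool) : Prop := {v | v ∈ T.1 ∧ w <+: v}.Infinite

theorem InfAbove.children {T : BinTree} {w : List Bool} (h : InfAbove T w) :
    InfAbove T (w ++ [false]) ∨ InfAbove T (w ++ [true]) := by
  by_contra hn
  simp only [InfAbove, not_or, Set.not_infinite] at hn
  refine h (((Set.finite_singleton w).union (hn.1.union hn.2)).subset ?_)
  rintro v ⟨hv, t, rfl⟩
  rcases t with _ | ⟨b, t⟩
  · left; simp
  · right
    cases b
    · exact Or.inl ⟨hv, t, by simp⟩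
    · exact Or.inr ⟨hv, t, by simp⟩

theorem InfAbove.mem {T : BinTree} {w : List Bool} (h : InfAbove T w) : w ∈ T.1 := by
  obtain ⟨v, hv, hw⟩ := h.nonempty
  exact T.2 _ _ hw hv

theorem InfAbove.exists_length {T : BinTree} {w : List Bool} (h : InfAbove T w) (N : ℕ) :
    ∃ v ∈ T.1, w <+: v ∧ N ≤ v.length := by
  by_contra hn
  push Not at hn
  exact h ((List.finite_length_lt Bool N).subset fun v hv => hn v hv.1 hv.2)

theorem eventually_getD_component {p q : Baire} {T : BinTree} (hl : IsLim p q)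
    (hq : treeSpace.Names q T) (v : List Bool) :
    ∀ᶠ s in atTop, ((initSeg (component p s) s).getD (Encodable.encode v) 0 = 1 ↔ v ∈ T.1) ∧
      Encodable.encode v < s := by
  filter_upwards [isLim_iff.mp hl (Encodable.encode v), eventually_gt_atTop (Encodable.encode v)]
    with s hs hlt
  refine ⟨?_, hlt⟩
  rw [initSeg_getD _ hlt, component, hs]
  by_cases hv : v ∈ T.1
  · simp [(hq v).1 hv, hv]
  · simp [(hq v).2 hv, hv]

/-- Only finitely many words have the critical length, and the approximations become correct on all
of them. Since `goodExt` demands all prefixes, no longer word can then appear to be in the tree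
above `a`. -/
theorem eventually_goodExt_length {p q : Baire} {T : BinTree} (hl : IsLim p q)
    (hq : treeSpace.Names q T) {a : List Bool} (ha : ¬ InfAbove T a) :
    ∃ N, ∀ᶠ s in atTop, ∀ v, goodExt (initSeg (component p s) s) a v = true → v.length < N := by
  rw [InfAbove, Set.not_infinite] at ha
  obtain ⟨N, hN⟩ := (ha.image List.length).bddAbove
  -- Truncation to this length exceeds the height `N` and still extends `a`.
  refine ⟨max (N + 1) a.length, ?_⟩
  set N' := max (N + 1) a.length
  have hev : ∀ᶠ s in atTop, ∀ v ∈ (List.finite_length_lt Bool (N' + 1)).toFinset,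
      ((initSeg (component p s) s).getD (Encodable.encode v) 0 = 1 ↔ v ∈ T.1) := by
    rw [eventually_all_finset]
    exact fun v _ => (eventually_getD_component hl hq v).mono fun _ h => h.1
  filter_upwards [hev] with s hs v hv
  by_contra hlen
  push Not at hlen
  simp only [goodExt, Bool.and_eq_true, decide_eq_true_eq, List.all_eq_true, List.mem_range] at hv
  have h1 := hv.2 N' (by omega)
  have hlen' : (v.take N').length = N' := by simp [hlen]
  have h2 := (hs (v.take N') (by simp [hlen'])).mp h1
  have h3 : a <+: v.take N' := by
    rw [← hv.1, List.prefix_take_iff]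
    exact ⟨List.take_prefix _ _, by simp [N']⟩
  have := hN ⟨_, ⟨h2, h3⟩, rfl⟩
  rw [hlen'] at this
  omega

theorem eventually_goodExt {p q : Baire} {T : BinTree} (hl : IsLim p q)
    (hq : treeSpace.Names q T) {a : List Bool} (ha : InfAbove T a) (N : ℕ) :
    ∃ v, N ≤ v.length ∧ ∀ᶠ s in atTop, goodExt (initSeg (component p s) s) a v = true ∧
      Encodable.encode v < s := by
  obtain ⟨v, hv, hav, hN⟩ := ha.exists_length N
  refine ⟨v, hN, ?_⟩
  have hev : ∀ᶠ s in atTop, ∀ l ∈ Finset.range (v.length + 1),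
      ((initSeg (component p s) s).getD (Encodable.encode (v.take l)) 0 = 1 ↔ v.take l ∈ T.1) := by
    rw [eventually_all_finset]
    exact fun l _ => (eventually_getD_component hl hq (v.take l)).mono fun _ h => h.1
  filter_upwards [hev, eventually_getD_component hl hq v] with s hs hs'
  refine ⟨?_, hs'.2⟩
  simp only [goodExt, Bool.and_eq_true, decide_eq_true_eq, List.all_eq_true, List.mem_range]
  exact ⟨(List.prefix_iff_eq_take.mp hav).symm, fun l hl =>
    (hs l (Finset.mem_range.mpr hl)).mpr (T.2 _ _ (List.take_prefix _ _) hv)⟩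

/-- A color that appears infinitely often points to an infinite subtree. -/
theorem InfAbove.of_nodeColor {p q : Baire} {T : BinTree} (hl : IsLim p q)
    (hq : treeSpace.Names q T) {w : List Bool} (hw : InfAbove T w) {j : ℕ} (hj : j < 2)
    (hf : ∃ᶠ s in atTop, nodeColor (initSeg (component p s) s) w = j) :
    InfAbove T (w ++ [!decide (j = 0)]) := by
  by_contra hn
  interval_cases j
  · have hi : InfAbove T (w ++ [true]) := hw.children.resolve_left hn
    obtain ⟨N, hN⟩ := eventually_goodExt_length hl hq hn
    obtain ⟨v, hNv, hv⟩ := eventually_goodExt hl hq hi N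
    refine hf ?_
    filter_upwards [hN, hv] with s h1 h2 h3
    obtain ⟨v', -, h5, h6⟩ := nodeColor_eq_zero_iff.mp h3 v (by simpa using h2.2) h2.1
    have := h1 v' h5
    omega
  · have hi : InfAbove T (w ++ [false]) := hw.children.resolve_right hn
    obtain ⟨N, hN⟩ := eventually_goodExt_length hl hq hn
    obtain ⟨v, hNv, hv⟩ := eventually_goodExt hl hq hi N
    refine hf ?_
    filter_upwards [hN, hv] with s h1 h2 h3
    have : nodeColor (initSeg (component p s) s) w = 0 := nodeColor_eq_zero_iff.mpr
      fun v' _ hv' => ⟨v, by simpa using h2.2, h2.1, by have := h1 v' hv'; omega⟩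
    omega

/-- One coloring of stages is posed for each word. Starting from the root, following the colors
stays within infinite subtrees; colors at other words may be arbitrary and are never consulted. -/
theorem WKL_jump_sRed_CRT : SRed WKL.jump (CRT 1 2).parallelization := by
  obtain ⟨k, hk, Hk⟩ := exists_wordMap_of_bound (fun n => Nat.pair n.unpair.2 n.unpair.2)
    (fun u n => ((Encodable.decode (α := List Bool) n.unpair.1).map fun w =>
      nodeColor (compSeg u n.unpair.2 n.unpair.2) w).getD 0) (by fun_prop) (by fun_prop)
  -- The word reached after `l` steps. The color for `w` is the first letter of the solution with
  -- index `encode w`; the value is `none` until all letters needed have been read.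
  let node : List ℕ → ℕ → Option (List Bool) := fun u l => Nat.rec (some []) (fun _ o =>
    o.bind fun w => (u[Nat.pair (Encodable.encode w) 0]?).map fun a => w ++ [!decide (a = 0)]) l
  have hnode : Primrec fun x : List ℕ × ℕ × ℕ => node x.1 x.2.1 := by
    simp only [node]; fun_prop
  obtain ⟨h, hh, Hh⟩ := exists_wordMap (fun u l _ => (node u l).bind fun w =>
    (u[Nat.pair (Encodable.encode w) 0]?).map fun a => (!decide (a = 0)).toNat) (by fun_prop)
  refine ⟨k, h, hk, hh, fun p T ⟨q, hl, hq⟩ ⟨y, hinf, _⟩ => ?_⟩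
  have hcol : ∀ w : List Bool, ∃ c : Coloring 1 2, (coloringSpace 1 2).Names
      (fun s => nodeColor (initSeg (component p s) s) w) c := by
    have hle : ∀ w s, nodeColor (initSeg (component p s) s) w ≤ 1 := fun w s => by
      unfold nodeColor; split_ifs <;> omega
    refine fun w => exists_coloring le_rfl (fun s => ?_) ⟨1, hle w⟩
    have : nodeColor (initSeg (component p s) s) w < 2 := by have := hle w s; omega
    exact_mod_cast this
  choose c hc using hcol
  -- A dummy instance for any index that codes no word; it matches the default 0 in `k`.
  obtain ⟨c₀, hc₀⟩ := exists_coloring (n := 1) (k := 2) le_rfl (x := fun _ => 0)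
    (fun _ => by norm_num) ⟨0, fun _ => le_rfl⟩
  refine ⟨_, fun i => ((Encodable.decode (α := List Bool) i).map c).getD c₀, Hk p, fun i => ?_,
    ?_, ?_⟩
  · rcases hd : Encodable.decode (α := List Bool) i with _ | w
    · intro s
      simp only [component, Nat.unpair_pair, hd, Option.map_none, Option.getD_none]
      exact hc₀ s
    · intro s
      simp only [component, Nat.unpair_pair, compSeg_initSeg p le_rfl, hd, Option.map_some,
        Option.getD_some]
      exact hc w s
  · choose y hy using fun i => mem_dom_CRT le_rfl
      (((Encodable.decode (α := List Bool) i).map c).getD c₀)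
    exact ⟨y, hy⟩
  · intro r z hr hz
    have key : ∀ w, InfAbove T w →
        InfAbove T (w ++ [!decide (r (Nat.pair (Encodable.encode w) 0) = 0)]) := by
      intro w hw
      have h1 := hz (Encodable.encode w)
      obtain ⟨a, b, e, ha, hb⟩ := hr (Encodable.encode w)
      rcases hzw : z (Encodable.encode w) with ⟨⟨j, hj⟩, M⟩
      rw [hzw] at h1 ha
      replace ha : a 0 = j := ha
      have hrj : r (Nat.pair (Encodable.encode w) 0) = j := by
        have := congrFun e 0
        simpa [component, pairB, ha] using this
      rw [hrj]
      simp only [Encodable.encodek, Option.map_some, Option.getD_some] at h1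
      have hom := (homogeneousWithColor_iff (hc w)).mp h1
      refine hw.of_nodeColor hl hq (by exact_mod_cast hj) ?_
      refine (Nat.frequently_atTop_iff_infinite.mpr hom.1).mono fun s hs => ?_
      exact hom.2 s (by simpa [thetaList] using hs)
    let W : ℕ → List Bool := fun l => Nat.rec []
      (fun _ w => w ++ [!decide (r (Nat.pair (Encodable.encode w) 0) = 0)]) l
    let x : ℕ → Bool := fun l => !decide (r (Nat.pair (Encodable.encode (W l)) 0) = 0)
    have hW : ∀ l, W l = (List.range l).map x := by
      intro l
      induction l with
      | zero => rfl
      | succ l ih => rw [List.range_succ, List.map_append, ← ih]; rfl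
    have hWinf : ∀ l, InfAbove T (W l) := by
      intro l
      induction l with
      | zero => exact hinf.mono fun v hv => ⟨hv, List.nil_prefix⟩
      | succ l ih => exact key _ ih
    have hsound : ∀ l L w, node (initSeg r L) l = some w → w = W l := by
      intro l L
      induction l with
      | zero => intro w hw; exact (Option.some.inj hw).symm
      | succ l ih =>
        intro w hw
        obtain ⟨w', hw', hw⟩ := Option.bind_eq_some_iff.mp hw
        obtain ⟨a, ha, rfl⟩ := Option.map_eq_some_iff.mp hw
        rw [ih w' hw'] at ha ⊢
        obtain ⟨-, rfl⟩ := eq_of_initSeg_getElem? ha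
        rfl
    have hcomplete : ∀ l, ∃ L, ∀ L', L ≤ L' → node (initSeg r L') l = some (W l) := by
      intro l
      induction l with
      | zero => exact ⟨0, fun _ _ => rfl⟩
      | succ l ih =>
        obtain ⟨L, hL⟩ := ih
        refine ⟨max L (Nat.pair (Encodable.encode (W l)) 0 + 1), fun L' hL' => ?_⟩
        refine Option.bind_eq_some_iff.mpr ⟨_, hL L' (by omega), ?_⟩
        rw [initSeg_getElem?_of_lt r (by omega)]
        rfl
    refine ⟨fun l => (x l).toNat, x, Hh _ _ (fun l => ?_) (fun l L _ v hv => ?_), fun _ => rfl,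
      hinf, fun l => ?_⟩
    · obtain ⟨L, hL⟩ := hcomplete l
      refine ⟨max L (Nat.pair (Encodable.encode (W l)) 0 + 1), 0, ?_⟩
      refine Option.bind_eq_some_iff.mpr ⟨_, hL _ (by omega), ?_⟩
      rw [initSeg_getElem?_of_lt r (by omega)]
      rfl
    · obtain ⟨w', hw', hw⟩ := Option.bind_eq_some_iff.mp hv
      obtain ⟨a, ha, rfl⟩ := Option.map_eq_some_iff.mp hw
      rw [hsound l L w' hw'] at ha
      obtain ⟨-, rfl⟩ := eq_of_initSeg_getElem? ha
      rfl
    · rw [← hW]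
      exact (hWinf l).mem

/-- A jump moves inside the parallelization and is then absorbed by raising the exponent by one. -/
theorem iterJump_WKL_sRed_CRT {n : ℕ} (hn : 1 ≤ n) :
    SRed (WKL.iterJump n) (CRT n 2).parallelization := by
  induction n, hn using Nat.le_induction with
  | base => exact WKL_jump_sRed_CRT
  | succ n hn ih =>
    rw [iterJump_succ]
    exact ((ih.jump.trans (jump_parallelization_sRed _)).trans
      (CRT_jump_sRed_CSRT hn).parallelization).trans (CSRT_sRed_CRT _ _).parallelization

theorem iterJump_WKL_sRed_CSRT {n : ℕ} (hn : 2 ≤ n) :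
    SRed (WKL.iterJump n) (CSRT n 2).parallelization := by
  obtain ⟨n, rfl⟩ := Nat.exists_eq_add_of_le' (show 1 ≤ n by omega)
  have hn' : 1 ≤ n := by omega
  rw [iterJump_succ]
  exact ((iterJump_WKL_sRed_CRT hn').jump.trans (jump_parallelization_sRed _)).trans
    (CRT_jump_sRed_CSRT hn').parallelization

/-! ### A uniform low basis theorem -/

/-- All words bounded by the word `bs`. -/
def boxWords (bs : List ℕ) : List (List ℕ) :=
  bs.foldr (fun b acc => (List.range (b + 1)).flatMap fun v => acc.map fun w => v :: w) [[]]

theorem mem_boxWords {bs w : List ℕ} : w ∈ boxWords bs ↔ List.Forall₂ (· ≤ ·) w bs := by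
  induction bs generalizing w with
  | nil => simp [boxWords]
  | cons b bs ih =>
    have : boxWords (b :: bs) =
      (List.range (b + 1)).flatMap fun v => (boxWords bs).map fun w => v :: w := rfl
    rw [this]
    simp only [List.mem_flatMap, List.mem_range, List.mem_map, ih]
    constructor
    · rintro ⟨v, hv, w, hw, rfl⟩
      exact List.Forall₂.cons (by omega) hw
    · rintro (_ | ⟨hv, hw⟩)
      exact ⟨_, by omega, _, hw, rfl⟩

/-- The bounds given by the odd part of a word. -/
def oddBounds (u : List ℕ) : List ℕ := (List.range (u.length / 2)).map fun m => u.getD (2 * m + 1) 0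

theorem oddBounds_initSeg (t : Baire) (τ : ℕ) :
    oddBounds (initSeg t τ) = initSeg (fun m => t (2 * m + 1)) (τ / 2) := by
  rw [oddBounds, length_initSeg]
  refine List.map_congr_left fun m hm => ?_
  rw [List.mem_range] at hm
  exact initSeg_getD t (by omega) 0

theorem mem_boxWords_oddBounds {t : Baire} {τ : ℕ} {w : List ℕ} :
    w ∈ boxWords (oddBounds (initSeg t τ)) ↔
      ∃ x : Baire, (∀ m, x m ≤ t (2 * m + 1)) ∧ w = initSeg x (τ / 2) := by
  rw [mem_boxWords, oddBounds_initSeg, List.forall₂_iff_get]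
  simp only [length_initSeg, List.get_eq_getElem, getElem_initSeg]
  constructor
  · rintro ⟨hlen, h⟩
    refine ⟨fun m => w.getD m 0, fun m => ?_, ?_⟩
    · change w.getD m 0 ≤ _
      by_cases hm : m < w.length
      · rw [List.getD_eq_getElem _ _ hm]
        exact h m hm (hlen ▸ hm)
      · rw [List.getD_eq_default _ _ (by omega)]
        exact Nat.zero_le _
    · refine List.ext_getElem (by simp [hlen]) fun i h1 h2 => ?_
      rw [getElem_initSeg, List.getD_eq_getElem _ _ h1]
  · rintro ⟨x, hx, rfl⟩
    exact ⟨by simp, fun i h1 h2 => by rw [getElem_initSeg]; exact hx i⟩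

/-! ### Guessing limits inside a compact closed set -/

section

variable (Q : List ℕ → List ℕ → Bool) (g : List ℕ → List ℕ)

/-- The word `w` refutes that the sequence `g` computes from its extensions has the value
`e.unpair.1` at `m` from stage `e.unpair.2` on. -/
def viol (m e : ℕ) (w : List ℕ) : Bool :=
  (List.range (g w).length).any fun i => decide (i.unpair.2 = m) &&
    (decide (e.unpair.2 ≤ i.unpair.1) && !decide ((g w).getD i 0 = e.unpair.1))

/-- The word `w` satisfies `Q` and refutes none of the guesses `es`. -/
def stageOk (u es w : List ℕ) : Bool :=
  ((List.range (w.length + 1)).all fun l => Q (u.take l) (w.take l)) &&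
    (List.range es.length).all fun m => !viol g m (es.getD m 0) w

/-- The guesses `es` are not refuted by the initial segment `u` of the instance. -/
def stageEx (u es : List ℕ) : Bool := (boxWords (oddBounds u)).any fun w => stageOk Q g u es w

/-- The next guess. -/
def nextGuess (u es : List ℕ) : ℕ :=
  ((List.range u.length).find? fun e => stageEx Q g u (es ++ [e])).getD 0

/-- The first `m` guesses. -/
def guesses (u : List ℕ) (m : ℕ) : List ℕ := Nat.rec [] (fun _ es => es ++ [nextGuess Q g u es]) m

variable {Q g}

theorem primrec_guesses (hQ : Primrec fun x : List ℕ × List ℕ => Q x.1 x.2) (hg : Primrec g) :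
    Primrec fun x : List ℕ × ℕ => guesses Q g x.1 x.2 := by
  have hviol : Primrec fun x : ℕ × ℕ × List ℕ => viol g x.1 x.2.1 x.2.2 := by
    unfold viol; fun_prop
  have hok : Primrec fun x : (List ℕ × List ℕ) × List ℕ => stageOk Q g x.1.1 x.1.2 x.2 := by
    have h1 : Primrec fun x : ((List ℕ × List ℕ) × List ℕ) × ℕ =>
        viol g x.2 (x.1.1.2.getD x.2 0) x.1.2 :=
      hviol.comp (by fun_prop : Primrec fun x : ((List ℕ × List ℕ) × List ℕ) × ℕ =>
        (x.2, x.1.1.2.getD x.2 0, x.1.2))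
    have h2 : Primrec fun x : ((List ℕ × List ℕ) × List ℕ) × ℕ =>
        Q (x.1.1.1.take x.2) (x.1.2.take x.2) :=
      hQ.comp (by fun_prop : Primrec fun x : ((List ℕ × List ℕ) × List ℕ) × ℕ =>
        (x.1.1.1.take x.2, x.1.2.take x.2))
    unfold stageOk
    fun_prop
  have hbox : Primrec boxWords := by unfold boxWords; fun_prop
  have hodd : Primrec oddBounds := by unfold oddBounds; fun_prop
  have hex : Primrec fun x : List ℕ × List ℕ => stageEx Q g x.1 x.2 := by
    unfold stageEx; fun_prop
  have hnext : Primrec fun x : List ℕ × List ℕ => nextGuess Q g x.1 x.2 := by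
    have : Primrec fun x : (List ℕ × List ℕ) × ℕ => stageEx Q g x.1.1 (x.1.2 ++ [x.2]) :=
      hex.comp (by fun_prop : Primrec fun x : (List ℕ × List ℕ) × ℕ => (x.1.1, x.1.2 ++ [x.2]))
    unfold nextGuess
    fun_prop
  have hstep : Primrec fun x : (List ℕ × ℕ) × ℕ × List ℕ =>
      x.2.2 ++ [nextGuess Q g x.1.1 x.2.2] := by
    have : Primrec fun x : (List ℕ × ℕ) × ℕ × List ℕ => nextGuess Q g x.1.1 x.2.2 :=
      hnext.comp (by fun_prop : Primrec fun x : (List ℕ × ℕ) × ℕ × List ℕ => (x.1.1, x.2.2))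
    fun_prop
  unfold guesses
  exact Prim.natRec (by fun_prop) (by fun_prop) hstep

theorem viol_iff {m e : ℕ} {w : List ℕ} : viol g m e w = true ↔
    ∃ i v : ℕ, (g w)[i]? = some v ∧ i.unpair.2 = m ∧ e.unpair.2 ≤ i.unpair.1 ∧ v ≠ e.unpair.1 := by
  simp only [viol, List.any_eq_true, List.mem_range, Bool.and_eq_true, decide_eq_true_eq,
    Bool.not_eq_true', decide_eq_false_iff_not]
  constructor
  · rintro ⟨i, hi, h1, h2, h3⟩
    rw [List.getD_eq_getElem _ _ hi] at h3
    exact ⟨i, _, List.getElem?_eq_getElem hi, h1, h2, h3⟩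
  · rintro ⟨i, v, hv, h1, h2, h3⟩
    refine ⟨i, (List.getElem?_eq_some_iff.mp hv).1, h1, h2, ?_⟩
    rwa [List.getD_eq_getElem?_getD, hv]

theorem viol_mono (hg : IsWordMap g) {m e : ℕ} {w w' : List ℕ} (h : w <+: w')
    (hv : viol g m e w = true) : viol g m e w' = true := by
  rw [viol_iff] at hv ⊢
  obtain ⟨i, v, h1, h2⟩ := hv
  exact ⟨i, v, getElem?_of_isPrefix (hg.2 _ _ h) h1, h2⟩

theorem stageOk_iff {t x : Baire} {τ : ℕ} {es : List ℕ} :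
    stageOk Q g (initSeg t τ) es (initSeg x (τ / 2)) = true ↔
      (∀ l ≤ τ / 2, Q (initSeg t l) (initSeg x l) = true) ∧
      ∀ m < es.length, ¬ viol g m (es.getD m 0) (initSeg x (τ / 2)) = true := by
  simp only [stageOk, Bool.and_eq_true, List.all_eq_true, List.mem_range, length_initSeg,
    Bool.not_eq_true', Bool.not_eq_true, Nat.lt_succ_iff]
  refine and_congr_left fun _ => forall_congr' fun l => imp_congr_right fun hl => ?_
  rw [initSeg_take_of_le t (by omega), initSeg_take_of_le x hl]

theorem isClosed_initSeg (P : List ℕ → Prop) (l : ℕ) : IsClosed {x : Baire | P (initSeg x l)} := by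
  have hc : Continuous fun (x : Baire) (i : Fin l) => x i := by fun_prop
  have : {x : Baire | P (initSeg x l)} =
      (fun (x : Baire) (i : Fin l) => x i) ⁻¹' {f | P (List.ofFn f)} := by
    ext x
    simp only [Set.mem_preimage, Set.mem_ofPred_eq]
    have : initSeg x l = List.ofFn fun i : Fin l => x i :=
      List.ext_getElem (by simp) fun i _ _ => by simp
    rw [this]
  rw [this]
  exact (isClosed_discrete _).preimage hc

theorem isCompact_box (b : Baire) : IsCompact {x : Baire | ∀ m, x m ≤ b m} := by
  have : {x : Baire | ∀ m, x m ≤ b m} = Set.pi Set.univ fun m => Set.Iic (b m) := by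
    ext x; simp [Pi.le_def]
  rw [this]
  exact isCompact_univ_pi fun m => (Set.finite_Iic (b m)).isCompact

variable (Q g) in
/-- The solutions that satisfy the guesses `es`. -/
def guessSol (t : Baire) (es : List ℕ) : Set Baire :=
  {x | x ∈ clSol Q t ∧ ∀ m < es.length, ∀ l, ¬ viol g m (es.getD m 0) (initSeg x l) = true}

theorem stageEx_of_mem {t x : Baire} {es : List ℕ} (h : x ∈ guessSol Q g t es) (τ : ℕ) :
    stageEx Q g (initSeg t τ) es = true := by
  rw [stageEx, List.any_eq_true]
  exact ⟨_, mem_boxWords_oddBounds.mpr ⟨x, h.1.1, rfl⟩,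
    stageOk_iff.mpr ⟨fun l _ => h.1.2 l, fun m hm => h.2 m hm _⟩⟩

/-- The points of the box that look like solutions at stage `τ`. -/
def stageSet (Q : List ℕ → List ℕ → Bool) (g : List ℕ → List ℕ) (t : Baire) (es : List ℕ)
    (τ : ℕ) : Set Baire :=
  {x | (∀ m, x m ≤ t (2 * m + 1)) ∧
    stageOk Q g (initSeg t τ) es (initSeg x (τ / 2)) = true}

theorem isCompact_stageSet (t : Baire) (es : List ℕ) (τ : ℕ) :
    IsCompact (stageSet Q g t es τ) :=
  (isCompact_box fun m => t (2 * m + 1)).inter_right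
    (isClosed_initSeg (fun w => stageOk Q g (initSeg t τ) es w = true) (τ / 2))

theorem stageSet_antitone (hg : IsWordMap g) (t : Baire) (es : List ℕ) :
    Antitone (stageSet Q g t es) := by
  intro τ τ' hτ x ⟨h1, h2⟩
  refine ⟨h1, ?_⟩
  rw [stageOk_iff] at h2 ⊢
  have hle : τ / 2 ≤ τ' / 2 := Nat.div_le_div_right hτ
  exact ⟨fun l hl => h2.1 l (hl.trans hle), fun m hm hv =>
    h2.2 m hm (viol_mono hg (initSeg_isPrefix x hle) hv)⟩

theorem iInter_stageSet (hg : IsWordMap g) (t : Baire) (es : List ℕ) :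
    ⋂ τ, stageSet Q g t es τ = guessSol Q g t es := by
  ext x
  simp only [Set.mem_iInter]
  constructor
  · intro h
    refine ⟨⟨(h 0).1, fun l => ?_⟩, fun m hm l hv => ?_⟩
    · exact (stageOk_iff.mp (h (2 * l)).2).1 l (by omega)
    · exact (stageOk_iff.mp (h (2 * l)).2).2 m hm (viol_mono hg (initSeg_isPrefix x (by omega)) hv)
  · exact fun h τ => ⟨h.1.1, stageOk_iff.mpr ⟨fun l _ => h.1.2 l, fun m hm => h.2 m hm _⟩⟩

theorem isCompact_guessSol (hg : IsWordMap g) (t : Baire) (es : List ℕ) :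
    IsCompact (guessSol Q g t es) := by
  rw [← iInter_stageSet hg]
  exact (isCompact_stageSet t es 0).of_isClosed_subset
    (isClosed_iInter fun τ => (isCompact_stageSet t es τ).isClosed) (Set.iInter_subset _ 0)

/-- The stage sets are compact and decreasing with intersection `guessSol`; if that is empty, some
stage set is already empty, so false guesses are refuted at a finite stage. -/
theorem eventually_not_stageEx (hg : IsWordMap g) {t : Baire} {es : List ℕ}
    (h : ¬ (guessSol Q g t es).Nonempty) :
    ∀ᶠ τ in atTop, ¬ stageEx Q g (initSeg t τ) es = true := by
  have hne : ∃ τ, ¬ (stageSet Q g t es τ).Nonempty := by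
    by_contra hall
    push Not at hall
    refine h ?_
    rw [← iInter_stageSet hg]
    exact IsCompact.nonempty_iInter_of_sequence_nonempty_isCompact_isClosed _
      (fun τ => stageSet_antitone hg t es τ.le_succ) hall (isCompact_stageSet t es 0)
      fun τ => (isCompact_stageSet t es τ).isClosed
  obtain ⟨τ, hτ⟩ := hne
  filter_upwards [eventually_ge_atTop τ] with τ' hτ' hex
  rw [stageEx, List.any_eq_true] at hex
  obtain ⟨w, hw, hok⟩ := hex
  obtain ⟨x, hx, rfl⟩ := mem_boxWords_oddBounds.mp hw
  exact hτ ⟨x, stageSet_antitone hg t es hτ' ⟨hx, hok⟩⟩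

/-- The least consistent guess is found in the limit: each smaller guess is refuted eventually,
whereas this one never is. -/
theorem exists_nextGuess (hg : IsWordMap g) {t : Baire}
    (hlim : ∀ x ∈ clSol Q t, ∃ v u, Maps g x v ∧ IsLim v u) {es : List ℕ}
    (hes : (guessSol Q g t es).Nonempty) :
    ∃ e, (guessSol Q g t (es ++ [e])).Nonempty ∧
      ∀ᶠ τ in atTop, nextGuess Q g (initSeg t τ) es = e := by
  have hex : ∃ e, (guessSol Q g t (es ++ [e])).Nonempty := by
    obtain ⟨x, hx, hes⟩ := hes
    obtain ⟨v, u, hv, hu⟩ := hlim x hx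
    obtain ⟨s, hs⟩ := eventually_atTop.mp (isLim_iff.mp hu es.length)
    -- Consistency is witnessed by the actual limit at the next position together with a stage from
    -- which it is attained.
    refine ⟨Nat.pair (u es.length) s, x, hx, fun m hm l hviol => ?_⟩
    by_cases hm' : m < es.length
    · rw [List.getD_append _ _ _ _ hm'] at hviol
      exact hes m hm' l hviol
    · have hm'' : m = es.length := by
        rw [List.length_append, List.length_singleton] at hm; omega
      subst hm''
      rw [List.getD_append_right _ _ _ _ le_rfl, Nat.sub_self, List.getD_cons_zero,
        viol_iff] at hviol
      obtain ⟨i, a, h1, h2, h3, h4⟩ := hviol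
      rw [Nat.unpair_pair] at h3 h4
      have := hs i.unpair.1 h3
      rw [← h2, Nat.pair_unpair, ← hv.sound hg h1, h2] at this
      exact h4 this
  classical
  refine ⟨Nat.find hex, Nat.find_spec hex, ?_⟩
  have hev : ∀ᶠ τ in atTop, ∀ e ∈ Finset.range (Nat.find hex),
      ¬ stageEx Q g (initSeg t τ) (es ++ [e]) = true := by
    rw [eventually_all_finset]
    exact fun e he => eventually_not_stageEx hg (Nat.find_min hex (Finset.mem_range.mp he))
  filter_upwards [hev, eventually_gt_atTop (Nat.find hex)] with τ h1 h2
  obtain ⟨x, hx⟩ := Nat.find_spec hex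
  have : (List.range (initSeg t τ).length).find?
      (fun e => stageEx Q g (initSeg t τ) (es ++ [e])) = some (Nat.find hex) := by
    rw [List.find?_range_eq_some]
    refine ⟨stageEx_of_mem hx τ, by simpa using h2, fun e he => ?_⟩
    rw [Bool.not_eq_true']
    exact Bool.eq_false_iff.mpr (h1 e (Finset.mem_range.mpr he))
  rw [nextGuess, this]
  rfl

/-- The limit of a sequence computed from a suitable point of a closed set can be computed as a
limit from the closed set. -/
theorem exists_wordMap_lowBasis (hQ : Primrec fun x : List ℕ × List ℕ => Q x.1 x.2)
    (hg : IsWordMap g) : ∃ R, IsWordMap R ∧ ∀ t, (clSol Q t).Nonempty →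
      (∀ x ∈ clSol Q t, ∃ v u, Maps g x v ∧ IsLim v u) →
      ∃ s r, Maps R t s ∧ IsLim s r ∧ ∃ x ∈ clSol Q t, ∃ v, Maps g x v ∧ IsLim v r := by
  have hpg := primrec_guesses hQ hg.1
  obtain ⟨R, hR, HR⟩ := exists_wordMap_of_bound (fun n => n.unpair.1)
    (fun u n => ((guesses Q g u (n.unpair.2 + 1)).getD n.unpair.2 0).unpair.1) (by fun_prop) (by
      have : Primrec fun x : List ℕ × ℕ => guesses Q g x.1 (x.2.unpair.2 + 1) :=
        hpg.comp (by fun_prop : Primrec fun x : List ℕ × ℕ => (x.1, x.2.unpair.2 + 1))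
      fun_prop)
  refine ⟨R, hR, fun t hne hlim => ?_⟩
  choose! nxt hnxt1 hnxt2 using fun es => exists_nextGuess (es := es) hg hlim
  let E : ℕ → List ℕ := fun m => Nat.rec [] (fun _ es => es ++ [nxt es]) m
  let e : Baire := fun m => nxt (E m)
  have hE : ∀ m, E m = initSeg e m := by
    intro m
    induction m with
    | zero => rfl
    | succ m ih => rw [initSeg_succ, ← ih]
  have hEne : ∀ m, (guessSol Q g t (E m)).Nonempty := by
    intro m
    induction m with
    | zero =>
      obtain ⟨x, hx⟩ := hne
      exact ⟨x, hx, fun m hm => absurd hm (by simp [E])⟩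
    | succ m ih => exact hnxt1 _ ih
  have hEev : ∀ m, ∀ᶠ τ in atTop, guesses Q g (initSeg t τ) m = E m := by
    intro m
    induction m with
    | zero => exact Eventually.of_forall fun _ => rfl
    | succ m ih =>
      filter_upwards [ih, hnxt2 _ (hEne m)] with τ h1 h2
      have : guesses Q g (initSeg t τ) (m + 1) = guesses Q g (initSeg t τ) m ++
        [nextGuess Q g (initSeg t τ) (guesses Q g (initSeg t τ) m)] := rfl
      rw [this, h1, h2]
  clear_value e E
  have hanti : ∀ m, guessSol Q g t (E (m + 1)) ⊆ guessSol Q g t (E m) := by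
    rintro m x ⟨hx, h⟩
    refine ⟨hx, fun m' hm' l => ?_⟩
    rw [hE, length_initSeg] at hm'
    have := h m' (by rw [hE, length_initSeg]; omega) l
    rwa [hE, initSeg_getD e (by omega)] at this ⊢
  -- By compactness one solution obeys all the guesses at once, and these then determine its limit.
  obtain ⟨x, hx⟩ := IsCompact.nonempty_iInter_of_sequence_nonempty_isCompact_isClosed
    (fun m => guessSol Q g t (E m)) hanti hEne (isCompact_guessSol hg t _)
    fun m => (isCompact_guessSol hg t _).isClosed
  rw [Set.mem_iInter] at hx
  have hxs : x ∈ clSol Q t := (hx 0).1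
  obtain ⟨v, u, hv, hu⟩ := hlim x hxs
  refine ⟨_, fun m => (e m).unpair.1, HR t, isLim_iff.mpr fun m => ?_, x, hxs, v, hv,
    isLim_iff.mpr fun m => ?_⟩
  · filter_upwards [hEev (m + 1)] with τ hτ
    simp only [Nat.unpair_pair]
    rw [hτ, hE, initSeg_getD e (by omega)]
  -- A deviation from the guess past the guessed stage would be visible on a finite prefix of `x`.
  · filter_upwards [eventually_ge_atTop (e m).unpair.2] with i hi
    by_contra hne'
    obtain ⟨l, hl⟩ := hv (Nat.pair i m)
    refine (hx (m + 1)).2 m (by rw [hE, length_initSeg]; omega) l ?_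
    rw [hE, initSeg_getD e (by omega), viol_iff]
    exact ⟨_, _, hl, by simp, by simpa using hi, hne'⟩

end

/-- A closed set that is computed as a limit, followed by an instance of the jump of `f`, can be
absorbed in the double jump of `f`. -/
theorem Problem.wRed_jump_jump_of_lowBasis {A f : Problem} {Q : List ℕ → List ℕ → Bool}
    (hQ : Primrec fun x : List ℕ × List ℕ => Q x.1 x.2) {k g h : List ℕ → List ℕ}
    (hk : IsWordMap k) (hg : IsWordMap g) (hh : IsWordMap h)
    (H : ∀ p a, A.X.Names p a → a ∈ A.dom → ∃ q t, Maps k p q ∧ IsLim q t ∧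
      (clSol Q t).Nonempty ∧ ∀ x ∈ clSol Q t, ∃ v y, Maps g x v ∧ f.jump.X.Names v y ∧
        y ∈ f.dom ∧ ∀ r z, f.Y.Names r z → z ∈ f.sol y →
          ∃ s b, Maps h (pairB p r) s ∧ A.Y.Names s b ∧ b ∈ A.sol a) :
    WRed A f.jump.jump := by
  obtain ⟨R, hR, HR⟩ := exists_wordMap_lowBasis hQ hg
  obtain ⟨R', hR', HR'⟩ := exists_wordMap_lim hR
  refine ⟨_, h, hR'.comp hk, hh, fun p a hp ha => ?_⟩
  obtain ⟨q, t, hq, hqt, hne, H⟩ := H p a hp ha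
  obtain ⟨s, r, hs, hsr, x, hx, v, hv, hvr⟩ := HR t hne fun x hx => by
    obtain ⟨v, y, hv, ⟨u, hu, -⟩, -⟩ := H x hx
    exact ⟨v, u, hv, hu⟩
  obtain ⟨v', y, hv', ⟨u, hu, huy⟩, hy, H⟩ := H x hx
  -- Both facts concern the same computed sequence, so the limit found by the low basis theorem
  -- names the intended instance.
  obtain rfl := hv.unique hg hv'
  obtain rfl := tendsto_nhds_unique hvr hu
  obtain ⟨s', hs', hs's⟩ := HR' q t s hqt hs
  exact ⟨s', y, hs'.comp hR' hk hq, ⟨s, hs's, r, hsr, huy⟩, hy, H⟩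

/-! ### Ramsey's theorem from weak Kőnig's lemma -/

/-- All prefixes of `w` belong to the tree with (complementary) characteristic function `u`. -/
def inTree (u w : List ℕ) : Bool :=
  (List.range (w.length + 1)).all fun l => decide (u.getD (2 * Encodable.encode (w.take l)) 0 = 0)

theorem primrec_inTree : Primrec fun x : List ℕ × List ℕ => inTree x.1 x.2 := by
  unfold inTree; fun_prop

/-- The value 0 marks membership, so nodes not yet read, which default to 0, are provisionally
accepted. -/
theorem mem_clSol_inTree {t x : Baire} : x ∈ clSol inTree t ↔
    (∀ m, x m ≤ t (2 * m + 1)) ∧ ∀ l, t (2 * Encodable.encode (initSeg x l)) = 0 := by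
  refine and_congr_right fun _ => ?_
  simp only [inTree, List.all_eq_true, List.mem_range, length_initSeg, decide_eq_true_eq,
    Nat.lt_succ_iff]
  constructor
  · intro h l
    set e := 2 * Encodable.encode (initSeg x l) with he
    have := h (l + e + 1) l (by omega)
    rwa [initSeg_take_of_le x (by omega), ← he, initSeg_getD t (by omega)] at this
  · intro h L l hl
    rw [initSeg_take_of_le x hl, List.getD_eq_getElem?_getD, initSeg_getElem?]
    split_ifs
    · exact h l
    · rfl

theorem foldr_max_initSeg_le {p : Baire} {K : ℕ} (h : ∀ m, p m ≤ K) (s : ℕ) :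
    (initSeg p s).foldr max 0 ≤ K := by
  have : ∀ u : List ℕ, (∀ a ∈ u, a ≤ K) → u.foldr max 0 ≤ K := by
    intro u
    induction u with
    | nil => simp
    | cons a u ih => intro h; simp_all
  refine this _ fun a ha => ?_
  obtain ⟨m, -, rfl⟩ := List.mem_map.mp ha
  exact h m

theorem le_foldr_max {u : List ℕ} {a : ℕ} (h : a ∈ u) : a ≤ u.foldr max 0 := by
  induction u with
  | nil => simp at h
  | cons b u ih =>
    rcases List.mem_cons.mp h with rfl | h
    · simp
    · simp [ih h]

/-- A bounded tree with an enumerable set of nodes can be computed as a limit. -/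
theorem exists_wordMap_limTree {θ : List ℕ → List ℕ → Bool}
    (hθ : Primrec fun x : List ℕ × List ℕ => θ x.1 x.2) :
    ∃ k, IsWordMap k ∧ ∀ (p : Baire) (K : ℕ), IsGreatest (Set.range p) K →
      (∀ w s s', s ≤ s' → θ (initSeg p s) w = true → θ (initSeg p s') w = true) →
      ∃ q t, Maps k p q ∧ IsLim q t ∧ ∀ x, x ∈ clSol inTree t ↔
        (∀ m, x m ≤ K) ∧ ∀ l, ∃ s, θ (initSeg p s) (initSeg x l) = true := by
  have hθ' : Primrec fun x : (List ℕ × ℕ) × List ℕ => θ x.1.1 x.2 :=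
    hθ.comp (by fun_prop : Primrec fun x : (List ℕ × ℕ) × List ℕ => (x.1.1, x.2))
  obtain ⟨k, hk, Hk⟩ := exists_wordMap_of_bound (fun n => n.unpair.1) (fun u n =>
    if n.unpair.2 % 2 = 0 then ((Encodable.decode (α := List ℕ) (n.unpair.2 / 2)).map fun w =>
      (!θ u w).toNat).getD 0 else u.foldr max 0) (by fun_prop) (by fun_prop)
  refine ⟨k, hk, fun p K hK hmono => ?_⟩
  classical
  let t : Baire := fun j => if j % 2 = 0 then
    ((Encodable.decode (α := List ℕ) (j / 2)).map fun w =>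
      if ∃ s, θ (initSeg p s) w = true then 0 else 1).getD 0 else K
  refine ⟨_, t, Hk p, isLim_iff.mpr fun j => ?_, fun x => ?_⟩
  · simp only [Nat.unpair_pair, t]
    by_cases hj : j % 2 = 0
    · simp only [hj, if_true]
      rcases Encodable.decode (α := List ℕ) (j / 2) with _ | w
      · exact Eventually.of_forall fun _ => rfl
      · simp only [Option.map_some, Option.getD_some]
        split_ifs with h
        · obtain ⟨s, hs⟩ := h
          filter_upwards [eventually_ge_atTop s] with s' hs'
          rw [hmono w s s' hs' hs]; rfl
        · refine Eventually.of_forall fun s => ?_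
          rw [Bool.eq_false_iff.mpr fun hs => h ⟨s, hs⟩]; rfl
    · simp only [hj, if_false]
      obtain ⟨⟨m, hm⟩, hub⟩ := hK
      -- The running maximum is final once a position where `K` is attained has been read; a mere
      -- upper bound would not suffice.
      filter_upwards [eventually_gt_atTop m] with s hs
      refine le_antisymm (foldr_max_initSeg_le (fun m => hub ⟨m, rfl⟩) s) ?_
      exact le_foldr_max (List.mem_map.mpr ⟨m, List.mem_range.mpr hs, hm⟩)
  · rw [mem_clSol_inTree]
    refine and_congr ?_ (forall_congr' fun l => ?_)
    · refine forall_congr' fun m => ?_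
      have : ¬ (2 * m + 1) % 2 = 0 := by omega
      simp only [t, this, if_false]
    · simp only [t, Nat.mul_mod_right, if_true, Nat.mul_div_cancel_left _ (zero_lt_two' ℕ),
        Encodable.encodek, Option.map_some, Option.getD_some]
      split_ifs with h <;> simp [h]

theorem exists_isGreatest_range {p : Baire} (h : ∃ K, ∀ m, p m ≤ K) :
    ∃ K, IsGreatest (Set.range p) K := by
  obtain ⟨K, hK⟩ := h
  have : (Set.range p).Finite := (Set.finite_Iic K).subset (by rintro _ ⟨m, rfl⟩; exact hK m)
  obtain ⟨a, ha⟩ := this.exists_maximal (Set.range_nonempty p)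
  exact ⟨a, ha.1, fun b hb => (le_total a b).elim (fun h => ha.2 hb h) id⟩

/-- A word survives if its first letter occurs in the coloring at a position no smaller than its
length. Hence the first letter of a path is a color occurring infinitely often, and the homogeneous
set is all of its occurrences. Reading these off needs the coloring itself, which the cylinder
property supplies. -/
theorem CRT_one_sRed : SRed (CRT 1 ⊤) (WKL.iterJump 1) := by
  obtain ⟨k, hk, Hk⟩ := exists_wordMap_limTree (θ := fun u w => decide (w.length = 0) ||
    (List.range u.length).any fun i => decide (w.length ≤ i) &&
      decide (u.getD i 0 = w.getD 0 0)) (by fun_prop)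
  obtain ⟨h, hh, Hh⟩ := exists_wordMap_of_bound (fun n => n + 2) (fun u n =>
    if n % 2 = 0 then u.getD 1 0 else (decide (u.getD (2 * (n / 2)) 0 = u.getD 1 0)).toNat)
    (by fun_prop) (by fun_prop)
  have H : WRed (CRT 1 ⊤) (CL inTree).jump := by
    refine ⟨k, h, hk, hh, fun p c hp _ => ?_⟩
    obtain ⟨K, hK⟩ := exists_isGreatest_range (bounded_of_names hp)
    obtain ⟨q, t, hq, hl, hsol⟩ := Hk p K hK (by
      intro w s s' hs h
      simp only [Bool.or_eq_true, decide_eq_true_eq, List.any_eq_true, List.mem_range,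
        length_initSeg, Bool.and_eq_true] at h ⊢
      refine h.imp_right ?_
      rintro ⟨i, hi, h1, h2⟩
      rw [initSeg_getD p hi] at h2
      exact ⟨i, by omega, h1, by rw [initSeg_getD p (by omega), h2]⟩)
    have hsol' : ∀ x, x ∈ clSol inTree t ↔
        (∀ m, x m ≤ K) ∧ ∀ l, ∃ i, l ≤ i ∧ p i = x 0 := by
      intro x
      rw [hsol]
      refine and_congr_right fun _ => ⟨fun h l => ?_, fun h l => ?_⟩
      · obtain ⟨s, hs⟩ := h (l + 1)
        simp only [Bool.or_eq_true, decide_eq_true_eq, List.any_eq_true, List.mem_range,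
          length_initSeg, Bool.and_eq_true] at hs
        rcases hs with hs | ⟨i, hi, h1, h2⟩
        · omega
        · rw [initSeg_getD p hi, initSeg_getD x (by omega)] at h2
          exact ⟨i, by omega, h2⟩
      · obtain ⟨i, h1, h2⟩ := h l
        refine ⟨i + 1, ?_⟩
        simp only [Bool.or_eq_true, decide_eq_true_eq, List.any_eq_true, List.mem_range,
          length_initSeg, Bool.and_eq_true]
        rcases Nat.eq_zero_or_pos l with hl | hl
        · exact Or.inl hl
        · refine Or.inr ⟨i, by omega, h1, ?_⟩
          rw [initSeg_getD p (by omega), initSeg_getD x hl, h2]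
    refine ⟨q, t, hq, ⟨t, hl, rfl⟩, ?_, ?_⟩
    · obtain ⟨M, j, hM⟩ := exists_homName le_rfl (bounded_of_names hp)
      have hMj : ∀ i, M i = true → p i = j := fun i hi => hM.2 i (by simpa [thetaList] using hi)
      refine ⟨fun _ => j, (hsol' _).mpr ⟨fun _ => ?_, fun l => ?_⟩⟩
      · obtain ⟨i, hi⟩ := hM.1.nonempty
        exact hMj i hi ▸ hK.2 ⟨i, rfl⟩
      · obtain ⟨i, hi, hl⟩ := hM.1.exists_gt l
        exact ⟨i, hl.le, hMj i hi⟩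
    · rintro r x rfl hx
      obtain ⟨-, hx⟩ := (hsol' _).mp hx
      refine ⟨_, (⟨r 0, ENat.natCast_lt_top _⟩, fun m => decide (p m = r 0)), Hh _,
        ⟨fun _ => r 0, fun m => (decide (p m = r 0)).toNat, ?_, rfl, fun _ => rfl⟩,
        (homogeneousWithColor_iff (c := c) hp).mpr ⟨?_, fun m hm => ?_⟩⟩
      · funext n
        have h1 : pairB p r 1 = r 0 := pairB_right p r 0
        rw [initSeg_getD _ (by omega), initSeg_getD _ (by omega), h1, pairB_left]
        rfl
      · simp only [decide_eq_true_eq]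
        refine Set.infinite_of_not_bddAbove fun ⟨B, hB⟩ => ?_
        obtain ⟨i, h1, h2⟩ := hx (B + 1)
        have := hB h2
        omega
      · simpa [thetaList] using hm
  exact (H.sRed_prodId.trans (cl_sRed_WKL primrec_inTree).jump.prodId).trans
    (iterJump_WKL_prodId_sRed 1)

/-! ### The Erdős–Rado step -/

/-- Decision procedure for `ErOk`. -/
def erOkWord (n : ℕ) (u w L : List ℕ) (b : ℕ) : Bool :=
  (L.all fun a => decide (a < b)) && (List.range (idxBound n L.length)).all fun m =>
    !((thetaList n m).all fun i => decide (i < L.length)) ||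
      decide (u.getD (thetaIdx (n + 1) ((thetaList n m).map (fun i => L.getD i 0) ++ [b])) 0 =
        w.getD m 0)

/-- The next element of the greedy chain `L`, as far as `u` can tell. -/
def erNext (n : ℕ) (u w L : List ℕ) : Option ℕ :=
  (List.range u.length).find? fun b =>
    decide (idxBound (n + 1) (b + 1) ≤ u.length) && erOkWord n u w L b

/-- The greedy chain of length `j`, as far as `u` can tell. -/
def erWord (n : ℕ) (u w : List ℕ) (j : ℕ) : Option (List ℕ) :=
  Nat.rec (some []) (fun _ o => o.bind fun L => (erNext n u w L).map fun b => L ++ [b]) j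

theorem primrec_erOkWord (n : ℕ) : Primrec fun x : (List ℕ × List ℕ × List ℕ) × ℕ =>
    erOkWord n x.1.1 x.1.2.1 x.1.2.2 x.2 := by
  have h1 := primrec_thetaList n
  have h2 := primrec_thetaIdx (n + 1)
  have h3 := primrec_idxBound n
  have h5 : Primrec fun x : (((List ℕ × List ℕ × List ℕ) × ℕ) × ℕ) =>
      decide (x.1.1.1.getD (thetaIdx (n + 1) ((thetaList n x.2).map
        (fun i => x.1.1.2.2.getD i 0) ++ [x.1.2])) 0 = x.1.1.2.1.getD x.2 0) := by fun_prop
  have h6 : Primrec fun x : (((List ℕ × List ℕ × List ℕ) × ℕ) × ℕ) =>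
      (thetaList n x.2).all fun i => decide (i < x.1.1.2.2.length) := by fun_prop
  exact Prim.and' (by fun_prop) (Prim.all (by fun_prop) (Prim.or' (Prim.not' h6) h5))

theorem primrec_erNext (n : ℕ) :
    Primrec fun x : List ℕ × List ℕ × List ℕ => erNext n x.1 x.2.1 x.2.2 := by
  have h := primrec_idxBound (n + 1)
  exact Prim.find? (by fun_prop) (Prim.and' (by fun_prop) (primrec_erOkWord n))

theorem primrec_erWord (n : ℕ) :
    Primrec fun x : List ℕ × List ℕ × ℕ => erWord n x.1 x.2.1 x.2.2 := by
  have hstep : Primrec fun x : (List ℕ × List ℕ × ℕ) × ℕ × Option (List ℕ) =>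
      x.2.2.bind fun L => (erNext n x.1.1 x.1.2.1 L).map fun b => L ++ [b] := by
    have : Primrec fun y : ((List ℕ × List ℕ × ℕ) × ℕ × Option (List ℕ)) × List ℕ =>
        erNext n y.1.1.1 y.1.1.2.1 y.2 :=
      (primrec_erNext n).comp (by fun_prop : Primrec fun y : ((List ℕ × List ℕ × ℕ) × ℕ ×
        Option (List ℕ)) × List ℕ => (y.1.1.1, y.1.1.2.1, y.2))
    fun_prop
  exact Prim.natRec (by fun_prop) (by fun_prop) hstep

theorem erOkWord_iff {n s : ℕ} {p : Baire} {w L : List ℕ} {b : ℕ}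
    (hb : idxBound (n + 1) (b + 1) ≤ s) : erOkWord n (initSeg p s) w L b = true ↔
      ErOk n p (fun m => w.getD m 0) L b := by
  simp only [erOkWord, ErOk, Bool.and_eq_true, List.all_eq_true, decide_eq_true_eq,
    List.mem_range, Bool.or_eq_true, Bool.not_eq_true', ← Bool.not_eq_true]
  refine and_congr_right fun hL => forall_congr' fun m => imp_congr_right fun _ => ?_
  rw [← imp_iff_not_or]
  refine imp_congr_right fun hm => ?_
  rw [initSeg_getD]
  refine (thetaIdx_lt_idxBound (n + 1) (b + 1) _ (fun x hx => ?_) (by simp)).trans_le hb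
  rcases List.mem_append.mp hx with hx | hx
  · obtain ⟨i, hi, rfl⟩ := List.mem_map.mp hx
    have hi' := hm i hi
    have := hL _ (List.getElem_mem hi')
    rw [List.getD_eq_getElem _ _ hi']
    omega
  · rw [List.mem_singleton.mp hx]; omega

/-- The search accepts a candidate only if `u` is long enough to decide it. Then all smaller
candidates are decided too, so the accepted one is truly least. -/
theorem erNext_iff {n s : ℕ} {p : Baire} {w L : List ℕ} {b : ℕ} :
    erNext n (initSeg p s) w L = some b ↔ idxBound (n + 1) (b + 1) ≤ s ∧
      ErOk n p (fun m => w.getD m 0) L b ∧ ∀ b' < b, ¬ ErOk n p (fun m => w.getD m 0) L b' := by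
  rw [erNext, List.find?_range_eq_some]
  simp only [length_initSeg, Bool.and_eq_true, decide_eq_true_eq, List.mem_range,
    Bool.not_eq_true', ← Bool.not_eq_true]
  have hmono : ∀ b' < b, idxBound (n + 1) (b + 1) ≤ s → idxBound (n + 1) (b' + 1) ≤ s :=
    fun b' hb' h => (idxBound_mono (n + 1) (by omega)).trans h
  constructor
  · rintro ⟨⟨h1, h2⟩, -, h3⟩
    exact ⟨h1, (erOkWord_iff h1).mp h2, fun b' hb' h =>
      h3 b' hb' ⟨hmono b' hb' h1, (erOkWord_iff (hmono b' hb' h1)).mpr h⟩⟩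
  · rintro ⟨h1, h2, h3⟩
    refine ⟨⟨h1, (erOkWord_iff h1).mpr h2⟩, ?_, fun b' hb' h =>
      h3 b' hb' ((erOkWord_iff h.1).mp h.2)⟩
    exact (le_idxBound (n + 1) (b + 1) (by omega)).trans h1

theorem erWord_iff {n s : ℕ} {p : Baire} {w : List ℕ} {j : ℕ} {L : List ℕ} :
    erWord n (initSeg p s) w j = some L ↔ ErChain n p (fun m => w.getD m 0) j L ∧
      ∀ b ∈ L, idxBound (n + 1) (b + 1) ≤ s := by
  induction j generalizing L with
  | zero =>
    change some [] = some L ↔ L = [] ∧ _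
    rw [Option.some_inj, eq_comm]
    exact ⟨fun h => ⟨h, by simp [h]⟩, fun h => h.1⟩
  | succ j ih =>
    change ((erWord n (initSeg p s) w j).bind fun L =>
      (erNext n (initSeg p s) w L).map fun b => L ++ [b]) = some L ↔ _
    rw [Option.bind_eq_some_iff]
    simp only [Option.map_eq_some_iff, ih, erNext_iff]
    constructor
    · rintro ⟨L', ⟨h1, h2⟩, b, ⟨h3, h4, h5⟩, rfl⟩
      refine ⟨⟨L', b, rfl, h1, h4, h5⟩, fun a ha => ?_⟩
      rcases List.mem_append.mp ha with ha | ha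
      · exact h2 a ha
      · rw [List.mem_singleton.mp ha]; exact h3
    · rintro ⟨⟨L', b, rfl, h1, h4, h5⟩, h⟩
      exact ⟨L', ⟨h1, fun a ha => h a (by simp [ha])⟩, b, ⟨h b (by simp), h4, h5⟩, rfl⟩

/-- A chain of length `j` consults its prescription only below `idxBound n j`; hence a finite prefix
of the prescription determines it. -/
theorem ErChain.congr {n : ℕ} {p d d' : Baire} : ∀ {j L}, (∀ m < idxBound n j, d m = d' m) →
    ErChain n p d j L → ErChain n p d' j L
  | 0, _, _, h => h
  | j + 1, _, hd, ⟨L, b, e, h, hb, hl⟩ => by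
    have hd' : ∀ m < idxBound n j, d m = d' m := fun m hm =>
      hd m (hm.trans_le (idxBound_mono n j.le_succ))
    have hok : ∀ b, ErOk n p d L b ↔ ErOk n p d' L b := fun b =>
      and_congr_right fun _ => forall_congr' fun m => forall_congr' fun hm => by
        rw [hd' m (h.length ▸ hm)]
    exact ⟨L, b, e, h.congr hd', (hok b).mp hb, fun b' hb' h' => hl b' hb' ((hok b').mpr h')⟩

theorem erChain_initSeg_iff {n l j : ℕ} {p x : Baire} {L : List ℕ} (h : idxBound n j ≤ l) :
    ErChain n p (fun m => (initSeg x l).getD m 0) j L ↔ ErChain n p x j L :=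
  ⟨ErChain.congr fun _ hm => initSeg_getD x (hm.trans_le h) 0,
    ErChain.congr fun _ hm => (initSeg_getD x (hm.trans_le h) 0).symm⟩

/-- The test for the Erdős–Rado tree: greedy chains exist as far as `w` prescribes them. -/
def erTest (n : ℕ) (u w : List ℕ) : Bool :=
  (List.range (w.length + 1)).all fun j =>
    !decide (idxBound n j ≤ w.length) || (erWord n u w j).isSome

theorem erTest_iff {n : ℕ} (hn : 1 ≤ n) {s : ℕ} {p : Baire} {w : List ℕ} :
    erTest n (initSeg p s) w = true ↔
      ∀ j, idxBound n j ≤ w.length → ∃ L, ErChain n p (fun m => w.getD m 0) j L ∧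
        ∀ b ∈ L, idxBound (n + 1) (b + 1) ≤ s := by
  simp only [erTest, List.all_eq_true, List.mem_range, Bool.or_eq_true, Bool.not_eq_true',
    ← Bool.not_eq_true, decide_eq_true_eq, ← imp_iff_not_or, Option.isSome_iff_exists, erWord_iff]
  refine ⟨fun h j hj => h j ?_ hj, fun h j _ hj => h j hj⟩
  have := le_idxBound n j hn
  omega

/-- Each node is accepted at a stage depending on the size of the chain elements, so the tree is
only enumerable. Its paths are the prescriptions whose greedy chains never stop. -/
theorem exists_erTest_iff {n : ℕ} (hn : 1 ≤ n) {p x : Baire} :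
    (∀ l, ∃ s, erTest n (initSeg p s) (initSeg x l) = true) ↔ ∀ j, ∃ L, ErChain n p x j L := by
  simp only [erTest_iff hn, length_initSeg]
  constructor
  · intro h j
    obtain ⟨s, hs⟩ := h (idxBound n j)
    obtain ⟨L, hL, -⟩ := hs j le_rfl
    exact ⟨L, (erChain_initSeg_iff le_rfl).mp hL⟩
  · intro h l
    obtain ⟨P, hP, hc, -⟩ := exists_of_erChain h
    refine ⟨idxBound (n + 1) (P l + 1), fun j hj =>
      ⟨initSeg P j, (erChain_initSeg_iff hj).mpr (hc j), fun b hb => ?_⟩⟩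
    obtain ⟨i, hi, rfl⟩ := List.mem_map.mp hb
    have h1 := List.mem_range.mp hi
    have h2 := le_idxBound n j hn
    have h3 := hP (show i < l by omega)
    exact idxBound_mono (n + 1) (by omega)

/-- The image of a homogeneous set under the greedy sequence is computable. -/
theorem exists_wordMap_erImage {n : ℕ} (hn : 1 ≤ n) : ∃ h, IsWordMap h ∧
    ∀ (p x a b P : Baire) (M M' : ℕ → Bool), StrictMono P →
      (∀ j, ErChain n p x j (initSeg P j)) → (∀ i, b i = (M i).toNat) →
      (∀ y, M' y = true ↔ ∃ i, M i = true ∧ P i = y) →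
      Maps h (pairB p (pairB x (pairB a b))) (pairB a fun y => (M' y).toNat) := by
  have h1 := primrec_erWord n
  have h2 := primrec_idxBound n
  have h3 : Primrec fun y : List ℕ × ℕ × ℕ =>
      erWord n ((List.range y.2.2).map fun m => y.1.getD (2 * m) 0)
        ((List.range y.2.2).map fun m => y.1.getD (2 * (2 * m) + 1) 0) (y.2.1 / 2 + 1) :=
    h1.comp (by fun_prop : Primrec fun y : List ℕ × ℕ × ℕ =>
      ((List.range y.2.2).map (fun m => y.1.getD (2 * m) 0),
        (List.range y.2.2).map (fun m => y.1.getD (2 * (2 * m) + 1) 0), y.2.1 / 2 + 1))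
  have h4 : Primrec fun y : (List ℕ × ℕ × ℕ) × List ℕ =>
      ((List.range (y.1.2.1 / 2 + 1)).any fun i => decide (y.2.getD i 0 = y.1.2.1 / 2) &&
        decide (y.1.1.getD (2 * (2 * (2 * i + 1) + 1) + 1) 0 = 1)).toNat := by fun_prop
  -- As `P` is strictly increasing, `y = P i` forces `i ≤ y`, so the chain of length `y + 1` decides
  -- membership of `y`. The length `8 * s + 8` covers the first `s` letters of `p` and `x` and, as
  -- `y < s`, the bits of `b` up to `y`, which stand at positions `8 * i + 7`.
  obtain ⟨h, hh, Hh⟩ := exists_wordMap (fun u m s => if m % 2 = 0 then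
      u[2 * (2 * (2 * (m / 2)) + 1) + 1]?
    else if 8 * s + 8 ≤ u.length then if idxBound n (m / 2 + 1) ≤ s then
      (erWord n ((List.range s).map fun m => u.getD (2 * m) 0)
        ((List.range s).map fun m => u.getD (2 * (2 * m) + 1) 0) (m / 2 + 1)).map fun L =>
          ((List.range (m / 2 + 1)).any fun i => decide (L.getD i 0 = m / 2) &&
            decide (u.getD (2 * (2 * (2 * i + 1) + 1) + 1) 0 = 1)).toNat
      else none else none) (by fun_prop)
  refine ⟨h, hh, fun p x a b P M M' hP hc hb hM' => ?_⟩
  set Z := pairB p (pairB x (pairB a b)) with hZ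
  have hp : ∀ m, Z (2 * m) = p m := fun m => pairB_left _ _ m
  have hx : ∀ m, Z (2 * (2 * m) + 1) = x m := fun m => by rw [hZ, pairB_right, pairB_left]
  have ha : ∀ m, Z (2 * (2 * (2 * m) + 1) + 1) = a m := fun m => by
    rw [hZ, pairB_right, pairB_right, pairB_left]
  have hb' : ∀ m, Z (2 * (2 * (2 * m + 1) + 1) + 1) = b m := fun m => by
    rw [hZ, pairB_right, pairB_right, pairB_right]
  have hval : ∀ l s y, 8 * s + 8 ≤ l → y + 1 ≤ s →
      ((List.range (y + 1)).any fun i => decide ((initSeg P (y + 1)).getD i 0 = y) &&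
        decide ((initSeg Z l).getD (2 * (2 * (2 * i + 1) + 1) + 1) 0 = 1)) = M' y := by
    intro l s y hl hy
    rw [Bool.eq_iff_iff, hM', List.any_eq_true]
    simp only [List.mem_range, Bool.and_eq_true, decide_eq_true_eq]
    constructor
    · rintro ⟨i, hi, e1, e2⟩
      rw [initSeg_getD P hi] at e1
      rw [initSeg_getD Z (by omega), hb', hb] at e2
      exact ⟨i, Bool.toNat_eq_one.mp e2, e1⟩
    · rintro ⟨i, hi, rfl⟩
      have := hP.le_apply (x := i)
      refine ⟨i, by omega, initSeg_getD P (by omega) 0, ?_⟩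
      rw [initSeg_getD Z (by omega), hb', hb, hi]
      rfl
  have hsegp : ∀ l s, 8 * s + 8 ≤ l →
      (List.range s).map (fun m => (initSeg Z l).getD (2 * m) 0) = initSeg p s :=
    fun l s hl => List.map_congr_left fun m hm => by
      have := List.mem_range.mp hm
      rw [initSeg_getD Z (by omega), hp]
  have hsegx : ∀ l s, 8 * s + 8 ≤ l →
      (List.range s).map (fun m => (initSeg Z l).getD (2 * (2 * m) + 1) 0) = initSeg x s :=
    fun l s hl => List.map_congr_left fun m hm => by
      have := List.mem_range.mp hm
      rw [initSeg_getD Z (by omega), hx]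
  refine Hh _ _ (fun m => ?_) fun m l s v hv => ?_
  · by_cases hm : m % 2 = 0
    · refine ⟨2 * (2 * (2 * (m / 2)) + 1) + 2, 0, ?_⟩
      rw [if_pos hm, initSeg_getElem?_of_lt Z (by omega), ha]
      simp [pairB, hm]
    · set y := m / 2 with hy
      -- Large enough to contain the prescription for this chain and the colors of all sets compared
      -- in building it.
      set s := idxBound n (y + 1) + idxBound (n + 1) (P (y + 1) + 1) with hs
      refine ⟨8 * s + 8, s, ?_⟩
      have hw : erWord n (initSeg p s) (initSeg x s) (y + 1) = some (initSeg P (y + 1)) := by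
        refine erWord_iff.mpr ⟨(erChain_initSeg_iff (by omega)).mpr (hc _), fun b hb => ?_⟩
        obtain ⟨i, hi, rfl⟩ := List.mem_map.mp hb
        have := hP (List.mem_range.mp hi)
        exact (idxBound_mono (n + 1) (show P i + 1 ≤ P (y + 1) + 1 by omega)).trans (by omega)
      rw [if_neg hm, if_pos (by simp), if_pos (by omega), hsegp _ s le_rfl, hsegx _ s le_rfl, hw]
      have hys : y + 1 ≤ s := (le_idxBound n (y + 1) hn).trans (by omega)
      simp only [Option.map_some, hval _ s y le_rfl hys]
      simp only [pairB, hm, if_false, ← hy]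
  · by_cases hm : m % 2 = 0
    · rw [if_pos hm] at hv
      obtain ⟨-, rfl⟩ := eq_of_initSeg_getElem? hv
      rw [ha]
      simp [pairB, hm]
    · rw [if_neg hm] at hv
      set y := m / 2 with hy
      split_ifs at hv with h5 h6
      rw [length_initSeg] at h5
      rw [hsegp _ s h5, hsegx _ s h5] at hv
      obtain ⟨L, hL, rfl⟩ := Option.map_eq_some_iff.mp hv
      have hL' := (erChain_initSeg_iff h6).mp (erWord_iff.mp hL).1
      obtain rfl := hL'.unique (hc _)
      rw [hval _ s y h5 ((le_idxBound n (y + 1) hn).trans h6)]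
      simp only [pairB, hm, if_false, ← hy]

/-- The low basis theorem merges the choice of a prescription with the passage to an instance of
WKL^(n), so only one jump is added. -/
theorem CRT_succ_sRed {n : ℕ} (hn : 1 ≤ n) (ih : SRed (CRT n ⊤) (WKL.iterJump n)) :
    SRed (CRT (n + 1) ⊤) (WKL.iterJump (n + 1)) := by
  refine WRed.sRed_iterJump_WKL ?_
  -- The chosen prescription `x` is never computed by the preprocessing; the identity factor makes
  -- the solution return it, and the greedy sequence is recomputed from it.
  obtain ⟨k₁, h₁, hk₁, hh₁, H₁⟩ := ih.prodId.trans (iterJump_WKL_prodId_sRed n)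
  obtain ⟨n', rfl⟩ := Nat.exists_eq_add_of_le' hn
  rw [iterJump_succ] at H₁ ⊢
  rw [iterJump_succ]
  obtain ⟨k, hk, Hk⟩ := exists_wordMap_limTree (θ := erTest (n' + 1)) (by
    have h2 := primrec_idxBound (n' + 1)
    have h3 : Primrec fun x : (List ℕ × List ℕ) × ℕ => erWord (n' + 1) x.1.1 x.1.2 x.2 :=
      (primrec_erWord (n' + 1)).comp
        (by fun_prop : Primrec fun x : (List ℕ × List ℕ) × ℕ => (x.1.1, x.1.2, x.2))
    unfold erTest
    fun_prop)
  obtain ⟨h, hh, Hh⟩ := exists_wordMap_erImage hn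
  -- `x` is used twice: as the data to be carried along and as the name of the n-coloring to be
  -- solved.
  obtain ⟨dup, hdup, Hdup⟩ := exists_wordMap_pair isWordMap_id isWordMap_id
  obtain ⟨π₁, hπ₁, Hπ₁⟩ := exists_wordMap_fst
  obtain ⟨π₂, hπ₂, Hπ₂⟩ := exists_wordMap_snd
  obtain ⟨m, hm, Hm⟩ := exists_wordMap_pair hπ₁ (hh₁.comp hπ₂)
  refine wRed_jump_jump_of_lowBasis primrec_inTree hk (hk₁.comp hdup) (hh.comp hm)
    fun p c hp _ => ?_
  obtain ⟨K, hK⟩ := exists_isGreatest_range (bounded_of_names hp)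
  obtain ⟨q, t, hq, hl, hsol⟩ := Hk p K hK (by
    intro w s s' hs h
    rw [erTest_iff hn] at h ⊢
    intro j hj
    obtain ⟨L, hL, hb⟩ := h j hj
    exact ⟨L, hL, fun b hbL => (hb b hbL).trans hs⟩)
  simp only [exists_erTest_iff hn] at hsol
  refine ⟨q, t, hq, hl, ?_, fun x hx => ?_⟩
  · obtain ⟨d, hd, hc⟩ := exists_erChain (n' + 1) (p := p) (K := K) fun m => hK.2 ⟨m, rfl⟩
    exact ⟨d, (hsol d).mpr ⟨hd, hc⟩⟩
  · obtain ⟨hxK, hchain⟩ := (hsol x).mp hx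
    obtain ⟨d, hd⟩ := exists_coloring hn (k := ⊤) (fun m => ENat.natCast_lt_top (x m)) ⟨K, hxK⟩
    obtain ⟨P, hP, hc, hok⟩ := exists_of_erChain hchain
    obtain ⟨y, hy⟩ := mem_dom_CRT hn d
    obtain ⟨v, y', hv, hvy, hdom, H₁⟩ := H₁ (pairB x x) (x, d) ⟨x, x, rfl, rfl, hd⟩
      ⟨(x, y), rfl, hy⟩
    refine ⟨v, y', hv.comp hk₁ hdup (Hdup _ _ _ (maps_id x) (maps_id x)), hvy, hdom,
      fun r z hr hz => ?_⟩
    obtain ⟨s, ⟨x', ⟨⟨j, hj⟩, M⟩⟩, hs, hsn, hx', hM⟩ := H₁ r z hr hz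
    obtain ⟨x'', s', rfl, hx'', a, b, rfl, ha, hb⟩ := hsn
    replace hx' : x' = x := hx'
    replace hx'' : x'' = x' := hx''
    subst hx''
    subst hx'
    have hom := (homogeneousWithColor_iff (c := d) hd).mp hM
    classical
    let M' : ℕ → Bool := fun y => decide (∃ i, M i = true ∧ P i = y)
    have hM' : ∀ y, M' y = true ↔ ∃ i, M i = true ∧ P i = y := fun y => by simp [M']
    refine ⟨_, (⟨j, hj⟩, M'), Maps.comp hh hm (Hh p _ a b P M M' hP hc hb hM')
      (Hm _ _ _ (Hπ₁ p r) (hs.comp hh₁ hπ₂ (Hπ₂ p r))), ⟨a, _, rfl, ha, fun _ => rfl⟩, ?_⟩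
    exact (homogeneousWithColor_iff (c := c) hp).mpr (hom.image hP hok hM')

theorem CRT_sRed_iterJump_WKL {n : ℕ} (hn : 1 ≤ n) (k : ℕ∞) :
    SRed (CRT n k).parallelization (WKL.iterJump n) := by
  have h : SRed (CRT n ⊤) (WKL.iterJump n) := by
    induction n, hn using Nat.le_induction with
    | base => exact CRT_one_sRed
    | succ n hn ih => exact CRT_succ_sRed hn ih
  exact ((CRT_mono n le_top).trans h).parallelization.trans (iterJump_WKL_parallelization_sRed n)

end Weihrauch

/-! ### Assembly of the equivalences -/

open Weihrauch Weihrauch.Problem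

theorem corollary4p19 (n : ℕ) (k : ℕ∞) (hk : 2 ≤ k) :
    (1 ≤ n →
      Weihrauch.Problem.EquivW (Weihrauch.RT n k).parallelization
        (Weihrauch.WKL.iterJump n) ∧
      Weihrauch.Problem.EquivSW (Weihrauch.WKL.iterJump n)
        (Weihrauch.CRT n k).parallelization) ∧
    (2 ≤ n →
      Weihrauch.Problem.EquivW (Weihrauch.SRT n k).parallelization
        (Weihrauch.WKL.iterJump n) ∧
      Weihrauch.Problem.EquivSW (Weihrauch.WKL.iterJump n)
        (Weihrauch.CSRT n k).parallelization) := by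
  constructor
  · intro hn
    have hup := CRT_sRed_iterJump_WKL hn k
    have hlow := (iterJump_WKL_sRed_CRT hn).trans (CRT_mono n hk).parallelization
    exact ⟨⟨((RT_sRed_CRT n k).parallelization.trans hup).wRed.leW,
      (hlow.trans_wRed (CRT_wRed_RT n k).parallelization).leW⟩, hlow.leSW, hup.leSW⟩
  · intro hn
    have hup := CRT_sRed_iterJump_WKL (show 1 ≤ n by omega) k
    have hlow := (iterJump_WKL_sRed_CSRT hn).trans (CSRT_mono n hk).parallelization
    exact ⟨⟨(((SRT_sRed_RT n k).trans (RT_sRed_CRT n k)).parallelization.trans hup).wRed.leW,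
      (hlow.trans_wRed (CSRT_wRed_SRT n k).parallelization).leW⟩, hlow.leSW,
      ((CSRT_sRed_CRT n k).parallelization.trans hup).leSW⟩
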